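/- **Setting.** Let $(V,Q)$ be a rational quadratic space of signature $(1,2)$ with bilinear form $(x,y)=Q(x+y)-Q(x)-Q(y)$, and fix an isometry of $V(\mathbb R)$ with the space of real $2\times2$ matrices of trace $0$ with quadratic form $\det$. Let $L\subset V$ be an even lattice with dual lattice $L'$, let $H=\mathrm{GSpin}(V)$ and $h\in H(\mathbb A_f)$, and for $\mu\in L'/L$ put $h(L+\mu)=V\cap h(\hat L+\mu)$. For $z=x+iy\in\mathbb C\setminus\mathbb R$ put $$Z(z)=\begin{pmatrix}z&-z^2\\1&-z\end{pmatrix},\qquad Z^\perp(z)=\frac1y\begin{pmatrix}x&-|z|^2\\1&-x\end{pmatrix}.$$ The point $z$ corresponds to the oriented negative plane spanned by $\mathrm{Re}\,Z(z),\mathrm{Im}\,Z(z)$ in $V(\mathbb R)$, so $\mathbb C\setminus\mathbb R$ is identified with the space $\mathbb D$ of all oriented negative planes; $\lambda_z$ and $\lambda_{z^\perp}$ denote the projections of $\lambda$ to this plane and to its orthogonal complement $\mathbb RZ^\perp(z)$. Points of the Shimura curve $X_K=H(\mathbb Q)\backslash\mathbb D\times H(\mathbb A_f)/K$ are represented by pairs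 $(z,h)\in\mathbb D\times H(\mathbb A_f)$. Let $\ell\ge0$ and $k\ge1$ be integers, let $\mathrm H_\ell(\xi)=(2\xi-\frac{d}{d\xi})^\ell\cdot1$ be the Hermite polynomial, write $\mathbf e(x)=e^{2\pi ix}$, and for $\tau=u+iv\in\mathbb H$ let $\Theta_L^{(\ell,k)}(\tau,z,h)=\sum_{\mu\in L'/L}\theta_\mu\phi_\mu$ with $$\theta_\mu=v^{k+1-\ell/2}y^{-2k}\sum_{\lambda\in h(L+\mu)}2^{-\ell}\,\mathrm H_\ell\big(\sqrt{\pi v}\,(\lambda,Z^\perp(z))\big)\big(\lambda,-\tfrac1{\sqrt2}Z(\bar z)\big)^k\,\mathbf e\big(Q(\lambda_{z^\perp})\tau+Q(\lambda_z)\bar\tau\big).$$ Let $f=\sum_\mu f_\mu\phi_\mu$ be a weakly holomorphic modular form of weight $k-\ell+\frac12$ for the Weil representation of $\mathrm{Mp}_2(\mathbb Z)$ attached to $L^-=(L,-Q)$, and define $$\Phi^{(\ell,k)}(f,z,h)=\int^{\mathrm{reg}}\sum_{\mu\in L'/L}f_\mu(\tau)\,\theta_\mu(\tau,z,h).$$ Here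 $\int^{\mathrm{reg}}F$ is the constant term at $s=0$ of the meromorphic continuation to $\mathbb C$ of $\lim_{T\to\infty}\int_{\mathcal F_T}F(\tau)v^{-s}\frac{du\,dv}{v^2}$, $\mathcal F_T$ being the standard fundamental domain of $\mathrm{SL}_2(\mathbb Z)$ truncated at height $T$; it is said to exist if for $\mathrm{Re}(s)\gg0$ this limit exists and is holomorphic in $s$, and it has such a continuation. **Proposition.** Let $(z_0,h_0)\in\mathbb D\times H(\mathbb A_f)$ be arbitrary (in particular, it may be a CM point at which $\Phi^{(\ell,k)}$ is singular). Then the regularized integral defining $\Phi^{(\ell,k)}(f,z_0,h_0)$ exists. Moreover, put $w=\frac{z-z_0}{z-\bar z_0}$, so that $z=\frac{z_0-w\bar z_0}{1-w}$. For all sufficiently small $w\ne0$ there is an absolutely convergent expansion $$(1-w)^{-2k}\,\Phi^{(\ell,k)}(f,z,h_0)=\sum_{m,n\gg-\infty}\big(a_{m,n}+b_{m,n}\log|w|^2\big)\,w^m\bar w^n,$$ where all $b_{m,n}$ vanish if $\ell<2k$ (so that it is then a Laurent expansion in $w,\bar w$), and its constant term $\mathrm{CT}^{(2k)}_{z_0}(\Phi^{(\ell,k)}):=a_{0,0}$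 satisfies $$\mathrm{CT}^{(2k)}_{z_0}\big(\Phi^{(\ell,k)}(f,\cdot,h_0)\big)=\Phi^{(\ell,k)}(f,z_0,h_0).$$ -/

import Mathlib

open UpperHalfPlane MeasureTheory Filter Topology
open scoped TensorProduct

noncomputable section

namespace OverReg

/-! ### The quadratic space `V`, its real points and its finite adelic points -/

/-- The real quadratic space of real `2 × 2` matrices of trace zero, with the determinant as
quadratic form; it has signature `(1, 2)`. -/
abbrev M20 : Type := LinearMap.ker (Matrix.traceLinearMap (Fin 2) ℝ ℝ)

/-- The determinant as a quadratic form on the trace zero matrices; on these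
`det X = -tr (X * X) / 2`. -/
def detForm : QuadraticForm ℝ M20 :=
  QuadraticMap.ofPolar (fun X => (X : Matrix (Fin 2) (Fin 2) ℝ).det)
    (fun a X => by simp [sq])
    (fun X X' Y => by
      simp only [QuadraticMap.polar, Matrix.det_fin_two, Submodule.coe_add, Matrix.add_apply]
      ring)
    (fun a X Y => by
      simp only [QuadraticMap.polar, Matrix.det_fin_two, Submodule.coe_add, Matrix.add_apply,
        Submodule.coe_smul, Matrix.smul_apply, smul_eq_mul]
      ring)

/-- The ring of finite adeles of `ℚ`. -/
abbrev Af : Type := IsDedekindDomain.FiniteAdeleRing ℤ ℚ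

/-- Membership of a finite adele in the profinite completion of `ℤ`. -/
def IsIntegralAdele (a : Af) : Prop := ∀ p, a p ∈ p.adicCompletionIntegers ℚ

/-- The group `GSpin` of a quadratic module: the units `g` of the even Clifford algebra with
`g M g⁻¹ = M`. -/
def GSpin {R M : Type*} [CommRing R] [AddCommGroup M] [Module R M] (q : QuadraticForm R M) :
    Subgroup (CliffordAlgebra q)ˣ where
  carrier := {g | (g : CliffordAlgebra q) ∈ CliffordAlgebra.even q ∧
    ((g⁻¹ : (CliffordAlgebra q)ˣ) : CliffordAlgebra q) ∈ CliffordAlgebra.even q ∧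
    (∀ v : M, ∃ v' : M, (g : CliffordAlgebra q) * CliffordAlgebra.ι q v *
      ((g⁻¹ : (CliffordAlgebra q)ˣ) : CliffordAlgebra q) = CliffordAlgebra.ι q v') ∧
    (∀ v : M, ∃ v' : M, ((g⁻¹ : (CliffordAlgebra q)ˣ) : CliffordAlgebra q) *
      CliffordAlgebra.ι q v * (g : CliffordAlgebra q) = CliffordAlgebra.ι q v')}
  one_mem' := by
    refine ⟨?_, ?_, fun v => ⟨v, by simp⟩, fun v => ⟨v, by simp⟩⟩
    · simp
    · simp
  mul_mem' := by
    rintro g g' ⟨h1, h2, h3, h4⟩ ⟨h1', h2', h3', h4'⟩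
    refine ⟨?_, ?_, fun v => ?_, fun v => ?_⟩
    · simpa using mul_mem h1 h1'
    · simpa using mul_mem h2' h2
    · obtain ⟨v', hv'⟩ := h3' v
      obtain ⟨v'', hv''⟩ := h3 v'
      refine ⟨v'', ?_⟩
      rw [← hv'', ← hv']
      simp [mul_assoc]
    · obtain ⟨v', hv'⟩ := h4 v
      obtain ⟨v'', hv''⟩ := h4' v'
      refine ⟨v'', ?_⟩
      rw [← hv'', ← hv']
      simp [mul_assoc]
  inv_mem' := by
    rintro g ⟨h1, h2, h3, h4⟩
    exact ⟨h2, by simpa using h1, h4, by simpa using h3⟩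

section Lattice

variable {V : Type*} [AddCommGroup V] [Module ℚ V]

/-- An even lattice: a finitely generated subgroup that spans `V` over `ℚ` and on which the
quadratic form takes integral values. -/
structure IsEvenLattice (Q : QuadraticForm ℚ V) (L : Submodule ℤ V) : Prop where
  fg : L.FG
  span_eq_top : Submodule.span ℚ (L : Set V) = ⊤
  integral : ∀ x ∈ L, ∃ n : ℤ, Q x = n

/-- The dual lattice `L'` with respect to `(x, y) = Q (x + y) - Q x - Q y`. -/
abbrev dualLattice (Q : QuadraticForm ℚ V) (L : Submodule ℤ V) : Submodule ℤ V :=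
  LinearMap.BilinForm.dualSubmodule (QuadraticMap.polarBilin Q) L

/-- The discriminant group `L' / L` (a finite group if `L` is an even lattice in a nondegenerate
space). -/
abbrev Disc (Q : QuadraticForm ℚ V) (L : Submodule ℤ V) : Type _ :=
  dualLattice Q L ⧸ L.submoduleOf (dualLattice Q L)

/-- The group `L ⊗ ℤ^` inside `V ⊗ Af`. -/
def latticeHat (L : Submodule ℤ V) : AddSubgroup (Af ⊗[ℚ] V) :=
  AddSubgroup.closure {t | ∃ a : Af, IsIntegralAdele a ∧ ∃ x ∈ L, t = a ⊗ₜ[ℚ] x}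

/-- The set `h (L + μ) = V(ℚ) ∩ h (L^ + μ)`, where `h` acts on `V ⊗ Af` by conjugation in the
Clifford algebra. -/
def cosetH (Q : QuadraticForm ℚ V) (L : Submodule ℤ V) (h : GSpin (Q.baseChange Af))
    (μ : Disc Q L) : Set V :=
  {lam | ∃ x : dualLattice Q L, Submodule.Quotient.mk x = μ ∧ ∃ t ∈ latticeHat L,
    CliffordAlgebra.ι (Q.baseChange Af) ((1 : Af) ⊗ₜ[ℚ] lam) =
      (h : (CliffordAlgebra (Q.baseChange Af))ˣ).val *
        CliffordAlgebra.ι (Q.baseChange Af) ((1 : Af) ⊗ₜ[ℚ] (x : V) + t) *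
        ((h : (CliffordAlgebra (Q.baseChange Af))ˣ)⁻¹).val}

/-! ### Weakly holomorphic vector-valued modular forms -/

/-- `ee x = exp (2 π i x)`. -/
def ee (x : ℂ) : ℂ := Complex.exp (2 * Real.pi * Complex.I * x)

/-- `f = ∑ μ, f_μ φ_μ` is a weakly holomorphic modular form of weight `κ` for the Weil
representation of the metaplectic cover of `SL₂(ℤ)` attached to `L⁻ = (L, -Q)`, for `(L, Q)` of
signature `(1, 2)`.  The Weil representation is given on the two standard generators by
`ρ(T) φ_ν = e(-Q(ν)) φ_ν` and `ρ(S) φ_ν = √i ^ (-1) / √|L'/L| * ∑ μ, e((μ, ν)) φ_μ`.  The last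
condition is the Fourier expansion, with finitely many terms of negative exponent. -/
structure IsWeaklyHolomorphic (Q : QuadraticForm ℚ V) (L : Submodule ℤ V) (κ : ℝ)
    (f : ℍ → Disc Q L → ℂ) : Prop where
  holo : ∀ μ, DifferentiableOn ℂ (fun τ : ℂ => f (UpperHalfPlane.ofComplex τ) μ)
    {τ : ℂ | 0 < τ.im}
  transf_T : ∀ (τ : ℍ) (x : dualLattice Q L),
    f ((1 : ℝ) +ᵥ τ) (Submodule.Quotient.mk x) =
      ee (-((Q (x : V) : ℚ) : ℂ)) * f τ (Submodule.Quotient.mk x)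
  transf_S : ∀ (τ : ℍ) (x : dualLattice Q L),
    f (ModularGroup.S • τ) (Submodule.Quotient.mk x) =
      (τ : ℂ) ^ (κ : ℂ) * (ee (-1 / 8) / (Real.sqrt (Nat.card (Disc Q L)) : ℂ)) *
        ∑ᶠ ν : Disc Q L,
          ee ((QuadraticMap.polar Q (x : V) ((Quotient.out ν : dualLattice Q L) : V) : ℚ) : ℂ) *
            f τ ν
  fourier : ∀ x : dualLattice Q L, ∃ c : ℤ → ℂ, (∃ N : ℤ, ∀ n < N, c n = 0) ∧
    ∀ τ : ℍ, HasSum (fun n : ℤ => c n * ee (((n : ℂ) - ((Q (x : V) : ℚ) : ℂ)) * τ))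
      (f τ (Submodule.Quotient.mk x))

end Lattice

/-! ### The theta kernel -/

/-- The physicists' Hermite polynomials, `H_ℓ = (2 ξ - d/dξ) ^ ℓ 1`. -/
def hermiteH : ℕ → Polynomial ℝ
  | 0 => 1
  | n + 1 => 2 * Polynomial.X * hermiteH n - Polynomial.derivative (hermiteH n)

/-- `Z(z)`; its real and imaginary parts span the negative plane of `z`. -/
def Zmat (z : ℂ) : Matrix (Fin 2) (Fin 2) ℂ := !![z, -z ^ 2; 1, -z]

/-- `Z^⊥(z)`, a vector of determinant `1` spanning the orthogonal complement of the negative plane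
of `z`. -/
def Zperp (z : ℂ) : Matrix (Fin 2) (Fin 2) ℝ :=
  z.im⁻¹ • !![z.re, -Complex.normSq z; 1, -z.re]

/-- The bilinear form `(X, Y) = det (X + Y) - det X - det Y`. -/
def pair {R : Type*} [CommRing R] (X Y : Matrix (Fin 2) (Fin 2) R) : R :=
  QuadraticMap.polar Matrix.det X Y

/-- The projection of `X` to the positive line `ℝ Z^⊥(z)`. -/
def projPos (z : ℂ) (X : Matrix (Fin 2) (Fin 2) ℝ) : Matrix (Fin 2) (Fin 2) ℝ :=
  (pair X (Zperp z) / 2) • Zperp z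

/-- The summand of the theta kernel at a real vector `X`, that is
`2 ^ (-ℓ) H_ℓ(√(π v) (X, Z^⊥(z))) (X, -Z(z̄) / √2) ^ k e(Q(X_{z^⊥}) τ + Q(X_z) τ̄)`. -/
def thetaTerm (ℓ k : ℕ) (τ : ℍ) (z : ℂ) (X : Matrix (Fin 2) (Fin 2) ℝ) : ℂ :=
  (((2 : ℝ) ^ (-(ℓ : ℤ)) *
      (hermiteH ℓ).eval (Real.sqrt (Real.pi * τ.im) * pair X (Zperp z)) : ℝ) : ℂ) *
    pair (X.map Complex.ofReal)
      ((-(1 / (Real.sqrt 2 : ℂ))) • Zmat (starRingEnd ℂ z)) ^ k *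
    ee (((projPos z X).det : ℂ) * τ + ((X - projPos z X).det : ℂ) * starRingEnd ℂ (τ : ℂ))

section Lift

variable {V : Type*} [AddCommGroup V] [Module ℚ V]

/-- The `φ_μ`-component of the theta kernel `Θ_L^{(ℓ, k)}(τ, z, h)`.  The point `z ∈ ℂ ∖ ℝ`
stands for the negative plane `ℝ Re Z(z) ⊕ ℝ Im Z(z)`, oriented by this basis. -/
def theta (Q : QuadraticForm ℚ V) (σ : (Q.baseChange ℝ).IsometryEquiv detForm)
    (L : Submodule ℤ V) (ℓ k : ℕ) (τ : ℍ) (z : ℂ) (h : GSpin (Q.baseChange Af))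
    (μ : Disc Q L) : ℂ :=
  ((τ.im ^ ((k : ℝ) + 1 - (ℓ : ℝ) / 2) * z.im ^ (-(2 * k : ℤ)) : ℝ) : ℂ) *
    ∑' lam : cosetH Q L h μ,
      thetaTerm ℓ k τ z ((σ ((1 : ℝ) ⊗ₜ[ℚ] (lam : V)) : M20) : Matrix (Fin 2) (Fin 2) ℝ)

/-- The pairing `⟨f(τ), Θ_L^{(ℓ, k)}(τ, z, h)⟩`. -/
def integrand (Q : QuadraticForm ℚ V) (σ : (Q.baseChange ℝ).IsometryEquiv detForm)
    (L : Submodule ℤ V) (ℓ k : ℕ) (f : ℍ → Disc Q L → ℂ) (z : ℂ)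
    (h : GSpin (Q.baseChange Af)) (τ : ℍ) : ℂ :=
  ∑ᶠ μ : Disc Q L, f τ μ * theta Q σ L ℓ k τ z h μ

end Lift

/-! ### Regularized integrals -/

/-- The standard fundamental domain of `SL₂(ℤ)`, truncated at height `T`. -/
def truncFD (T : ℝ) : Set ℍ := {τ | τ ∈ ModularGroup.fd ∧ τ.im ≤ T}

/-- `c` is the constant term of the Laurent expansion of the meromorphic function `G` at `0`. -/
def IsConstTermAtZero (G : ℂ → ℂ) (c : ℂ) : Prop :=
  ∃ (p : Polynomial ℂ) (g : ℂ → ℂ), AnalyticAt ℂ g 0 ∧ g 0 = c ∧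
    ∀ᶠ s in 𝓝[≠] (0 : ℂ), G s = g s + s⁻¹ * p.eval s⁻¹

/-- The regularized integral of `F` exists and equals `c`: for `Re s ≫ 0` the limit as `T → ∞` of
the integrals of `F(τ) v ^ (-s) dμ(τ)` over the truncated fundamental domains exists and is
holomorphic in `s`, it continues meromorphically to `ℂ`, and the constant term of the continuation
at `s = 0` is `c`.  Here `dμ = du dv / v ^ 2` is the standard measure of `ℍ`. -/
def HasRegIntegral (F : ℍ → ℂ) (c : ℂ) : Prop :=
  ∃ (G : ℂ → ℂ) (s₀ : ℝ), MeromorphicOn G Set.univ ∧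
    DifferentiableOn ℂ G {s : ℂ | s₀ < s.re} ∧
    (∀ s : ℂ, s₀ < s.re →
      (∀ T : ℝ, IntegrableOn (fun τ : ℍ => F τ * (τ.im : ℂ) ^ (-s)) (truncFD T)) ∧
      Tendsto (fun T : ℝ => ∫ τ in truncFD T, F τ * (τ.im : ℂ) ^ (-s)) atTop (𝓝 (G s))) ∧
    IsConstTermAtZero G c

open Classical in
/-- The value of the regularized integral (and `0` if it does not exist). -/
def regIntegral (F : ℍ → ℂ) : ℂ :=
  if h : ∃ c, HasRegIntegral F c then h.choose else 0

/-- The regularized theta lift `Φ^{(ℓ, k)}(f, z, h)`. -/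
def thetaLift {V : Type*} [AddCommGroup V] [Module ℚ V] (Q : QuadraticForm ℚ V)
    (σ : (Q.baseChange ℝ).IsometryEquiv detForm) (L : Submodule ℤ V) (ℓ k : ℕ)
    (f : ℍ → Disc Q L → ℂ) (z : ℂ) (h : GSpin (Q.baseChange Af)) : ℂ :=
  regIntegral (integrand Q σ L ℓ k f z h)

/-! ### Laurent expansions -/

/-- `(1 - w) ^ (-κ) * Φ((z₀ - w z̄₀) / (1 - w))`, the function `Φ` of weight `κ` in the local
coordinate `w = (z - z₀) / (z - z̄₀)` at `z₀`. -/
def localForm (Φ : ℂ → ℂ) (κ : ℤ) (z₀ w : ℂ) : ℂ :=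
  (1 - w) ^ (-κ) * Φ ((z₀ - w * starRingEnd ℂ z₀) / (1 - w))

/-- On a punctured disc about `0`,
`g w = ∑_{m, n ≫ -∞} (a m n + b m n * log |w|²) w ^ m w̄ ^ n`, absolutely convergent.  For `b = 0`
this is a Laurent expansion in `w` and `w̄`; the coefficients are determined by `g`, and the
constant term of the expansion is `a (0, 0)`. -/
def HasLogLaurentExpansion (g : ℂ → ℂ) (a b : ℤ × ℤ → ℂ) : Prop :=
  (∃ N : ℤ, ∀ p : ℤ × ℤ, p.1 < N ∨ p.2 < N → a p = 0 ∧ b p = 0) ∧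
  ∃ r : ℝ, 0 < r ∧ ∀ w : ℂ, 0 < ‖w‖ → ‖w‖ < r →
    HasSum (fun p : ℤ × ℤ => (a p + b p * (Real.log (‖w‖ ^ 2) : ℂ)) *
      (w ^ p.1 * starRingEnd ℂ w ^ p.2)) (g w)

end OverReg

end

/-! Fix a component μ and a vector λ in h(L + μ). The dependence of a theta summand on z and z̄ is
polarized: z̄ becomes an independent variable z₂, so that a summand is holomorphic in (z₁, z₂) near
(z₀, z̄₀). Up to the factor y, `qf` is the pairing with Z, `pf` is the pairing with Z^⊥, and `ypol`
replaces y.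

The fundamental domain is cut at height 1. The compact piece gives a locally uniformly convergent
sum of holomorphic functions. Over the strip above it, integration over u extracts the coefficient
c(m) of f with m = q - Q(λ), where q = Q(x) for a representative x of μ. What remains is the
integral over v > 1 of a power of v, a polynomial factor containing (λ, Z(z̄))^k, and exp(4πv
Q(λ_z)). This decays exponentially unless λ_z = 0; but if λ_z = 0 then (λ, Z(z̄))^k = 0, because k ≥
1. Hence the truncated integrals converge for every s to an entire function, at singular points too,
and the regularized value is simply its value at s = 0 (`hasRegIntegral_of_differentiable`,
`exists_bounds_at`).

For the expansion at z₀, only finitely many λ have c(m) ≠ 0 and λ_{z₀} = 0, since m is bounded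
below. For all other λ with c(m) ≠ 0, |(λ, Z(z₀))|² is bounded below by a multiple of 1 + |λ|²
(`exists_qf_lower`), so their polarized contribution is bounded and holomorphic on a bidisc and has
a double power series in w and w̄ (`exists_regular_expansion`). Its constant term is the whole lift
at z₀, because the omitted terms vanish there.

An omitted λ is a multiple of Z^⊥(z₀), and its contribution is explicit: w̄^k times a combination of
incomplete Gamma integrals in |w|² (`exists_singular_term`). Integration by parts shows that these
have the form ρ^(-k) A(ρ) + D(ρ) log ρ with ρ = |w|². The resulting monomials are w^(n-k) w̄^n, and
w^n w̄^(n+k) log|w|²; as k ≥ 1, none is the constant one. The logarithm needs an exponent of v that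
is at most -1, which does not occur if ℓ < 2k.

The arithmetic inputs are that Q is constant modulo ℤ on h(L + μ), that these vectors have bounded
denominators, so that sums over them converge, and that L'/L is finite. -/

namespace OverReg

/-! ### Holomorphic parameter integrals and double power series -/

/-- A parameter integral of holomorphic functions that are uniformly dominated is holomorphic. -/
theorem differentiableOn_integral_of_dominated {α : Type*} [MeasurableSpace α] {μ : Measure α}
    {U : Set ℂ} (hU : IsOpen U) {F : ℂ → α → ℂ} {g : α → ℝ}
    (hm : ∀ s ∈ U, AEStronglyMeasurable (F s) μ)
    (hd : ∀ᵐ a ∂μ, DifferentiableOn ℂ (fun s => F s a) U)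
    (hb : ∀ᵐ a ∂μ, ∀ s ∈ U, ‖F s a‖ ≤ g a) (hg : Integrable g μ) :
    DifferentiableOn ℂ (fun s => ∫ a, F s a ∂μ) U := by
  intro s₀ hs₀
  obtain ⟨ε, hε, hεU⟩ := Metric.isOpen_iff.1 hU s₀ hs₀
  have hε2 : 0 < ε / 2 := by positivity
  have hsub : ∀ x ∈ Metric.ball s₀ (ε / 2), Metric.closedBall x (ε / 2) ⊆ U := by
    intro x hx y hy
    apply hεU
    rw [Metric.mem_ball] at *
    rw [Metric.mem_closedBall] at hy
    linarith [dist_triangle y x s₀]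
  have hmem : ∀ x ∈ Metric.ball s₀ (ε / 2), x ∈ U := fun x hx =>
    hsub x hx (Metric.mem_closedBall_self hε2.le)
  have hderiv : ∀ᵐ a ∂μ, ∀ x ∈ Metric.ball s₀ (ε / 2),
      HasDerivAt (fun s => F s a) (deriv (fun s => F s a) x) x := by
    filter_upwards [hd] with a ha x hx
    exact (ha.differentiableAt (hU.mem_nhds (hmem x hx))).hasDerivAt
  -- Cauchy's estimate on circles of radius ε/2 turns the bound g for F into the bound g/(ε/2) for
  -- its derivative.
  have key := hasDerivAt_integral_of_dominated_loc_of_deriv_le (μ := μ) (F := F)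
    (F' := fun x a => deriv (fun s => F s a) x) (bound := fun a => g a / (ε / 2))
    (Metric.ball_mem_nhds s₀ hε2) ?_ ?_ ?_ ?_ (hg.div_const _) hderiv
  · exact key.2.differentiableAt.differentiableWithinAt
  · filter_upwards [hU.mem_nhds hs₀] with x hx using hm x hx
  · refine hg.mono' (hm s₀ hs₀) ?_
    filter_upwards [hb] with a ha using ha s₀ hs₀
  -- The derivative at s₀ is measurable in a as a limit of difference quotients along the points s₀
  -- + ε/(2(n+1)).
  · have hseq : Tendsto (fun n : ℕ => s₀ + ((ε / 2 / (n + 1) : ℝ) : ℂ)) atTop (𝓝[≠] s₀) := by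
      refine tendsto_nhdsWithin_iff.2 ⟨?_, Eventually.of_forall fun n => ?_⟩
      · have h1 : Tendsto (fun n : ℕ => ε / 2 / ((n : ℝ) + 1)) atTop (𝓝 0) := by
          have := (tendsto_one_div_add_atTop_nhds_zero_nat (𝕜 := ℝ)).const_mul (ε / 2)
          simpa [div_eq_mul_inv] using this
        have h2 := (Complex.continuous_ofReal.tendsto 0).comp h1
        simpa using h2.const_add s₀
      · have : (0 : ℝ) < ε / 2 / (n + 1) := by positivity
        simp only [Set.mem_compl_iff, Set.mem_singleton_iff, add_eq_left, Complex.ofReal_eq_zero]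
        exact this.ne'
    have hmemU : ∀ n : ℕ, s₀ + ((ε / 2 / (n + 1) : ℝ) : ℂ) ∈ U := by
      intro n
      apply hεU
      have h0 : (0 : ℝ) < ε / 2 / (n + 1) := by positivity
      rw [Metric.mem_ball, dist_eq_norm, add_sub_cancel_left, Complex.norm_real,
        Real.norm_of_nonneg h0.le]
      calc ε / 2 / (n + 1) ≤ ε / 2 := div_le_self hε2.le (by linarith [n.cast_nonneg (α := ℝ)])
        _ < ε := by linarith
    refine aestronglyMeasurable_of_tendsto_ae atTop
      (f := fun (n : ℕ) a => slope (fun s => F s a) s₀ (s₀ + ((ε / 2 / (n + 1) : ℝ) : ℂ))) ?_ ?_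
    · intro n
      simp only [slope_def_field]
      exact (((hm _ (hmemU n)).sub (hm _ hs₀)).mul aestronglyMeasurable_const).congr
        (Eventually.of_forall fun a => (div_eq_mul_inv _ _).symm)
    · filter_upwards [hderiv] with a ha
      exact (hasDerivAt_iff_tendsto_slope.1 (ha s₀ (Metric.mem_ball_self hε2))).comp hseq
  · filter_upwards [hd, hb] with a ha hba x hx
    refine Complex.norm_deriv_le_of_forall_mem_sphere_norm_le hε2 ?_ ?_
    · apply DifferentiableOn.diffContOnCl
      rw [closure_ball _ hε2.ne']
      exact ha.mono (hsub x hx)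
    · intro z hz
      exact hba z (hsub x hx (Metric.sphere_subset_closedBall hz))

/-- A bounded separately holomorphic function on a bidisc has a double power series expansion. -/
theorem exists_hasSum_of_separately_differentiable {F : ℂ → ℂ → ℂ} {R M : ℝ} (hR : 0 < R)
    (h1 : ∀ w₂ ∈ Metric.ball (0 : ℂ) R,
      DifferentiableOn ℂ (fun w₁ => F w₁ w₂) (Metric.ball 0 R))
    (h2 : ∀ w₁ ∈ Metric.ball (0 : ℂ) R,
      DifferentiableOn ℂ (fun w₂ => F w₁ w₂) (Metric.ball 0 R))
    (hM : ∀ w₁ ∈ Metric.ball (0 : ℂ) R, ∀ w₂ ∈ Metric.ball (0 : ℂ) R, ‖F w₁ w₂‖ ≤ M) :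
    ∃ a : ℕ × ℕ → ℂ, a (0, 0) = F 0 0 ∧
      ∀ w₁ ∈ Metric.ball (0 : ℂ) (R / 2), ∀ w₂ ∈ Metric.ball (0 : ℂ) (R / 2),
        HasSum (fun p : ℕ × ℕ => a p * (w₁ ^ p.1 * w₂ ^ p.2)) (F w₁ w₂) := by
  have hr : 0 < R / 2 := by positivity
  have hrR : R / 2 < R := by linarith
  have hcl : Metric.closedBall (0 : ℂ) (R / 2) ⊆ Metric.ball 0 R :=
    Metric.closedBall_subset_ball hrR
  have hsph : Metric.sphere (0 : ℂ) (R / 2) ⊆ Metric.ball 0 R :=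
    Metric.sphere_subset_closedBall.trans hcl
  have h0R : (0 : ℂ) ∈ Metric.ball (0 : ℂ) R := Metric.mem_ball_self hR
  have hM0 : 0 ≤ M := (norm_nonneg _).trans (hM 0 h0R 0 h0R)
  have hdc : ∀ {g : ℂ → ℂ}, DifferentiableOn ℂ g (Metric.ball 0 R) →
      DiffContOnCl ℂ g (Metric.ball 0 (R / 2)) := by
    intro g hg
    apply DifferentiableOn.diffContOnCl
    rw [closure_ball _ hr.ne']
    exact hg.mono hcl
  let D : ℕ → ℂ → ℂ := fun m w₂ => iteratedDeriv m (fun w₁ => F w₁ w₂) 0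
  have hDb : ∀ m, ∀ w₂ ∈ Metric.ball (0 : ℂ) R, ‖D m w₂‖ ≤ m.factorial * M / (R / 2) ^ m := by
    intro m w₂ hw₂
    exact Complex.norm_iteratedDeriv_le_of_forall_mem_sphere_norm_le m hr (hdc (h1 w₂ hw₂))
      fun z hz => hM z (hsph hz) w₂ hw₂
  -- Cauchy's formula writes each Taylor coefficient in w₁ as a circle integral that depends
  -- holomorphically on w₂, so it can be expanded once more in w₂.
  have hDd : ∀ m, DifferentiableOn ℂ (D m) (Metric.ball 0 R) := by
    intro m
    have hint : DifferentiableOn ℂ (fun w₂ => ∮ ζ in C(0, R / 2),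
        (1 / (ζ - 0) ^ (m + 1)) • F ζ w₂) (Metric.ball 0 R) := by
      simp only [circleIntegral, intervalIntegral.integral_of_le Real.two_pi_pos.le]
      have hne : ∀ θ, circleMap 0 (R / 2) θ ≠ 0 := fun θ => circleMap_ne_center hr.ne'
      refine differentiableOn_integral_of_dominated Metric.isOpen_ball
        (g := fun _ => R / 2 * (1 / (R / 2) ^ (m + 1) * M)) ?_ ?_ ?_ ?_
      · intro w₂ hw₂
        refine Continuous.aestronglyMeasurable ?_
        have hc : Continuous fun θ => F (circleMap 0 (R / 2) θ) w₂ :=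
          (h1 w₂ hw₂).continuousOn.comp_continuous (continuous_circleMap 0 (R / 2))
            fun θ => hsph (circleMap_mem_sphere 0 hr.le θ)
        simp only [deriv_circleMap, sub_zero, smul_eq_mul]
        refine Continuous.mul (by fun_prop) (Continuous.mul ?_ hc)
        exact continuous_const.div (by fun_prop) fun θ => pow_ne_zero _ (hne θ)
      · refine Eventually.of_forall fun θ => ?_
        simp only [smul_eq_mul]
        exact ((h2 _ (hsph (circleMap_mem_sphere 0 hr.le θ))).const_mul _).const_mul _
      · refine Eventually.of_forall fun θ w₂ hw₂ => ?_
        have hb := hM _ (hsph (circleMap_mem_sphere 0 hr.le θ)) w₂ hw₂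
        simp only [deriv_circleMap, norm_smul, sub_zero, norm_mul, norm_div, norm_pow,
          norm_circleMap_zero, Complex.norm_I, mul_one, norm_one, abs_of_pos hr]
        gcongr
      · exact integrable_const _
    have heq : ∀ w₂ ∈ Metric.ball (0 : ℂ) R, D m w₂ =
        (2 * Real.pi * Complex.I / m.factorial)⁻¹ * ∮ ζ in C(0, R / 2),
        (1 / (ζ - 0) ^ (m + 1)) • F ζ w₂ := by
      intro w₂ hw₂
      rw [(hdc (h1 w₂ hw₂)).circleIntegral_one_div_sub_center_pow_smul hr m, smul_eq_mul,
        inv_mul_cancel_left₀]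
      have := Nat.factorial_ne_zero m
      have := Real.pi_ne_zero
      simp_all
    exact (hint.const_mul _).congr heq
  let a : ℕ × ℕ → ℂ := fun p =>
    ((p.1.factorial : ℂ)⁻¹ * (p.2.factorial : ℂ)⁻¹) * iteratedDeriv p.2 (D p.1) 0
  have hab : ∀ p, ‖a p‖ ≤ M * ((R / 2)⁻¹ ^ p.1 * (R / 2)⁻¹ ^ p.2) := by
    intro p
    have := Complex.norm_iteratedDeriv_le_of_forall_mem_sphere_norm_le p.2 hr (hdc (hDd p.1))
      fun z hz => hDb p.1 z (hsph hz)
    have h1 : (p.1.factorial : ℝ) ≠ 0 := by exact_mod_cast Nat.factorial_ne_zero _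
    have h2 : (p.2.factorial : ℝ) ≠ 0 := by exact_mod_cast Nat.factorial_ne_zero _
    simp only [a, norm_mul, norm_inv, Complex.norm_natCast]
    calc _ ≤ ((p.1.factorial : ℝ)⁻¹ * (p.2.factorial : ℝ)⁻¹) *
        (p.2.factorial * (p.1.factorial * M / (R / 2) ^ p.1) / (R / 2) ^ p.2) := by gcongr
      _ = _ := by
        simp only [inv_pow]
        field_simp
  refine ⟨a, by simp [a, D], fun w₁ hw₁ w₂ hw₂ => ?_⟩
  have hw₁' : ‖w₁‖ < R / 2 := by simpa using hw₁
  have hw₂' : ‖w₂‖ < R / 2 := by simpa using hw₂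
  have hw₁R : w₁ ∈ Metric.ball (0 : ℂ) R := hcl (Metric.ball_subset_closedBall hw₁)
  have hw₂R : w₂ ∈ Metric.ball (0 : ℂ) R := hcl (Metric.ball_subset_closedBall hw₂)
  have hsum : Summable fun p : ℕ × ℕ => a p * (w₁ ^ p.1 * w₂ ^ p.2) := by
    have hg : ∀ {w : ℂ}, ‖w‖ < R / 2 → Summable fun n : ℕ => (‖w‖ / (R / 2)) ^ n := fun {w} hw =>
      summable_geometric_of_lt_one (by positivity) ((div_lt_one hr).2 hw)
    have := ((hg hw₁').mul_of_nonneg (hg hw₂') (fun _ => by positivity)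
      (fun _ => by positivity)).mul_left M
    refine Summable.of_norm_bounded this fun p => ?_
    rw [norm_mul, norm_mul (w₁ ^ p.1), norm_pow, norm_pow]
    calc _ ≤ M * ((R / 2)⁻¹ ^ p.1 * (R / 2)⁻¹ ^ p.2) * (‖w₁‖ ^ p.1 * ‖w₂‖ ^ p.2) := by
          gcongr; exact hab p
      _ = _ := by simp only [div_eq_mul_inv, mul_pow]; ring
  have hout : HasSum (fun m : ℕ => (m.factorial : ℂ)⁻¹ * w₁ ^ m * D m w₂) (F w₁ w₂) := by
    have := Complex.hasSum_taylorSeries_on_ball (h1 w₂ hw₂R) hw₁R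
    simpa [D, mul_assoc] using this
  have hin : ∀ m, HasSum (fun n : ℕ => a (m, n) * (w₁ ^ m * w₂ ^ n))
      ((m.factorial : ℂ)⁻¹ * w₁ ^ m * D m w₂) := by
    intro m
    have := (Complex.hasSum_taylorSeries_on_ball (hDd m) hw₂R).mul_left
      ((m.factorial : ℂ)⁻¹ * w₁ ^ m)
    refine this.congr_fun ?_ |> fun h => h
    intro n
    simp only [a, sub_zero, smul_eq_mul]
    ring
  have := (hsum.hasSum.prod_fiberwise hin).unique hout
  rw [← this]
  exact hsum.hasSum

/-! ### Uniqueness of the regularized integral -/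

/-- The value of a regularized integral is unique. -/
theorem HasRegIntegral.unique {F : ℍ → ℂ} {c c' : ℂ} (h : HasRegIntegral F c)
    (h' : HasRegIntegral F c') : c = c' := by
  obtain ⟨G, s₀, hG, -, hlim, p, g, hg, rfl, hGg⟩ := h
  obtain ⟨G', s₀', hG', -, hlim', p', g', hg', rfl, hGg'⟩ := h'
  have hmer : MeromorphicOn (G - G') Set.univ := hG.sub hG'
  have hzero : ∀ s : ℂ, max s₀ s₀' < s.re → (G - G') s = 0 := by
    intro s hs
    have h1 := (hlim s ((le_max_left _ _).trans_lt hs)).2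
    have h2 := (hlim' s ((le_max_right _ _).trans_lt hs)).2
    simp [tendsto_nhds_unique h1 h2]
  -- The difference of the two continuations vanishes on a right half-plane. Finite order at 0 would
  -- propagate along the connected plane to the point y of that half-plane, where the order is
  -- infinite.
  have htop : meromorphicOrderAt (G - G') 0 = ⊤ := by
    by_contra hne
    let y : ℂ := ((max s₀ s₀' + 1 : ℝ) : ℂ)
    have := hmer.meromorphicOrderAt_ne_top_of_isPreconnected isPreconnected_univ
      (Set.mem_univ 0) (Set.mem_univ y) hne
    apply this
    rw [meromorphicOrderAt_eq_top_iff]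
    have hopen : {s : ℂ | max s₀ s₀' < s.re} ∈ 𝓝 y :=
      (isOpen_lt continuous_const Complex.continuous_re).mem_nhds (by
        rw [Set.mem_ofPred_eq, Complex.ofReal_re]; exact lt_add_one _)
    exact mem_nhdsWithin_of_mem_nhds (by filter_upwards [hopen] with s hs using hzero s hs)
  rw [meromorphicOrderAt_eq_top_iff] at htop
  have hev : ∀ᶠ s in 𝓝[≠] (0 : ℂ), g s - g' s = (Polynomial.X * (p' - p)).eval s⁻¹ := by
    filter_upwards [htop, hGg, hGg'] with s h1 h2 h3
    have : G s - G' s = 0 := h1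
    rw [h2, h3] at this
    simp only [Polynomial.eval_mul, Polynomial.eval_X, Polynomial.eval_sub]
    linear_combination this
  have hcont : Tendsto (fun s => g s - g' s) (𝓝[≠] (0 : ℂ)) (𝓝 (g 0 - g' 0)) :=
    ((hg.continuousAt.sub hg'.continuousAt).tendsto).mono_left nhdsWithin_le_nhds
  by_cases hp : p' - p = 0
  · have h0 : Tendsto (fun s => g s - g' s) (𝓝[≠] (0 : ℂ)) (𝓝 0) := by
      refine tendsto_const_nhds.congr' ?_
      filter_upwards [hev] with s hs
      rw [hs, hp]
      simp
    exact sub_eq_zero.1 (tendsto_nhds_unique hcont h0)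
  -- A nonconstant polynomial in s⁻¹ is unbounded as s tends to 0, whereas g - g' has a limit.
  · exfalso
    have hdeg : 0 < (Polynomial.X * (p' - p)).degree := by
      rw [Polynomial.degree_mul, Polynomial.degree_X]
      have : (0 : WithBot ℕ) ≤ (p' - p).degree := Polynomial.zero_le_degree_iff.2 hp
      calc (0 : WithBot ℕ) < 1 := by norm_num
        _ ≤ 1 + (p' - p).degree := le_add_of_nonneg_right this
    have hinf : Tendsto (fun s : ℂ => ‖s⁻¹‖) (𝓝[≠] 0) atTop :=
      tendsto_norm_cobounded_atTop.comp tendsto_inv₀_nhdsNE_zero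
    have h1 := (Polynomial.tendsto_norm_atTop _ hdeg hinf)
    have h2 := hcont.norm.congr' (hev.mono fun s hs => by rw [hs])
    exact not_tendsto_nhds_of_tendsto_atTop h1 _ h2

theorem HasRegIntegral.regIntegral_eq {F : ℍ → ℂ} {c : ℂ} (h : HasRegIntegral F c) :
    regIntegral F = c := by
  have hex : ∃ c, HasRegIntegral F c := ⟨c, h⟩
  rw [regIntegral, dif_pos hex]
  exact hex.choose_spec.unique h

/-- If the truncated integrals converge for all `s` to an entire function, its value at `0` is the
regularized integral. -/
theorem hasRegIntegral_of_differentiable {F : ℍ → ℂ} {G : ℂ → ℂ} (hG : Differentiable ℂ G)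
    (hint : ∀ (s : ℂ) (T : ℝ), IntegrableOn (fun τ : ℍ => F τ * (τ.im : ℂ) ^ (-s)) (truncFD T))
    (hlim : ∀ s : ℂ, Tendsto (fun T : ℝ => ∫ τ in truncFD T, F τ * (τ.im : ℂ) ^ (-s)) atTop
      (𝓝 (G s))) : HasRegIntegral F (G 0) := by
  refine ⟨G, 0, fun s _ => (hG.analyticAt s).meromorphicAt, hG.differentiableOn,
    fun s _ => ⟨hint s, hlim s⟩, 0, G, hG.analyticAt 0, rfl, Eventually.of_forall fun s => ?_⟩
  simp

/-! ### Trace zero matrices and the polarized theta kernel -/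

/-- The trace zero matrix with entries `x 0, x 1, x 2, -x 0`. -/
def vecMat (x : Fin 3 → ℝ) : Matrix (Fin 2) (Fin 2) ℝ := !![x 0, x 1; x 2, -x 0]

/-- The determinant of `vecMat x`. -/
def detV (x : Fin 3 → ℝ) : ℝ := -(x 0) ^ 2 - x 1 * x 2

/-- The pairing of `vecMat x` with `Z(ζ)`. -/
noncomputable def qf (x : Fin 3 → ℝ) (ζ : ℂ) : ℂ := x 2 * ζ ^ 2 - 2 * x 0 * ζ - x 1

/-- The polarization of `z ↦ z.im`. -/
noncomputable def ypol (z₁ z₂ : ℂ) : ℂ := (z₁ - z₂) / (2 * Complex.I)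

/-- The polarization of the pairing of `vecMat x` with `Z^⊥(z)`. -/
noncomputable def pf (x : Fin 3 → ℝ) (z₁ z₂ : ℂ) : ℂ :=
  (x 2 * (z₁ * z₂) - x 0 * (z₁ + z₂) - x 1) / ypol z₁ z₂

/-- The polarized polynomial factor of the theta kernel. -/
noncomputable def polyPart (ℓ k : ℕ) (v : ℝ) (x : Fin 3 → ℝ) (z₁ z₂ : ℂ) : ℂ :=
  ((2 : ℂ) ^ ℓ)⁻¹ * Polynomial.aeval ((Real.sqrt (Real.pi * v) : ℂ) * pf x z₁ z₂) (hermiteH ℓ) *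
    (-(1 / (Real.sqrt 2 : ℂ)) * qf x z₂) ^ k

/-- The polarized summand of the theta kernel. -/
noncomputable def termA (ℓ k : ℕ) (u v : ℝ) (x : Fin 3 → ℝ) (z₁ z₂ : ℂ) : ℂ :=
  polyPart ℓ k v x z₁ z₂ * Complex.exp (2 * Real.pi * Complex.I * (detV x * u) -
    2 * Real.pi * v * (pf x z₁ z₂ ^ 2 / 2 - detV x))

/-- The polarized summand of the theta kernel against `e(-Q τ)`. -/
noncomputable def termB (ℓ k : ℕ) (v : ℝ) (x : Fin 3 → ℝ) (z₁ z₂ : ℂ) : ℂ :=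
  polyPart ℓ k v x z₁ z₂ *
    Complex.exp (-(Real.pi * v * (qf x z₁ / ypol z₁ z₂ * (qf x z₂ / ypol z₁ z₂))))

theorem ypol_conj (z : ℂ) : ypol z (starRingEnd ℂ z) = z.im := by
  rw [ypol, Complex.sub_conj]
  field_simp [Complex.I_ne_zero]
  push_cast
  ring

theorem qf_conj (x : Fin 3 → ℝ) (z : ℂ) : qf x (starRingEnd ℂ z) = starRingEnd ℂ (qf x z) := by
  simp [qf, map_ofNat]

/-- Polarization of Q(λ) = Q(λ_{z^⊥}) + Q(λ_z): for z₂ = z̄₁ both sides equal -4 Q(λ_z). The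
identity rests on (z₁ - z₂)² = -4 `ypol`². It is what turns the Gaussian of the theta kernel into
decay governed by `qf`. -/
theorem pf_sq_sub (x : Fin 3 → ℝ) {z₁ z₂ : ℂ} (h : ypol z₁ z₂ ≠ 0) :
    pf x z₁ z₂ ^ 2 - 4 * detV x = qf x z₁ / ypol z₁ z₂ * (qf x z₂ / ypol z₁ z₂) := by
  have h4 : (z₁ - z₂) ^ 2 = -4 * ypol z₁ z₂ ^ 2 := by
    have : z₁ - z₂ = 2 * Complex.I * ypol z₁ z₂ := by
      rw [ypol]; field_simp [Complex.I_ne_zero]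
    rw [this, mul_pow, mul_pow, Complex.I_sq]
    ring
  rw [pf, qf, qf, detV]
  field_simp
  push_cast
  linear_combination ((x 0 : ℂ) ^ 2 + x 1 * x 2) * h4

theorem det_vecMat (x : Fin 3 → ℝ) : (vecMat x).det = detV x := by
  simp [vecMat, Matrix.det_fin_two, detV]
  ring

theorem pair_Zperp (x : Fin 3 → ℝ) (z : ℂ) :
    ((pair (vecMat x) (Zperp z) : ℝ) : ℂ) = pf x z (starRingEnd ℂ z) := by
  rw [pf, ypol_conj, Complex.mul_conj, Complex.add_conj]
  simp only [pair, QuadraticMap.polar, vecMat, Zperp, Matrix.det_fin_two]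
  simp
  ring

theorem pair_Zmat (x : Fin 3 → ℝ) (c ζ : ℂ) :
    pair ((vecMat x).map Complex.ofReal) (c • Zmat ζ) = c * qf x ζ := by
  simp only [pair, QuadraticMap.polar, vecMat, Zmat, Matrix.det_fin_two, qf]
  simp
  ring

theorem det_projPos (x : Fin 3 → ℝ) {z : ℂ} (hz : z.im ≠ 0) :
    (projPos z (vecMat x)).det = pair (vecMat x) (Zperp z) ^ 2 / 4 := by
  have h : (Zperp z).det = 1 := by
    simp [Zperp, Matrix.det_fin_two, Complex.normSq_apply]
    field_simp
    ring
  rw [projPos, Matrix.det_smul, h]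
  simp
  ring

theorem det_sub_projPos (x : Fin 3 → ℝ) {z : ℂ} (hz : z.im ≠ 0) :
    (vecMat x - projPos z (vecMat x)).det = detV x - pair (vecMat x) (Zperp z) ^ 2 / 4 := by
  have h : (Zperp z).det = 1 := by
    simp [Zperp, Matrix.det_fin_two, Complex.normSq_apply]
    field_simp
    ring
  have key : ∀ (X Y : Matrix (Fin 2) (Fin 2) ℝ) (t : ℝ),
      (X - t • Y).det = X.det - t * pair X Y + t ^ 2 * Y.det := by
    intro X Y t
    simp only [pair, QuadraticMap.polar, Matrix.det_fin_two, Matrix.sub_apply, Matrix.add_apply,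
      Matrix.smul_apply, smul_eq_mul]
    ring
  rw [projPos, key, h, det_vecMat]
  ring

/-- The polarized kernel restricts to the theta kernel on z₂ = z̄₁; through this, estimates near (z,
z̄) become statements about the lift. -/
theorem thetaTerm_vecMat (ℓ k : ℕ) (τ : ℍ) {z : ℂ} (hz : z.im ≠ 0) (x : Fin 3 → ℝ) :
    thetaTerm ℓ k τ z (vecMat x) = termA ℓ k τ.re τ.im x z (starRingEnd ℂ z) := by
  rw [thetaTerm, termA, polyPart, pair_Zmat, det_projPos x hz, det_sub_projPos x hz, ee]
  rw [← pair_Zperp]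
  congr 1
  · congr 1
    rw [Complex.ofReal_mul]
    congr 1
    · simp
    · rw [← Complex.ofReal_mul]
      exact (Polynomial.aeval_algebraMap_apply_eq_algebraMap_eval (A := ℂ)
        (Real.sqrt (Real.pi * τ.im) * pair (vecMat x) (Zperp z)) (hermiteH ℓ)).symm
  · congr 1
    have h1 : (τ : ℂ) = τ.re + τ.im * Complex.I := (Complex.re_add_im (τ : ℂ)).symm
    have h2 : starRingEnd ℂ (τ : ℂ) = τ.re - τ.im * Complex.I := by
      conv_lhs => rw [h1]
      simp
      ring
    rw [h2, h1]
    push_cast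
    linear_combination (2 * Real.pi * τ.im *
      ((pair (vecMat x) (Zperp z) : ℝ) ^ 2 / 2 - detV x : ℂ)) * Complex.I_sq

/-! ### Uniform estimates -/

/-- The values of a linear form vary by at most the variation of its coefficients times ‖x‖, so one
neighbourhood serves all lattice vectors simultaneously. -/
theorem eventually_linear_form_close {g : ℂ × ℂ → Fin 3 → ℂ} {w₀ : ℂ × ℂ}
    (hg : ContinuousAt g w₀) {ε : ℝ} (hε : 0 < ε) :
    ∀ᶠ w in 𝓝 w₀, ∀ x : Fin 3 → ℝ,
      ‖∑ i, (x i : ℂ) * g w i - ∑ i, (x i : ℂ) * g w₀ i‖ ≤ ε * ‖x‖ := by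
  have h3 : (0 : ℝ) < ε / 3 := by positivity
  filter_upwards [Metric.continuousAt_iff'.1 hg (ε / 3) h3] with w hw x
  rw [← Finset.sum_sub_distrib]
  calc _ ≤ ∑ i : Fin 3, ‖(x i : ℂ) * g w i - x i * g w₀ i‖ := norm_sum_le _ _
    _ ≤ ∑ _i : Fin 3, ‖x‖ * (ε / 3) := by
        refine Finset.sum_le_sum fun i _ => ?_
        rw [← mul_sub, norm_mul, Complex.norm_real]
        refine mul_le_mul (norm_le_pi_norm x i) ?_ (norm_nonneg _) (norm_nonneg _)
        rw [dist_eq_norm] at hw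
        exact (norm_le_pi_norm (g w - g w₀) i).trans hw.le
    _ = ε * ‖x‖ := by simp; ring

theorem continuousAt_ypol_inv {w₀ : ℂ × ℂ} (h : ypol w₀.1 w₀.2 ≠ 0) :
    ContinuousAt (fun w : ℂ × ℂ => (ypol w.1 w.2)⁻¹) w₀ := by
  refine ContinuousAt.inv₀ ?_ h
  unfold ypol
  fun_prop

theorem eventually_pf_close {w₀ : ℂ × ℂ} (h : ypol w₀.1 w₀.2 ≠ 0) {ε : ℝ} (hε : 0 < ε) :
    ∀ᶠ w in 𝓝 w₀, ∀ x : Fin 3 → ℝ, ‖pf x w.1 w.2 - pf x w₀.1 w₀.2‖ ≤ ε * ‖x‖ := by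
  have hc := continuousAt_ypol_inv h
  have hg : ContinuousAt (fun w : ℂ × ℂ => ![-(w.1 + w.2) * (ypol w.1 w.2)⁻¹,
      -(ypol w.1 w.2)⁻¹, (w.1 * w.2) * (ypol w.1 w.2)⁻¹]) w₀ := by
    refine continuousAt_pi.2 fun i => ?_
    fin_cases i <;> simp <;> fun_prop
  filter_upwards [eventually_linear_form_close hg hε] with w hw x
  convert hw x using 2
  simp [Fin.sum_univ_three, pf]
  ring

theorem eventually_qf_fst_close {w₀ : ℂ × ℂ} (h : ypol w₀.1 w₀.2 ≠ 0) {ε : ℝ} (hε : 0 < ε) :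
    ∀ᶠ w in 𝓝 w₀, ∀ x : Fin 3 → ℝ,
      ‖qf x w.1 / ypol w.1 w.2 - qf x w₀.1 / ypol w₀.1 w₀.2‖ ≤ ε * ‖x‖ := by
  have hc := continuousAt_ypol_inv h
  have hg : ContinuousAt (fun w : ℂ × ℂ => ![-(2 * w.1) * (ypol w.1 w.2)⁻¹,
      -(ypol w.1 w.2)⁻¹, (w.1 ^ 2) * (ypol w.1 w.2)⁻¹]) w₀ := by
    refine continuousAt_pi.2 fun i => ?_
    fin_cases i <;> simp <;> fun_prop
  filter_upwards [eventually_linear_form_close hg hε] with w hw x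
  convert hw x using 2
  simp [Fin.sum_univ_three, qf]
  ring

theorem eventually_qf_snd_close {w₀ : ℂ × ℂ} (h : ypol w₀.1 w₀.2 ≠ 0) {ε : ℝ} (hε : 0 < ε) :
    ∀ᶠ w in 𝓝 w₀, ∀ x : Fin 3 → ℝ,
      ‖qf x w.2 / ypol w.1 w.2 - qf x w₀.2 / ypol w₀.1 w₀.2‖ ≤ ε * ‖x‖ := by
  have hc := continuousAt_ypol_inv h
  have hg : ContinuousAt (fun w : ℂ × ℂ => ![-(2 * w.2) * (ypol w.1 w.2)⁻¹,
      -(ypol w.1 w.2)⁻¹, (w.2 ^ 2) * (ypol w.1 w.2)⁻¹]) w₀ := by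
    refine continuousAt_pi.2 fun i => ?_
    fin_cases i <;> simp <;> fun_prop
  filter_upwards [eventually_linear_form_close hg hε] with w hw x
  convert hw x using 2
  simp [Fin.sum_univ_three, qf]
  ring

/-- The three linear forms at `z` bound the vector. -/
theorem exists_norm_le_pf_qf {z : ℂ} (hz : z.im ≠ 0) : ∃ K : ℝ, 0 < K ∧ ∀ x : Fin 3 → ℝ,
    ‖x‖ ≤ K * (‖pf x z (starRingEnd ℂ z)‖ + ‖qf x z / ypol z (starRingEnd ℂ z)‖) := by
  set y := z.im with hy
  set t := z.re with ht
  have hz' : z = t + y * Complex.I := (Complex.re_add_im z).symm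
  -- The summands bound the three coordinates: 2y·x₂ is the difference of p and the real part of
  -- `qf`/y, then x₀ comes from the imaginary part, and x₁ from p.
  let K : ℝ := 1 + |2 * y|⁻¹ + (|t| * |2 * y|⁻¹ + 1) +
    ((t ^ 2 + y ^ 2) * |2 * y|⁻¹ + 2 * (|t| * |2 * y|⁻¹ + 1) * |t| + |y|)
  have hK : 0 < K := by positivity
  refine ⟨K, hK, fun x => ?_⟩
  set P := ‖pf x z (starRingEnd ℂ z)‖
  set S := ‖qf x z / ypol z (starRingEnd ℂ z)‖
  let p : ℝ := (x 2 * (t ^ 2 + y ^ 2) - 2 * x 0 * t - x 1) / y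
  have hp : pf x z (starRingEnd ℂ z) = (p : ℂ) := by
    rw [pf, ypol_conj, Complex.mul_conj, Complex.add_conj, Complex.normSq_apply]
    simp only [p, ← ht, ← hy]
    push_cast
    ring
  have hP : |p| ≤ P := by
    simp only [P, hp, Complex.norm_real, Real.norm_eq_abs, le_refl]
  have hq : qf x z / ypol z (starRingEnd ℂ z) =
      (((x 2 * (t ^ 2 - y ^ 2) - 2 * x 0 * t - x 1) / y : ℝ) : ℂ) +
        ((2 * (x 2 * t - x 0) : ℝ) : ℂ) * Complex.I := by
    have hyc : (y : ℂ) ≠ 0 := by exact_mod_cast hz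
    rw [ypol_conj, ← hy, qf, hz']
    field_simp
    push_cast
    field_simp
    linear_combination (x 2 : ℂ) * (y : ℂ) ^ 2 * Complex.I_sq
  have hS1 : |(x 2 * (t ^ 2 - y ^ 2) - 2 * x 0 * t - x 1) / y| ≤ S := by
    have := Complex.abs_re_le_norm (qf x z / ypol z (starRingEnd ℂ z))
    rw [hq] at this
    simpa only [S, hq, Complex.add_re, Complex.ofReal_re, Complex.re_ofReal_mul, Complex.I_re,
      mul_zero, add_zero] using this
  have hS2 : |2 * (x 2 * t - x 0)| ≤ S := by
    have := Complex.abs_im_le_norm (qf x z / ypol z (starRingEnd ℂ z))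
    rw [hq] at this
    simpa only [S, hq, Complex.add_im, Complex.ofReal_im, Complex.im_ofReal_mul, Complex.I_im,
      mul_one, zero_add] using this
  have hc : |x 2| ≤ |2 * y|⁻¹ * (P + S) := by
    have : x 2 = (2 * y)⁻¹ * (p - (x 2 * (t ^ 2 - y ^ 2) - 2 * x 0 * t - x 1) / y) := by
      simp only [p]; field_simp; ring
    rw [this, abs_mul, abs_inv]
    gcongr
    exact (abs_sub _ _).trans (add_le_add hP hS1)
  have hP0 : 0 ≤ P := norm_nonneg _
  have hS0 : 0 ≤ S := norm_nonneg _
  have ha : |x 0| ≤ (|t| * |2 * y|⁻¹ + 1) * (P + S) := by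
    have : x 0 = t * x 2 - (2 * (x 2 * t - x 0)) / 2 := by ring
    rw [this]
    calc _ ≤ |t * x 2| + |2 * (x 2 * t - x 0) / 2| := abs_sub _ _
      _ ≤ |t| * (|2 * y|⁻¹ * (P + S)) + S := by
          rw [abs_mul, abs_div, abs_two]
          gcongr
          linarith
      _ ≤ _ := by nlinarith
  have hb : |x 1| ≤ ((t ^ 2 + y ^ 2) * |2 * y|⁻¹ + 2 * (|t| * |2 * y|⁻¹ + 1) * |t| + |y|) *
      (P + S) := by
    have : x 1 = (t ^ 2 + y ^ 2) * x 2 - 2 * x 0 * t - p * y := by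
      simp only [p]; field_simp; ring
    rw [this]
    calc _ ≤ |(t ^ 2 + y ^ 2) * x 2| + |2 * x 0 * t| + |p * y| :=
          (abs_sub _ _).trans (add_le_add_left (abs_sub _ _) _)
      _ ≤ (t ^ 2 + y ^ 2) * (|2 * y|⁻¹ * (P + S)) +
          2 * ((|t| * |2 * y|⁻¹ + 1) * (P + S)) * |t| + (P + S) * |y| := by
          rw [abs_mul, abs_mul, abs_mul, abs_mul, abs_two,
            abs_of_nonneg (by positivity : 0 ≤ t ^ 2 + y ^ 2)]
          gcongr
          linarith
      _ = _ := by ring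
  have h1 : 0 ≤ |2 * y|⁻¹ := by positivity
  have h2 : 0 ≤ |t| * |2 * y|⁻¹ + 1 := by positivity
  have h3 : 0 ≤ (t ^ 2 + y ^ 2) * |2 * y|⁻¹ + 2 * (|t| * |2 * y|⁻¹ + 1) * |t| + |y| := by
    positivity
  refine (pi_norm_le_iff_of_nonneg (by positivity)).2 fun i => ?_
  rw [Real.norm_eq_abs]
  fin_cases i
  · exact ha.trans (mul_le_mul_of_nonneg_right (by simp only [K]; linarith) (by positivity))
  · exact hb.trans (mul_le_mul_of_nonneg_right (by simp only [K]; linarith) (by positivity))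
  · exact hc.trans (mul_le_mul_of_nonneg_right (by simp only [K]; linarith) (by positivity))

theorem exists_aeval_le (P : Polynomial ℝ) : ∃ C : ℝ, 0 ≤ C ∧ ∀ ξ : ℂ,
    ‖Polynomial.aeval ξ P‖ ≤ C * (1 + ‖ξ‖) ^ P.natDegree := by
  refine ⟨∑ i ∈ Finset.range (P.natDegree + 1), |P.coeff i|, by positivity, fun ξ => ?_⟩
  rw [Polynomial.aeval_eq_sum_range, Finset.sum_mul]
  refine (norm_sum_le _ _).trans (Finset.sum_le_sum fun i hi => ?_)
  rw [norm_smul, Real.norm_eq_abs, norm_pow]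
  gcongr
  calc ‖ξ‖ ^ i ≤ (1 + ‖ξ‖) ^ i := by gcongr; linarith
    _ ≤ _ := pow_le_pow_right₀ (by linarith [norm_nonneg ξ])
      (Nat.lt_succ_iff.1 (Finset.mem_range.1 hi))

theorem exists_polyPart_le (ℓ k : ℕ) (K : ℝ) (hK : 0 ≤ K) : ∃ C : ℝ, 0 ≤ C ∧ ∃ d : ℕ,
    ∀ (v : ℝ) (x : Fin 3 → ℝ) (z₁ z₂ : ℂ), 0 ≤ v → ‖pf x z₁ z₂‖ ≤ K * ‖x‖ →
      ‖qf x z₂‖ ≤ K * ‖x‖ → ‖polyPart ℓ k v x z₁ z₂‖ ≤ C * (1 + v) ^ d * (1 + ‖x‖) ^ d := by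
  obtain ⟨C, hC, hCb⟩ := exists_aeval_le (hermiteH ℓ)
  set e := (hermiteH ℓ).natDegree
  refine ⟨C * (1 + 4 * K) ^ e * K ^ k, by positivity, e + k, ?_⟩
  intro v x z₁ z₂ hv hp hq
  have hsq : Real.sqrt (Real.pi * v) ≤ 4 * (1 + v) := by
    rw [Real.sqrt_le_left (by positivity)]
    nlinarith [Real.pi_le_four, Real.pi_pos]
  have h1 : ‖((2 : ℂ) ^ ℓ)⁻¹‖ ≤ 1 := by
    rw [norm_inv, norm_pow, Complex.norm_ofNat]
    exact inv_le_one_of_one_le₀ (one_le_pow₀ (by norm_num))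
  have hx : 0 ≤ ‖x‖ := norm_nonneg x
  have h2 : ‖(Real.sqrt (Real.pi * v) : ℂ) * pf x z₁ z₂‖ ≤ 4 * (1 + v) * (K * ‖x‖) := by
    rw [norm_mul, Complex.norm_real, Real.norm_of_nonneg (Real.sqrt_nonneg _)]
    gcongr
  have h3 : 1 + ‖(Real.sqrt (Real.pi * v) : ℂ) * pf x z₁ z₂‖ ≤
      (1 + 4 * K) * ((1 + v) * (1 + ‖x‖)) := by
    have h4 : 1 ≤ (1 + v) * (1 + ‖x‖) := by nlinarith
    have h5 : (1 + v) * ‖x‖ ≤ (1 + v) * (1 + ‖x‖) := by gcongr; linarith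
    nlinarith
  have h4 : ‖-(1 / (Real.sqrt 2 : ℂ)) * qf x z₂‖ ≤ K * ((1 + v) * (1 + ‖x‖)) := by
    rw [norm_mul, norm_neg, norm_div, norm_one, Complex.norm_real,
      Real.norm_of_nonneg (Real.sqrt_nonneg _)]
    have h6 : 1 / Real.sqrt 2 ≤ 1 := by
      rw [div_le_one (by positivity)]
      exact Real.one_le_sqrt.2 (by norm_num)
    calc _ ≤ 1 * (K * ‖x‖) := by gcongr
      _ ≤ K * ((1 + v) * (1 + ‖x‖)) := by rw [one_mul]; gcongr; nlinarith
  rw [polyPart, norm_mul, norm_mul, norm_pow]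
  calc _ ≤ 1 * (C * ((1 + 4 * K) * ((1 + v) * (1 + ‖x‖))) ^ e) *
        (K * ((1 + v) * (1 + ‖x‖))) ^ k := by
        gcongr
        exact (hCb _).trans (by gcongr)
    _ = _ := by simp only [mul_pow, pow_add]; ring

theorem pow_mul_exp_neg_le (m : ℕ) {c t : ℝ} (hc : 0 < c) (ht : 0 ≤ t) :
    (1 + t) ^ m * Real.exp (-(c * t)) ≤ m.factorial / c ^ m * Real.exp c := by
  have h := Real.pow_div_factorial_le_exp (c * (1 + t)) (by positivity) m
  rw [div_le_iff₀ (by positivity), mul_pow] at h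
  have hcm : 0 < c ^ m := by positivity
  have h2 : (1 + t) ^ m ≤ m.factorial / c ^ m * Real.exp (c * (1 + t)) := by
    rw [div_mul_eq_mul_div, le_div_iff₀ hcm]
    linarith
  calc _ ≤ m.factorial / c ^ m * Real.exp (c * (1 + t)) * Real.exp (-(c * t)) := by gcongr
    _ = _ := by rw [mul_assoc, ← Real.exp_add]; ring_nf

theorem exists_pow_mul_exp_neg_sq_le (d r : ℕ) {c : ℝ} (hc : 0 < c) : ∃ C : ℝ, 0 ≤ C ∧
    ∀ t : ℝ, 0 ≤ t → (1 + t) ^ d * Real.exp (-(c * t ^ 2)) ≤ C * ((1 + t) ^ r)⁻¹ := by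
  refine ⟨Real.exp c * ((d + r).factorial / (2 * c) ^ (d + r) * Real.exp (2 * c)),
    by positivity, fun t ht => ?_⟩
  rw [← div_eq_mul_inv, le_div_iff₀ (by positivity)]
  have h1 := pow_mul_exp_neg_le (d + r) (c := 2 * c) (by positivity) ht
  -- From t² ≥ 2t - 1 a Gaussian is dominated by an exponential, to which the preceding bound
  -- applies.
  have h2 : Real.exp (-(c * t ^ 2)) ≤ Real.exp c * Real.exp (-(2 * c * t)) := by
    rw [← Real.exp_add]
    apply Real.exp_le_exp.2
    nlinarith [sq_nonneg (t - 1)]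
  calc _ = (1 + t) ^ (d + r) * Real.exp (-(c * t ^ 2)) := by rw [pow_add]; ring
    _ ≤ (1 + t) ^ (d + r) * (Real.exp c * Real.exp (-(2 * c * t))) := by gcongr
    _ = Real.exp c * ((1 + t) ^ (d + r) * Real.exp (-(2 * c * t))) := by ring
    _ ≤ _ := by gcongr

theorem norm_mul_sub_mul_le {A B A' B' : ℂ} {ε K X : ℝ} (hε1 : ε ≤ 1) (hX : 0 ≤ X)
    (hε : 0 ≤ ε) (hK : 0 ≤ K) (hA : ‖A' - A‖ ≤ ε * X) (hB : ‖B' - B‖ ≤ ε * X)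
    (hAK : ‖A‖ ≤ K * X) (hBK : ‖B‖ ≤ K * X) :
    ‖A' * B' - A * B‖ ≤ (2 * K + 1) * ε * X ^ 2 := by
  have h : A' * B' - A * B = (A' - A) * (B' - B) + A * (B' - B) + (A' - A) * B := by ring
  rw [h]
  calc _ ≤ ‖A' - A‖ * ‖B' - B‖ + ‖A‖ * ‖B' - B‖ + ‖A' - A‖ * ‖B‖ := by
        refine (norm_add₃_le ..).trans ?_
        simp only [norm_mul, le_refl]
    _ ≤ (ε * X) * (ε * X) + (K * X) * (ε * X) + (ε * X) * (K * X) := by gcongr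
    _ = ε * ε * X ^ 2 + 2 * K * ε * X ^ 2 := by ring
    _ ≤ ε * 1 * X ^ 2 + 2 * K * ε * X ^ 2 := by gcongr
    _ = _ := by ring

theorem exists_qf_le (ζ : ℂ) : ∃ K : ℝ, 0 ≤ K ∧ ∀ x : Fin 3 → ℝ, ‖qf x ζ‖ ≤ K * ‖x‖ := by
  refine ⟨‖ζ‖ ^ 2 + 2 * ‖ζ‖ + 1, by positivity, fun x => ?_⟩
  rw [qf]
  calc _ ≤ ‖(x 2 : ℂ) * ζ ^ 2‖ + ‖2 * (x 0 : ℂ) * ζ‖ + ‖(x 1 : ℂ)‖ :=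
        (norm_sub_le _ _).trans (add_le_add_left (norm_sub_le _ _) _)
    _ = ‖x 2‖ * ‖ζ‖ ^ 2 + 2 * ‖x 0‖ * ‖ζ‖ + ‖x 1‖ := by simp
    _ ≤ ‖x‖ * ‖ζ‖ ^ 2 + 2 * ‖x‖ * ‖ζ‖ + ‖x‖ := by
        gcongr <;> exact norm_le_pi_norm x _
    _ = _ := by ring

theorem exists_pf_le (z₁ z₂ : ℂ) : ∃ K : ℝ, 0 ≤ K ∧ ∀ x : Fin 3 → ℝ,
    ‖pf x z₁ z₂‖ ≤ K * ‖x‖ := by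
  refine ⟨(‖z₁ * z₂‖ + ‖z₁ + z₂‖ + 1) * ‖(ypol z₁ z₂)⁻¹‖, by positivity, fun x => ?_⟩
  rw [pf, div_eq_mul_inv, norm_mul]
  calc _ ≤ (‖(x 2 : ℂ) * (z₁ * z₂)‖ + ‖(x 0 : ℂ) * (z₁ + z₂)‖ + ‖(x 1 : ℂ)‖) *
        ‖(ypol z₁ z₂)⁻¹‖ := by
        gcongr
        exact (norm_sub_le _ _).trans (add_le_add_left (norm_sub_le _ _) _)
    _ = (‖x 2‖ * ‖z₁ * z₂‖ + ‖x 0‖ * ‖z₁ + z₂‖ + ‖x 1‖) * ‖(ypol z₁ z₂)⁻¹‖ := by simp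
    _ ≤ (‖x‖ * ‖z₁ * z₂‖ + ‖x‖ * ‖z₁ + z₂‖ + ‖x‖) * ‖(ypol z₁ z₂)⁻¹‖ := by
        gcongr <;> exact norm_le_pi_norm x _
    _ = _ := by ring

theorem norm_termA (ℓ k : ℕ) (u v : ℝ) (x : Fin 3 → ℝ) (z₁ z₂ : ℂ) :
    ‖termA ℓ k u v x z₁ z₂‖ = ‖polyPart ℓ k v x z₁ z₂‖ *
      Real.exp (-(2 * Real.pi * v * (pf x z₁ z₂ ^ 2 / 2 - detV x).re)) := by
  rw [termA, norm_mul, Complex.norm_exp]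
  congr 2
  have h1 : (2 * Real.pi * Complex.I * ((detV x : ℂ) * u)).re = 0 := by
    have : 2 * Real.pi * Complex.I * ((detV x : ℂ) * u) =
        ((2 * Real.pi * (detV x * u) : ℝ) : ℂ) * Complex.I := by push_cast; ring
    rw [this, Complex.re_ofReal_mul, Complex.I_re, mul_zero]
  have h2 : (2 * Real.pi * v * (pf x z₁ z₂ ^ 2 / 2 - detV x)).re =
      2 * Real.pi * v * (pf x z₁ z₂ ^ 2 / 2 - detV x).re := by
    rw [← Complex.re_ofReal_mul]
    push_cast
    rfl
  rw [Complex.sub_re, h1, h2]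
  ring

theorem norm_termB (ℓ k : ℕ) (v : ℝ) (x : Fin 3 → ℝ) (z₁ z₂ : ℂ) :
    ‖termB ℓ k v x z₁ z₂‖ = ‖polyPart ℓ k v x z₁ z₂‖ *
      Real.exp (-(Real.pi * v * (qf x z₁ / ypol z₁ z₂ * (qf x z₂ / ypol z₁ z₂)).re)) := by
  rw [termB, norm_mul, Complex.norm_exp, Complex.neg_re, ← Complex.ofReal_mul,
    Complex.re_ofReal_mul]

/-- Uniform Gaussian bounds for the polarized kernels near the point `(z, z̄)`. -/
theorem exists_uniform_bound (ℓ k : ℕ) {z : ℂ} (hz : z.im ≠ 0) {δ : ℝ} (hδ : 0 < δ) :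
    ∃ ε > 0, ∃ C ≥ 0, ∃ d : ℕ, ∃ c > 0,
      ∀ z₁ ∈ Metric.ball z ε, ∀ z₂ ∈ Metric.ball (starRingEnd ℂ z) ε, ypol z₁ z₂ ≠ 0 ∧
        ∀ x : Fin 3 → ℝ, (∀ u v : ℝ, 0 ≤ v → ‖termA ℓ k u v x z₁ z₂‖ ≤
          C * (1 + v) ^ d * (1 + ‖x‖) ^ d * Real.exp (-(c * v * ‖x‖ ^ 2))) ∧
        (δ * (1 + ‖x‖ ^ 2) ≤ ‖qf x z‖ ^ 2 → ∀ v : ℝ, 0 ≤ v → ‖termB ℓ k v x z₁ z₂‖ ≤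
          C * (1 + v) ^ d * (1 + ‖x‖) ^ d * Real.exp (-(c * v * (1 + ‖x‖ ^ 2)))) := by
  set z' := starRingEnd ℂ z with hz'
  have hy0 : ypol z z' ≠ 0 := by rw [hz', ypol_conj]; exact_mod_cast hz
  obtain ⟨K, hK, hKx⟩ := exists_norm_le_pf_qf hz
  obtain ⟨K₁, hK₁, hpK⟩ := exists_pf_le z z'
  obtain ⟨K₂, hK₂, hqK⟩ := exists_qf_le z
  obtain ⟨K₃, hK₃, hqK'⟩ := exists_qf_le z'
  set Y := ‖ypol z z'‖ with hY
  have hYpos : 0 < Y := norm_pos_iff.2 hy0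
  set M := K₁ + K₂ / Y + K₃ / Y with hM
  have hM0 : 0 ≤ M := by positivity
  have hp0 : ∀ x, ‖pf x z z'‖ ≤ M * ‖x‖ := fun x => (hpK x).trans (by
    gcongr; rw [hM]; have : 0 ≤ K₂ / Y := by positivity
    have : 0 ≤ K₃ / Y := by positivity
    linarith)
  have hq10 : ∀ x, ‖qf x z / ypol z z'‖ ≤ M * ‖x‖ := fun x => by
    rw [norm_div]
    calc _ ≤ K₂ * ‖x‖ / Y := by gcongr; exact hqK x
      _ = K₂ / Y * ‖x‖ := by ring
      _ ≤ _ := by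
        gcongr; rw [hM]; have : 0 ≤ K₃ / Y := by positivity
        linarith
  have hq20 : ∀ x, ‖qf x z' / ypol z z'‖ ≤ M * ‖x‖ := fun x => by
    rw [norm_div]
    calc _ ≤ K₃ * ‖x‖ / Y := by gcongr; exact hqK' x
      _ = K₃ / Y * ‖x‖ := by ring
      _ ≤ _ := by
        gcongr; rw [hM]; have : 0 ≤ K₂ / Y := by positivity
        linarith
  set δ' := δ / Y ^ 2 with hδ'
  have hδ'pos : 0 < δ' := by positivity
  -- The tolerated error in the quadratic terms, relative to ‖x‖². The first entry costs half of the
  -- lower bound ‖x‖²/(2K²) for |`pf`|² + |`qf`/y|²; the second costs half of the lower bound δ' for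
  -- |`qf`/y|². The number η is the error in the linear forms that guarantees κ.
  set κ := min (1 / (8 * K ^ 2)) (δ' / 2) with hκ
  have hκpos : 0 < κ := by positivity
  set η := min 1 (κ / (2 * M + 1)) with hη
  have hηpos : 0 < η := by positivity
  have hη1 : η ≤ 1 := min_le_left _ _
  have hηκ : (2 * M + 1) * η ≤ κ := by
    have : η ≤ κ / (2 * M + 1) := min_le_right _ _
    rw [le_div_iff₀ (by positivity)] at this
    linarith
  obtain ⟨C, hC, d, hCd⟩ := exists_polyPart_le ℓ k ((M + 1) * (Y + 1)) (by positivity)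
  have hyc : ∀ᶠ w in 𝓝 (z, z'), ypol w.1 w.2 ≠ 0 ∧ ‖ypol w.1 w.2‖ ≤ Y + 1 := by
    have hcont : Continuous fun w : ℂ × ℂ => ypol w.1 w.2 := by unfold ypol; fun_prop
    refine (hcont.continuousAt.eventually_ne hy0).and ?_
    exact (hcont.norm.continuousAt.eventually_lt continuousAt_const
      (by simp only [← hY]; linarith : ‖ypol (z, z').1 (z, z').2‖ < Y + 1)).mono
      fun w hw => hw.le
  have hev := hyc.and ((eventually_pf_close (w₀ := (z, z')) hy0 hηpos).and
    ((eventually_qf_fst_close (w₀ := (z, z')) hy0 hηpos).and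
      (eventually_qf_snd_close (w₀ := (z, z')) hy0 hηpos)))
  obtain ⟨ε, hε, hball⟩ := Metric.eventually_nhds_iff_ball.1 hev
  refine ⟨ε, hε, C, hC, d, min (Real.pi / (32 * K ^ 2)) (δ' / 2), by positivity, ?_⟩
  intro z₁ hz₁ z₂ hz₂
  obtain ⟨⟨hy, hyY⟩, hp, hq1, hq2⟩ := hball (z₁, z₂) (by
    rw [← ball_prod_same]; exact ⟨hz₁, hz₂⟩)
  simp only at hy hyY hp hq1 hq2
  refine ⟨hy, fun x => ?_⟩
  specialize hp x
  specialize hq1 x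
  specialize hq2 x
  have hx0 : 0 ≤ ‖x‖ := norm_nonneg x
  have hpoly : ∀ v, 0 ≤ v → ‖polyPart ℓ k v x z₁ z₂‖ ≤ C * (1 + v) ^ d * (1 + ‖x‖) ^ d := by
    intro v hv
    refine hCd v x z₁ z₂ hv ?_ ?_
    · calc ‖pf x z₁ z₂‖ ≤ ‖pf x z₁ z₂ - pf x z z'‖ + ‖pf x z z'‖ := by
            simpa using norm_add_le (pf x z₁ z₂ - pf x z z') (pf x z z')
        _ ≤ η * ‖x‖ + M * ‖x‖ := add_le_add hp (hp0 x)
        _ ≤ 1 * ‖x‖ + M * ‖x‖ := by gcongr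
        _ = (M + 1) * 1 * ‖x‖ := by ring
        _ ≤ _ := by gcongr; linarith
    · have h1 : ‖qf x z₂ / ypol z₁ z₂‖ ≤ (M + 1) * ‖x‖ := by
        calc _ ≤ ‖qf x z₂ / ypol z₁ z₂ - qf x z' / ypol z z'‖ + ‖qf x z' / ypol z z'‖ := by
              simpa using norm_add_le (qf x z₂ / ypol z₁ z₂ - qf x z' / ypol z z')
                (qf x z' / ypol z z')
          _ ≤ η * ‖x‖ + M * ‖x‖ := add_le_add hq2 (hq20 x)
          _ ≤ 1 * ‖x‖ + M * ‖x‖ := by gcongr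
          _ = _ := by ring
      calc ‖qf x z₂‖ = ‖qf x z₂ / ypol z₁ z₂‖ * ‖ypol z₁ z₂‖ := by
            rw [← norm_mul, div_mul_cancel₀ _ hy]
        _ ≤ (M + 1) * ‖x‖ * (Y + 1) := by gcongr
        _ = _ := by ring
  have hpp : ‖pf x z₁ z₂ * pf x z₁ z₂ - pf x z z' * pf x z z'‖ ≤ κ * ‖x‖ ^ 2 :=
    (norm_mul_sub_mul_le hη1 hx0 hηpos.le hM0 hp hp (hp0 x) (hp0 x)).trans (by gcongr)
  have hqq : ‖qf x z₁ / ypol z₁ z₂ * (qf x z₂ / ypol z₁ z₂) -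
      qf x z / ypol z z' * (qf x z' / ypol z z')‖ ≤ κ * ‖x‖ ^ 2 :=
    (norm_mul_sub_mul_le hη1 hx0 hηpos.le hM0 hq1 hq2 (hq10 x) (hq20 x)).trans (by gcongr)
  have hreal : ypol z z' = (z.im : ℂ) := ypol_conj z
  have hp0re : (pf x z z' * pf x z z').re = ‖pf x z z'‖ ^ 2 := by
    rw [hz', ← pair_Zperp, ← Complex.ofReal_mul, Complex.ofReal_re, Complex.norm_real,
      Real.norm_eq_abs, sq_abs, sq]
  have hq0re : (qf x z / ypol z z' * (qf x z' / ypol z z')).re = ‖qf x z / ypol z z'‖ ^ 2 := by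
    have : qf x z' / ypol z z' = starRingEnd ℂ (qf x z / ypol z z') := by
      rw [hreal, map_div₀, Complex.conj_ofReal, hz', qf_conj]
    rw [this, Complex.mul_conj, Complex.ofReal_re, Complex.normSq_eq_norm_sq]
  have hpre : ‖pf x z z'‖ ^ 2 - κ * ‖x‖ ^ 2 ≤ (pf x z₁ z₂ * pf x z₁ z₂).re := by
    have := (Complex.abs_re_le_norm _).trans hpp
    rw [Complex.sub_re, hp0re] at this
    linarith [(abs_le.1 this).1]
  have hqre : ‖qf x z / ypol z z'‖ ^ 2 - κ * ‖x‖ ^ 2 ≤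
      (qf x z₁ / ypol z₁ z₂ * (qf x z₂ / ypol z₁ z₂)).re := by
    have := (Complex.abs_re_le_norm _).trans hqq
    rw [Complex.sub_re, hq0re] at this
    linarith [(abs_le.1 this).1]
  constructor
  · intro u v hv
    rw [norm_termA]
    refine mul_le_mul (hpoly v hv) ?_ (Real.exp_pos _).le (by positivity)
    apply Real.exp_le_exp.2
    -- The exponent is a quarter of the polarized majorant Q(λ_{z^⊥}) - Q(λ_z), up to scaling; its
    -- value at (z, z̄) is positive definite in x.
    have hid : pf x z₁ z₂ ^ 2 / 2 - detV x =
        (pf x z₁ z₂ * pf x z₁ z₂ + qf x z₁ / ypol z₁ z₂ * (qf x z₂ / ypol z₁ z₂)) / 4 := by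
      rw [← pf_sq_sub x hy]; ring
    have hre : (pf x z₁ z₂ ^ 2 / 2 - detV x).re = ((pf x z₁ z₂ * pf x z₁ z₂).re +
        (qf x z₁ / ypol z₁ z₂ * (qf x z₂ / ypol z₁ z₂)).re) / 4 := by
      rw [hid, ← Complex.add_re]
      simp
    have hxK : ‖x‖ ^ 2 ≤ 2 * K ^ 2 * (‖pf x z z'‖ ^ 2 + ‖qf x z / ypol z z'‖ ^ 2) := by
      have h1 := hKx x
      calc ‖x‖ ^ 2 ≤ (K * (‖pf x z z'‖ + ‖qf x z / ypol z z'‖)) ^ 2 := by gcongr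
        _ ≤ _ := by nlinarith [sq_nonneg (‖pf x z z'‖ - ‖qf x z / ypol z z'‖), sq_nonneg K,
            mul_nonneg (sq_nonneg K) (sq_nonneg (‖pf x z z'‖ - ‖qf x z / ypol z z'‖))]
    have hκ1 : κ * ‖x‖ ^ 2 ≤ 1 / (8 * K ^ 2) * ‖x‖ ^ 2 := by
      gcongr; exact min_le_left _ _
    have hxK' : ‖x‖ ^ 2 / (2 * K ^ 2) ≤ ‖pf x z z'‖ ^ 2 + ‖qf x z / ypol z z'‖ ^ 2 := by
      rw [div_le_iff₀ (by positivity)]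
      linarith
    have hlow : ‖x‖ ^ 2 / (16 * K ^ 2) ≤ (pf x z₁ z₂ ^ 2 / 2 - detV x).re := by
      rw [hre]
      have : ‖x‖ ^ 2 / (16 * K ^ 2) = (‖x‖ ^ 2 / (2 * K ^ 2) -
          2 * (1 / (8 * K ^ 2) * ‖x‖ ^ 2)) / 4 := by field_simp; ring
      rw [this]
      linarith
    have hc : min (Real.pi / (32 * K ^ 2)) (δ' / 2) ≤ Real.pi / (32 * K ^ 2) := min_le_left _ _
    have : min (Real.pi / (32 * K ^ 2)) (δ' / 2) * v * ‖x‖ ^ 2 ≤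
        2 * Real.pi * v * (‖x‖ ^ 2 / (16 * K ^ 2)) := by
      calc _ ≤ Real.pi / (32 * K ^ 2) * v * ‖x‖ ^ 2 := by gcongr
        _ = 2 * Real.pi * v * (‖x‖ ^ 2 / (16 * K ^ 2)) / 4 := by field_simp; ring
        _ ≤ _ := by
          have : 0 ≤ 2 * Real.pi * v * (‖x‖ ^ 2 / (16 * K ^ 2)) := by positivity
          linarith
    have h2 : 2 * Real.pi * v * (‖x‖ ^ 2 / (16 * K ^ 2)) ≤
        2 * Real.pi * v * (pf x z₁ z₂ ^ 2 / 2 - detV x).re := by gcongr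
    linarith
  · intro hqδ v hv
    rw [norm_termB]
    refine mul_le_mul (hpoly v hv) ?_ (Real.exp_pos _).le (by positivity)
    apply Real.exp_le_exp.2
    have h1 : δ' * (1 + ‖x‖ ^ 2) ≤ ‖qf x z / ypol z z'‖ ^ 2 := by
      rw [norm_div, div_pow, hδ', div_mul_eq_mul_div]
      gcongr
    have hκ1 : κ * ‖x‖ ^ 2 ≤ δ' / 2 * ‖x‖ ^ 2 := by
      gcongr; exact min_le_right _ _
    have hlow : δ' / 2 * (1 + ‖x‖ ^ 2) ≤
        (qf x z₁ / ypol z₁ z₂ * (qf x z₂ / ypol z₁ z₂)).re := by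
      have e1 : δ' * (1 + ‖x‖ ^ 2) = δ' + δ' * ‖x‖ ^ 2 := by ring
      have e2 : δ' / 2 * (1 + ‖x‖ ^ 2) = δ' / 2 + δ' / 2 * ‖x‖ ^ 2 := by ring
      linarith
    have h3 : min (Real.pi / (32 * K ^ 2)) (δ' / 2) * v * (1 + ‖x‖ ^ 2) ≤
        δ' / 2 * v * (1 + ‖x‖ ^ 2) := by gcongr; exact min_le_right _ _
    have h4 : v * (δ' / 2 * (1 + ‖x‖ ^ 2)) ≤
        v * (qf x z₁ / ypol z₁ z₂ * (qf x z₂ / ypol z₁ z₂)).re := by gcongr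
    have h5 : 0 ≤ v * (qf x z₁ / ypol z₁ z₂ * (qf x z₂ / ypol z₁ z₂)).re :=
      le_trans (by positivity) h4
    have h6 : v * (qf x z₁ / ypol z₁ z₂ * (qf x z₂ / ypol z₁ z₂)).re ≤
        Real.pi * (v * (qf x z₁ / ypol z₁ z₂ * (qf x z₂ / ypol z₁ z₂)).re) :=
      le_mul_of_one_le_left h5 (by linarith [Real.pi_gt_three])
    rw [neg_le_neg_iff, mul_assoc Real.pi]
    calc _ ≤ δ' / 2 * v * (1 + ‖x‖ ^ 2) := h3
      _ = v * (δ' / 2 * (1 + ‖x‖ ^ 2)) := by ring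
      _ ≤ _ := h4.trans h6

/-! ### Dominated sums of parameter integrals -/

/-- Sums of parameter integrals of holomorphic functions are holomorphic under domination. -/
theorem differentiableOn_tsum_integral {ι α : Type*} [MeasurableSpace α] {μ : Measure α}
    {U : Set ℂ} (hU : IsOpen U) {F : ι → ℂ → α → ℂ} {u : ι → ℝ} {g : α → ℝ}
    (hm : ∀ i, ∀ s ∈ U, AEStronglyMeasurable (F i s) μ)
    (hd : ∀ i, ∀ᵐ a ∂μ, DifferentiableOn ℂ (fun s => F i s a) U)
    (hb : ∀ i, ∀ᵐ a ∂μ, ∀ s ∈ U, ‖F i s a‖ ≤ u i * g a) (hu : Summable u)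
    (hg : Integrable g μ) :
    DifferentiableOn ℂ (fun s => ∑' i, ∫ a, F i s a ∂μ) U := by
  refine Complex.differentiableOn_tsum_of_summable_norm (u := fun i => u i * ∫ a, g a ∂μ)
    (hu.mul_right _) (fun i => ?_) hU fun i s hs => ?_
  · exact differentiableOn_integral_of_dominated hU (hm i) (hd i) (hb i) (hg.const_mul _)
  · rw [← integral_const_mul]
    exact norm_integral_le_of_norm_le (hg.const_mul _) ((hb i).mono fun a ha => ha s hs)

theorem norm_tsum_integral_le {ι α : Type*} [MeasurableSpace α] {μ : Measure α}
    {F : ι → α → ℂ} {u : ι → ℝ} {g : α → ℝ} (hb : ∀ i, ∀ᵐ a ∂μ, ‖F i a‖ ≤ u i * g a)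
    (hu : Summable u) (hg : Integrable g μ) :
    ‖∑' i, ∫ a, F i a ∂μ‖ ≤ ∑' i, u i * ∫ a, g a ∂μ := by
  refine tsum_of_norm_bounded (hu.mul_right (∫ a, g a ∂μ)).hasSum fun i => ?_
  rw [← integral_const_mul]
  exact norm_integral_le_of_norm_le (hg.const_mul _) (hb i)

theorem integral_tsum_of_dominated {ι α : Type*} [Countable ι] [MeasurableSpace α] {μ : Measure α}
    {F : ι → α → ℂ} {u : ι → ℝ} {g : α → ℝ} (hm : ∀ i, AEStronglyMeasurable (F i) μ)
    (hb : ∀ i, ∀ᵐ a ∂μ, ‖F i a‖ ≤ u i * g a)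
    (hu : Summable u) (hg : Integrable g μ) :
    ∫ a, ∑' i, F i a ∂μ = ∑' i, ∫ a, F i a ∂μ := by
  refine (integral_tsum_of_summable_integral_norm (fun i => (hg.const_mul _).mono' (hm i) (hb i))
    ?_).symm
  refine Summable.of_nonneg_of_le (fun i => integral_nonneg fun a => norm_nonneg _) (fun i => ?_)
    (hu.mul_right (∫ a, g a ∂μ))
  rw [← integral_const_mul]
  exact integral_mono_of_nonneg (Eventually.of_forall fun a => norm_nonneg _) (hg.const_mul _)
    (hb i)

/-! ### Fourier coefficients against discrete families of vectors -/

/-- A Fourier series `f` with exponents in `-q + ℤ`, bounded below, together with a discrete family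
of trace zero matrices with determinants in `q + ℤ`. -/
structure IsFourierFamily {ι : Type*} (x : ι → Fin 3 → ℝ) (f : ℍ → ℂ) (c : ℤ → ℂ) (q : ℝ)
    (m : ι → ℤ) (r : ℕ) : Prop where
  cont : Continuous f
  summ : Summable fun i => ((1 + ‖x i‖) ^ r)⁻¹
  bdd : ∃ N : ℤ, ∀ n < N, c n = 0
  hasSum : ∀ τ : ℍ, HasSum (fun n : ℤ => c n * ee (((n : ℂ) - (q : ℂ)) * τ)) (f τ)
  det : ∀ i, (m i : ℝ) = q - detV (x i)

theorem norm_ee_mul (a : ℝ) (τ : ℍ) :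
    ‖ee ((a : ℂ) * τ)‖ = Real.exp (-(2 * Real.pi * a * τ.im)) := by
  rw [ee, Complex.norm_exp]
  congr 1
  have : 2 * Real.pi * Complex.I * ((a : ℂ) * τ) =
      ((2 * Real.pi * a : ℝ) : ℂ) * (Complex.I * τ) := by push_cast; ring
  rw [this, Complex.re_ofReal_mul]
  simp

theorem abs_detV_le (x : Fin 3 → ℝ) : |detV x| ≤ 2 * ‖x‖ ^ 2 := by
  have h : ∀ i, |x i| ≤ ‖x‖ := fun i => norm_le_pi_norm x i
  rw [detV]
  calc _ ≤ |-(x 0) ^ 2| + |x 1 * x 2| := abs_sub _ _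
    _ = |x 0| ^ 2 + |x 1| * |x 2| := by rw [abs_neg, abs_pow, abs_mul]
    _ ≤ ‖x‖ ^ 2 + ‖x‖ * ‖x‖ := by gcongr <;> exact h _
    _ = _ := by ring

namespace IsFourierFamily

variable {ι : Type*} {x : ι → Fin 3 → ℝ} {f : ℍ → ℂ} {c : ℤ → ℂ} {q : ℝ} {m : ι → ℤ} {r : ℕ}

/-- Summability of (1 + ‖x‖)^(-r) already encodes discreteness: only finitely many terms exceed a
given positive number. -/
theorem finite_norm_le (h : IsFourierFamily x f c q m r) (R : ℝ) :
    {i | ‖x i‖ ≤ R}.Finite := by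
  have h1 := h.summ.tendsto_cofinite_zero
  rcases lt_or_ge R 0 with hR | hR
  · convert Set.finite_empty
    ext i
    simpa using hR.trans_le (norm_nonneg _)
  have hpos : (0 : ℝ) < ((1 + R) ^ r)⁻¹ := by positivity
  have h2 := h1.eventually (gt_mem_nhds hpos)
  rw [Filter.eventually_cofinite] at h2
  refine h2.subset fun i hi => ?_
  simp only [Set.mem_ofPred_eq, not_lt] at hi ⊢
  gcongr

theorem countable (h : IsFourierFamily x f c q m r) : Countable ι := by
  have : (Set.univ : Set ι) = ⋃ n : ℕ, {i | ‖x i‖ ≤ n} := by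
    ext i
    simpa using exists_nat_ge ‖x i‖
  rw [← Set.countable_univ_iff, this]
  exact Set.countable_iUnion fun n => (h.finite_norm_le n).countable

/-- Absolute convergence at the single point τ = iη/(2π) bounds all the coefficients. Since η is
arbitrary, they grow more slowly than every exponential. -/
theorem exists_coeff_le (h : IsFourierFamily x f c q m r) {η : ℝ} (hη : 0 < η) :
    ∃ C : ℝ, 0 ≤ C ∧ ∀ n, ‖c n‖ ≤ C * Real.exp (η * n) := by
  have hpi := Real.pi_pos
  let τ : ℍ := ⟨((η / (2 * Real.pi) : ℝ) : ℂ) * Complex.I, by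
    rw [Complex.im_ofReal_mul, Complex.I_im, mul_one]; positivity⟩
  have him : τ.im = η / (2 * Real.pi) := by
    change (((η / (2 * Real.pi) : ℝ) : ℂ) * Complex.I).im = _
    rw [Complex.im_ofReal_mul, Complex.I_im, mul_one]
  have hs := (h.hasSum τ).summable.norm
  refine ⟨(∑' n, ‖c n * ee (((n : ℂ) - (q : ℂ)) * τ)‖) * Real.exp (-(η * q)), by positivity,
    fun n => ?_⟩
  have h1 := hs.le_tsum n fun _ _ => norm_nonneg _
  have h2 : ((n : ℂ) - (q : ℂ)) = (((n : ℝ) - q : ℝ) : ℂ) := by push_cast; rfl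
  have h3 : ‖c n * ee (((n : ℂ) - (q : ℂ)) * τ)‖ = ‖c n‖ * Real.exp (-(η * (n - q))) := by
    rw [norm_mul, h2, norm_ee_mul, him]
    congr 2
    field_simp
  rw [h3] at h1
  calc ‖c n‖ = ‖c n‖ * Real.exp (-(η * (n - q))) * Real.exp (-(η * q)) * Real.exp (η * n) := by
        rw [mul_assoc, mul_assoc, ← Real.exp_add, ← Real.exp_add]
        ring_nf
        simp
    _ ≤ _ := by gcongr

/-- Because m = q - Q(λ) ≤ q + 2‖x‖², subexponential growth in m becomes growth slower than any
Gaussian in x, which the theta kernel can absorb. -/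
theorem exists_coeff_le' (h : IsFourierFamily x f c q m r) {η : ℝ} (hη : 0 < η) :
    ∃ C : ℝ, 0 ≤ C ∧ ∀ i, ‖c (m i)‖ ≤ C * Real.exp (η * ‖x i‖ ^ 2) := by
  obtain ⟨C, hC, hb⟩ := h.exists_coeff_le (half_pos hη)
  refine ⟨C * Real.exp (η / 2 * q), by positivity, fun i => (hb (m i)).trans ?_⟩
  rw [mul_assoc, ← Real.exp_add, h.det i]
  gcongr
  have := (abs_le.1 (abs_detV_le (x i))).1
  nlinarith

/-- If c(m) ≠ 0 then m ≥ N, so Q(λ) ≤ q - N. Then |`pf`|² = |`qf`/y|² + 4Q(λ) forces |`qf`| to be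
comparable with ‖x‖ once ‖x‖ is large. The remaining vectors are finitely many, and a common δ is
the minimum over those with `qf` ≠ 0. -/
theorem exists_qf_lower (h : IsFourierFamily x f c q m r) {z : ℂ} (hz : z.im ≠ 0) :
    ∃ δ > 0, ∀ i, c (m i) = 0 ∨ qf (x i) z = 0 ∨ δ * (1 + ‖x i‖ ^ 2) ≤ ‖qf (x i) z‖ ^ 2 := by
  obtain ⟨N, hN⟩ := h.bdd
  obtain ⟨K, hK, hKx⟩ := exists_norm_le_pf_qf hz
  have hyc : ypol z (starRingEnd ℂ z) = z.im := ypol_conj z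
  have hy0 : ypol z (starRingEnd ℂ z) ≠ 0 := by rw [hyc]; exact_mod_cast hz
  set B := |4 * (q - N)| with hB
  have hB0 : 0 ≤ B := abs_nonneg _
  -- For ‖x‖ > R the constant 2K²B in ‖x‖² ≤ 2K²(2S² + B) is at most (‖x‖² - 1)/2, so it can be
  -- absorbed on the left.
  set R := 1 + 4 * K ^ 2 * B with hR
  have hR1 : 1 ≤ R := by rw [hR]; have : 0 ≤ 4 * K ^ 2 * B := by positivity
                         linarith
  have hfin : ∀ t : Finset ι, ∃ δ > 0, ∀ i ∈ t, qf (x i) z ≠ 0 →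
      δ * (1 + ‖x i‖ ^ 2) ≤ ‖qf (x i) z‖ ^ 2 := by
    classical
    intro t
    induction t using Finset.induction_on with
    | empty => exact ⟨1, one_pos, by simp⟩
    | insert j t hj ih =>
      obtain ⟨δ, hδ, hδt⟩ := ih
      by_cases hq : qf (x j) z = 0
      · refine ⟨δ, hδ, fun i hi hne => ?_⟩
        rcases Finset.mem_insert.1 hi with rfl | hi
        · exact absurd hq hne
        · exact hδt i hi hne
      · have hpos : 0 < ‖qf (x j) z‖ ^ 2 / (1 + ‖x j‖ ^ 2) := by
          have := norm_pos_iff.2 hq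
          positivity
        refine ⟨min δ (‖qf (x j) z‖ ^ 2 / (1 + ‖x j‖ ^ 2)), by positivity, fun i hi hne => ?_⟩
        rcases Finset.mem_insert.1 hi with rfl | hi
        · rw [← le_div_iff₀ (by positivity)]
          exact min_le_right _ _
        · refine le_trans ?_ (hδt i hi hne)
          gcongr
          exact min_le_left _ _
  obtain ⟨δ, hδ, hδt⟩ := hfin (h.finite_norm_le R).toFinset
  refine ⟨min δ (z.im ^ 2 / (16 * K ^ 2)), by positivity, fun i => ?_⟩
  by_cases hc : c (m i) = 0
  · exact Or.inl hc
  by_cases hq : qf (x i) z = 0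
  · exact Or.inr (Or.inl hq)
  refine Or.inr (Or.inr ?_)
  rcases le_or_gt ‖x i‖ R with hxR | hxR
  · refine le_trans ?_ (hδt i (by simpa using hxR) hq)
    gcongr
    exact min_le_left _ _
  · have hmN : (N : ℝ) ≤ m i := by
      by_contra hlt
      exact hc (hN _ (by exact_mod_cast not_le.1 hlt))
    have hdet : 4 * detV (x i) ≤ B := by
      have := h.det i
      exact le_trans (by linarith) (le_abs_self (4 * (q - N)))
    have hid := pf_sq_sub (x i) hy0
    have hq2 : qf (x i) (starRingEnd ℂ z) / ypol z (starRingEnd ℂ z) =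
        starRingEnd ℂ (qf (x i) z / ypol z (starRingEnd ℂ z)) := by
      rw [hyc, map_div₀, Complex.conj_ofReal, qf_conj]
    rw [hq2, Complex.mul_conj, Complex.normSq_eq_norm_sq, ← pair_Zperp] at hid
    set S := ‖qf (x i) z / ypol z (starRingEnd ℂ z)‖ with hS
    have hid' : (pair (vecMat (x i)) (Zperp z)) ^ 2 - 4 * detV (x i) = S ^ 2 := by
      exact_mod_cast hid
    have hP : ‖pf (x i) z (starRingEnd ℂ z)‖ ^ 2 = S ^ 2 + 4 * detV (x i) := by
      rw [← pair_Zperp, Complex.norm_real, Real.norm_eq_abs, sq_abs]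
      linarith
    have hxK : ‖x i‖ ^ 2 ≤ 2 * K ^ 2 * (2 * S ^ 2 + B) := by
      have h1 := hKx (x i)
      rw [← hS] at h1
      calc ‖x i‖ ^ 2 ≤ (K * (‖pf (x i) z (starRingEnd ℂ z)‖ + S)) ^ 2 := by gcongr
        _ ≤ 2 * K ^ 2 * (‖pf (x i) z (starRingEnd ℂ z)‖ ^ 2 + S ^ 2) := by
            nlinarith [mul_nonneg (sq_nonneg K)
              (sq_nonneg (‖pf (x i) z (starRingEnd ℂ z)‖ - S))]
        _ ≤ _ := by
            refine mul_le_mul_of_nonneg_left ?_ (by positivity)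
            rw [hP]
            linarith
    have hx1 : R ≤ ‖x i‖ ^ 2 := by nlinarith
    have hSlow : 1 + ‖x i‖ ^ 2 ≤ 16 * K ^ 2 * S ^ 2 := by nlinarith
    have hSq : S ^ 2 * z.im ^ 2 = ‖qf (x i) z‖ ^ 2 := by
      rw [hS, norm_div, hyc, Complex.norm_real, Real.norm_eq_abs, div_pow, sq_abs,
        div_mul_cancel₀ _ (pow_ne_zero 2 hz)]
    calc _ ≤ z.im ^ 2 / (16 * K ^ 2) * (1 + ‖x i‖ ^ 2) := by
          gcongr; exact min_le_right _ _
      _ ≤ z.im ^ 2 / (16 * K ^ 2) * (16 * K ^ 2 * S ^ 2) := by gcongr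
      _ = S ^ 2 * z.im ^ 2 := by field_simp
      _ = _ := hSq

/-- Uniform bounds of all kernels near `(z, z̄)`, with a summable factor. -/
theorem exists_bounds (h : IsFourierFamily x f c q m r) (ℓ k : ℕ) {z : ℂ} (hz : z.im ≠ 0)
    {δ : ℝ} (hδ : 0 < δ) :
    ∃ ε > 0, (∃ C ≥ 0, ∃ d : ℕ,
      ∀ z₁ ∈ Metric.ball z ε, ∀ z₂ ∈ Metric.ball (starRingEnd ℂ z) ε, ypol z₁ z₂ ≠ 0 ∧
        ∀ i, ∀ u v : ℝ, 1 / 2 ≤ v → ‖termA ℓ k u v (x i) z₁ z₂‖ ≤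
          ((1 + ‖x i‖) ^ r)⁻¹ * (C * (1 + v) ^ d)) ∧
      ∃ C ≥ 0, ∃ d : ℕ, ∃ b > 0,
      ∀ z₁ ∈ Metric.ball z ε, ∀ z₂ ∈ Metric.ball (starRingEnd ℂ z) ε,
        ∀ i, δ * (1 + ‖x i‖ ^ 2) ≤ ‖qf (x i) z‖ ^ 2 → ∀ v : ℝ, 1 ≤ v →
          ‖c (m i) * termB ℓ k v (x i) z₁ z₂‖ ≤
          ((1 + ‖x i‖) ^ r)⁻¹ * (C * ((1 + v) ^ d * Real.exp (-(b * v)))) := by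
  obtain ⟨ε, hε, C, hC, d, b, hb, hbound⟩ := exists_uniform_bound ℓ k hz hδ
  -- As v ≥ 1/2 for the first kernel, exp(-bv‖x‖²) contains a factor exp(-b‖x‖²/2) that trades the
  -- polynomial growth for (1 + ‖x‖)^(-r). For the second kernel v ≥ 1, and the other half of the
  -- Gaussian pays for the coefficient c(m).
  obtain ⟨Cg, hCg, hg⟩ := exists_pow_mul_exp_neg_sq_le d r (c := b / 2) (by positivity)
  obtain ⟨Cc, hCc, hcc⟩ := h.exists_coeff_le' (η := b / 2) (by positivity)
  refine ⟨ε, hε, ⟨C * Cg, by positivity, d, fun z₁ hz₁ z₂ hz₂ => ?_⟩,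
    ⟨Cc * C * Cg, by positivity, d, b, hb, fun z₁ hz₁ z₂ hz₂ i hi v hv => ?_⟩⟩
  · refine ⟨(hbound z₁ hz₁ z₂ hz₂).1, fun i u v hv => ?_⟩
    have h1 := ((hbound z₁ hz₁ z₂ hz₂).2 (x i)).1 u v (by linarith)
    have h2 := hg ‖x i‖ (norm_nonneg _)
    calc _ ≤ C * (1 + v) ^ d * (1 + ‖x i‖) ^ d * Real.exp (-(b * v * ‖x i‖ ^ 2)) := h1
      _ ≤ C * (1 + v) ^ d * (1 + ‖x i‖) ^ d * Real.exp (-(b / 2 * ‖x i‖ ^ 2)) := by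
          have : 0 ≤ 1 + v := by linarith
          gcongr
          nlinarith
      _ = C * (1 + v) ^ d * ((1 + ‖x i‖) ^ d * Real.exp (-(b / 2 * ‖x i‖ ^ 2))) := by ring
      _ ≤ C * (1 + v) ^ d * (Cg * ((1 + ‖x i‖) ^ r)⁻¹) := by
          have : 0 ≤ 1 + v := by linarith
          gcongr
      _ = _ := by ring
  · have h1 := ((hbound z₁ hz₁ z₂ hz₂).2 (x i)).2 hi v (by linarith)
    have h2 := hg ‖x i‖ (norm_nonneg _)
    have hv0 : 0 ≤ 1 + v := by linarith
    rw [norm_mul]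
    calc _ ≤ Cc * Real.exp (b / 2 * ‖x i‖ ^ 2) *
          (C * (1 + v) ^ d * (1 + ‖x i‖) ^ d * Real.exp (-(b * v * (1 + ‖x i‖ ^ 2)))) := by
          gcongr
          exact hcc i
      _ = Cc * C * (1 + v) ^ d * (1 + ‖x i‖) ^ d * Real.exp (-(b * v)) *
          (Real.exp (b / 2 * ‖x i‖ ^ 2) * Real.exp (-(b * v * ‖x i‖ ^ 2))) := by
          rw [mul_add, mul_one, neg_add, Real.exp_add]
          ring
      _ ≤ Cc * C * (1 + v) ^ d * (1 + ‖x i‖) ^ d * Real.exp (-(b * v)) *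
          Real.exp (-(b / 2 * ‖x i‖ ^ 2)) := by
          rw [← Real.exp_add]
          gcongr
          nlinarith [mul_nonneg (mul_nonneg hb.le (sub_nonneg.2 hv)) (sq_nonneg ‖x i‖)]
      _ = Cc * C * (1 + v) ^ d * Real.exp (-(b * v)) *
          ((1 + ‖x i‖) ^ d * Real.exp (-(b / 2 * ‖x i‖ ^ 2))) := by ring
      _ ≤ Cc * C * (1 + v) ^ d * Real.exp (-(b * v)) * (Cg * ((1 + ‖x i‖) ^ r)⁻¹) := by
          gcongr
      _ = _ := by ring

end IsFourierFamily

/-! ### Integration over the truncated fundamental domain -/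

/-- The part of the standard strip with height between `1` and `T`. -/
def stripFD (T : ℝ) : Set ℍ := {τ | τ.re ∈ Set.Icc (-1 / 2 : ℝ) (1 / 2) ∧ τ.im ∈ Set.Ioc 1 T}

theorem measurableSet_stripFD (T : ℝ) : MeasurableSet (stripFD T) :=
  (UpperHalfPlane.continuous_re.measurable measurableSet_Icc).inter
    (UpperHalfPlane.continuous_im.measurable measurableSet_Ioc)

theorem integral_stripFD_eq_complex (g : ℍ → ℂ) (T : ℝ) :
    ∫ τ in stripFD T, g τ = ∫ ζ in UpperHalfPlane.coe '' stripFD T,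
      ((ζ.im ^ 2 : ℝ) : ℂ)⁻¹ * g (UpperHalfPlane.ofComplex ζ) := by
  have hmp : MeasurePreserving UpperHalfPlane.coe (volume.comap UpperHalfPlane.coe)
      (volume.restrict (.range UpperHalfPlane.coe)) :=
    ⟨measurable_coe, by rw [measurableEmbedding_coe.map_comap]⟩
  rw [volume_def, setIntegral_withDensity_eq_setIntegral_smul _ _ (measurableSet_stripFD T)]
  · have h := hmp.setIntegral_image_emb measurableEmbedding_coe
      (fun ζ : ℂ => ((ζ.im ^ 2 : ℝ) : ℂ)⁻¹ * g (UpperHalfPlane.ofComplex ζ)) (stripFD T)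
    rw [Measure.restrict_restrict_of_subset (Set.image_subset_range _ _)] at h
    rw [h]
    refine setIntegral_congr_fun (measurableSet_stripFD T) fun τ _ => ?_
    simp only [ofComplex_apply, NNReal.smul_def, Complex.real_smul]
    congr 1
    push_cast
    simp
  · refine Measurable.pow_const (Measurable.const_div ?_ _) _
    exact UpperHalfPlane.continuous_im.measurable.subtype_mk

/-- Fubini in the coordinates (u, v), with hyperbolic density v⁻². Continuity is asked only on Im τ
> 1/2, an open set containing the whole fundamental domain. -/
theorem integral_stripFD {g : ℍ → ℂ} (hg : ContinuousOn g {τ : ℍ | 1 / 2 < τ.im}) (T : ℝ) :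
    ∫ τ in stripFD T, g τ = ∫ v in Set.Ioc 1 T, ((v ^ 2 : ℝ) : ℂ)⁻¹ *
      ∫ u in Set.Icc (-1 / 2 : ℝ) (1 / 2), g (UpperHalfPlane.ofComplex (u + v * Complex.I)) := by
  rw [integral_stripFD_eq_complex]
  have himg : UpperHalfPlane.coe '' stripFD T = Complex.measurableEquivRealProd ⁻¹'
      (Set.Icc (-1 / 2 : ℝ) (1 / 2) ×ˢ Set.Ioc 1 T) := by
    ext ζ
    constructor
    · rintro ⟨τ, hτ, rfl⟩
      exact hτ
    · intro hζ
      have him : 0 < ζ.im := one_pos.trans hζ.2.1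
      exact ⟨⟨ζ, him⟩, hζ, rfl⟩
  have hmp := Complex.volume_preserving_equiv_real_prod
  have h := hmp.setIntegral_preimage_emb Complex.measurableEquivRealProd.measurableEmbedding
    (fun p : ℝ × ℝ => ((p.2 ^ 2 : ℝ) : ℂ)⁻¹ *
      g (UpperHalfPlane.ofComplex (p.1 + p.2 * Complex.I)))
    (Set.Icc (-1 / 2 : ℝ) (1 / 2) ×ˢ Set.Ioc 1 T)
  rw [himg]
  refine Eq.trans (Eq.trans ?_ h) ?_
  · refine integral_congr_ae (Eventually.of_forall fun ζ => ?_)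
    simp only [Complex.measurableEquivRealProd_apply, Complex.re_add_im]
  have hint : IntegrableOn (fun p : ℝ × ℝ => ((p.2 ^ 2 : ℝ) : ℂ)⁻¹ *
      g (UpperHalfPlane.ofComplex (p.1 + p.2 * Complex.I)))
      (Set.Icc (-1 / 2 : ℝ) (1 / 2) ×ˢ Set.Ioc 1 T) := by
    refine IntegrableOn.mono_set (t := Set.Icc (-1 / 2 : ℝ) (1 / 2) ×ˢ Set.Icc 1 T) ?_
      (Set.prod_mono le_rfl Set.Ioc_subset_Icc_self)
    refine ContinuousOn.integrableOn_compact (isCompact_Icc.prod isCompact_Icc) ?_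
    refine ContinuousOn.mul ?_ ?_
    · refine ContinuousOn.inv₀ (by fun_prop) fun p hp => ?_
      have : (0 : ℝ) < p.2 := one_pos.trans_le hp.2.1
      exact_mod_cast (pow_pos this 2).ne'
    · have hmaps : ∀ p ∈ Set.Icc (-1 / 2 : ℝ) (1 / 2) ×ˢ Set.Icc (1 : ℝ) T,
          ((p.1 : ℂ) + p.2 * Complex.I).im = p.2 := by
        intro p _
        simp
      refine ContinuousOn.comp (t := {τ : ℍ | 1 / 2 < τ.im}) hg ?_ ?_
      · intro p hp
        have hpos : 0 < ((p.1 : ℂ) + p.2 * Complex.I).im := by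
          rw [hmaps p hp]; exact one_pos.trans_le hp.2.1
        have h1 : ContinuousAt (UpperHalfPlane.ofComplex : ℂ → ℍ)
            ((p.1 : ℂ) + p.2 * Complex.I) :=
          UpperHalfPlane.contMDiffAt_ofComplex (n := 0) hpos |>.continuousAt
        exact (h1.comp (f := fun p : ℝ × ℝ => ((p.1 : ℂ) + p.2 * Complex.I))
          (by fun_prop)).continuousWithinAt
      · intro p hp
        have hpos : 0 < ((p.1 : ℂ) + p.2 * Complex.I).im := by
          rw [hmaps p hp]; exact one_pos.trans_le hp.2.1
        have : (UpperHalfPlane.ofComplex ((p.1 : ℂ) + p.2 * Complex.I)).im = p.2 := by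
          rw [ofComplex_apply_of_im_pos hpos]
          exact hmaps p hp
        simp only [Set.mem_ofPred_eq, this]
        linarith [hp.2.1]
  rw [IntegrableOn, Measure.volume_eq_prod, ← Measure.prod_restrict] at hint
  rw [Measure.volume_eq_prod, ← Measure.prod_restrict, integral_prod_symm _ hint]
  refine integral_congr_ae (Eventually.of_forall fun v => ?_)
  simp only
  rw [integral_const_mul]

theorem one_half_lt_im {τ : ℍ} (h : τ ∈ ModularGroup.fd) : 1 / 2 < τ.im := by
  have := ModularGroup.three_le_four_mul_im_sq_of_mem_fd h
  have := τ.im_pos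
  nlinarith

theorem isCompact_truncFD (T : ℝ) : IsCompact (truncFD T) :=
  ModularGroup.isCompact_truncatedFundamentalDomain T

/-- Above height 1 the condition |τ| ≥ 1 is automatic, so the domain is a full rectangle there and u
runs over a complete period. -/
theorem truncFD_eq_union {T : ℝ} (hT : 1 ≤ T) : truncFD T = truncFD 1 ∪ stripFD T := by
  ext τ
  simp only [truncFD, stripFD, Set.mem_union, Set.mem_ofPred_eq, Set.mem_Icc, Set.mem_Ioc,
    ModularGroup.fd]
  constructor
  · rintro ⟨⟨h1, h2⟩, h3⟩
    rcases le_or_gt τ.im 1 with h | h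
    · exact Or.inl ⟨⟨h1, h2⟩, h⟩
    · refine Or.inr ⟨?_, h, h3⟩
      rw [abs_le] at h2
      constructor <;> linarith [h2.1, h2.2]
  · rintro (⟨h1, h2⟩ | ⟨⟨h1, h2⟩, h3, h4⟩)
    · exact ⟨h1, h2.trans hT⟩
    · refine ⟨⟨?_, ?_⟩, h4⟩
      · rw [Complex.normSq_apply]
        have : (τ : ℂ).im = τ.im := rfl
        rw [this]
        nlinarith [mul_self_nonneg (τ : ℂ).re]
      · rw [abs_le]
        constructor <;> linarith

theorem disjoint_truncFD_stripFD (T : ℝ) : Disjoint (truncFD 1) (stripFD T) := by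
  rw [Set.disjoint_left]
  rintro τ ⟨-, h1⟩ ⟨-, h2, -⟩
  exact absurd h1 (not_le.2 h2)

theorem integral_truncFD {g : ℍ → ℂ} (hg : ContinuousOn g {τ : ℍ | 1 / 2 < τ.im}) {T : ℝ}
    (hT : 1 ≤ T) :
    ∫ τ in truncFD T, g τ = (∫ τ in truncFD 1, g τ) + ∫ v in Set.Ioc 1 T, ((v ^ 2 : ℝ) : ℂ)⁻¹ *
      ∫ u in Set.Icc (-1 / 2 : ℝ) (1 / 2), g (UpperHalfPlane.ofComplex (u + v * Complex.I)) := by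
  have hint : ∀ T, IntegrableOn g (truncFD T) := fun T =>
    (hg.mono fun τ hτ => one_half_lt_im hτ.1).integrableOn_compact (isCompact_truncFD T)
  have hsub : stripFD T ⊆ truncFD T := by
    rw [truncFD_eq_union hT]; exact Set.subset_union_right
  rw [← integral_stripFD hg, ← setIntegral_union (disjoint_truncFD_stripFD T)
    (measurableSet_stripFD T) (hint 1) ((hint T).mono_set hsub), ← truncFD_eq_union hT]

/-! ### The compact and the cuspidal kernels -/

/-- The exponent of `v` in the theta kernel. -/
noncomputable def thetaExp (ℓ k : ℕ) : ℝ := (k : ℝ) + 1 - (ℓ : ℝ) / 2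

/-- The integrand over the compact part of the fundamental domain. -/
noncomputable def kerA (ℓ k : ℕ) (f : ℍ → ℂ) (s : ℂ) (τ : ℍ) (x : Fin 3 → ℝ) (z₁ z₂ : ℂ) : ℂ :=
  f τ * (τ.im : ℂ) ^ ((thetaExp ℓ k : ℂ) - s) * termA ℓ k τ.re τ.im x z₁ z₂

/-- The integrand over the cusp, after integration over the real part. -/
noncomputable def kerB (ℓ k : ℕ) (β : ℂ) (s : ℂ) (v : ℝ) (x : Fin 3 → ℝ) (z₁ z₂ : ℂ) : ℂ :=
  (v : ℂ) ^ ((thetaExp ℓ k : ℂ) - 2 - s) * (β * termB ℓ k v x z₁ z₂)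

/-- The contribution of the compact part of the fundamental domain. -/
noncomputable def liftA {ι : Type*} (ℓ k : ℕ) (f : ℍ → ℂ) (x : ι → Fin 3 → ℝ) (s z₁ z₂ : ℂ) : ℂ :=
  ∑' i, ∫ τ in truncFD 1, kerA ℓ k f s τ (x i) z₁ z₂

/-- The contribution of the cusp. -/
noncomputable def liftB {ι : Type*} (ℓ k : ℕ) (β : ι → ℂ) (x : ι → Fin 3 → ℝ) (s z₁ z₂ : ℂ) : ℂ :=
  ∑' i, ∫ v in Set.Ioi (1 : ℝ), kerB ℓ k (β i) s v (x i) z₁ z₂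

theorem continuous_polyPart {X : Type*} [TopologicalSpace X] (ℓ k : ℕ) {v : X → ℝ}
    (hv : Continuous v) (x : Fin 3 → ℝ) (z₁ z₂ : ℂ) :
    Continuous fun a => polyPart ℓ k (v a) x z₁ z₂ := by
  unfold polyPart
  refine (continuous_const.mul ?_).mul continuous_const
  exact (Polynomial.continuous_aeval _).comp (by fun_prop)

theorem continuous_termA {X : Type*} [TopologicalSpace X] (ℓ k : ℕ) {u v : X → ℝ}
    (hu : Continuous u) (hv : Continuous v) (x : Fin 3 → ℝ) (z₁ z₂ : ℂ) :
    Continuous fun a => termA ℓ k (u a) (v a) x z₁ z₂ := by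
  unfold termA
  exact (continuous_polyPart ℓ k hv x z₁ z₂).mul (by fun_prop)

theorem continuous_termB (ℓ k : ℕ) (x : Fin 3 → ℝ) (z₁ z₂ : ℂ) :
    Continuous fun v : ℝ => termB ℓ k v x z₁ z₂ := by
  unfold termB
  exact (continuous_polyPart ℓ k continuous_id x z₁ z₂).mul (by fun_prop)

theorem continuous_im_cpow (w : ℂ) : Continuous fun τ : ℍ => (τ.im : ℂ) ^ w := by
  refine continuous_iff_continuousAt.2 fun τ => ContinuousAt.cpow ?_ continuousAt_const ?_
  · exact (Complex.continuous_ofReal.comp UpperHalfPlane.continuous_im).continuousAt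
  · exact Complex.ofReal_mem_slitPlane.2 τ.im_pos

theorem continuousOn_ofReal_cpow (w : ℂ) : ContinuousOn (fun v : ℝ => (v : ℂ) ^ w) (Set.Ioi 0) := by
  intro v hv
  refine (ContinuousAt.cpow ?_ continuousAt_const ?_).continuousWithinAt
  · exact Complex.continuous_ofReal.continuousAt
  · exact Complex.ofReal_mem_slitPlane.2 hv

theorem continuous_kerA {f : ℍ → ℂ} (hf : Continuous f) (ℓ k : ℕ) (s : ℂ) (x : Fin 3 → ℝ)
    (z₁ z₂ : ℂ) : Continuous fun τ : ℍ => kerA ℓ k f s τ x z₁ z₂ := by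
  exact (hf.mul (continuous_im_cpow _)).mul
    (continuous_termA ℓ k UpperHalfPlane.continuous_re UpperHalfPlane.continuous_im x z₁ z₂)

theorem continuousOn_kerB (ℓ k : ℕ) (β s : ℂ) (x : Fin 3 → ℝ) (z₁ z₂ : ℂ) :
    ContinuousOn (fun v : ℝ => kerB ℓ k β s v x z₁ z₂) (Set.Ioi 0) :=
  (continuousOn_ofReal_cpow _).mul
    (continuous_const.mul (continuous_termB ℓ k x z₁ z₂)).continuousOn

theorem aestronglyMeasurable_kerB (ℓ k : ℕ) (β s : ℂ) (x : Fin 3 → ℝ) (z₁ z₂ : ℂ) :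
    AEStronglyMeasurable (fun v : ℝ => kerB ℓ k β s v x z₁ z₂)
      (volume.restrict (Set.Ioi (1 : ℝ))) :=
  ((continuousOn_kerB ℓ k β s x z₁ z₂).mono (Set.Ioi_subset_Ioi zero_le_one)).aestronglyMeasurable
    measurableSet_Ioi

theorem norm_cpow_le_of_half_le {v : ℝ} (hv : 1 / 2 ≤ v) (w : ℂ) :
    ‖(v : ℂ) ^ w‖ ≤ Real.exp (‖w‖ * (1 + v)) := by
  have hv0 : 0 < v := by linarith
  rw [Complex.norm_cpow_eq_rpow_re_of_pos hv0, Real.rpow_def_of_pos hv0]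
  apply Real.exp_le_exp.2
  have h1 : |Real.log v| ≤ 1 + v := by
    rw [abs_le]
    constructor
    · have := Real.log_le_log (by norm_num) hv
      rw [one_div, Real.log_inv] at this
      linarith [Real.log_two_lt_d9]
    · linarith [Real.log_le_self hv0.le]
  calc _ ≤ |Real.log v * w.re| := le_abs_self _
    _ = |w.re| * |Real.log v| := by rw [abs_mul, mul_comm]
    _ ≤ _ := by
      gcongr
      exact Complex.abs_re_le_norm w

theorem norm_cpow_le_of_one_le {v : ℝ} (hv : 1 ≤ v) {w : ℂ} {D : ℕ} (hw : ‖w‖ ≤ D) :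
    ‖(v : ℂ) ^ w‖ ≤ (1 + v) ^ D := by
  have hv0 : 0 < v := by linarith
  rw [Complex.norm_cpow_eq_rpow_re_of_pos hv0]
  calc v ^ w.re ≤ v ^ (D : ℝ) :=
        Real.rpow_le_rpow_of_exponent_le hv ((Complex.re_le_norm w).trans hw)
    _ = v ^ D := Real.rpow_natCast v D
    _ ≤ _ := by gcongr; linarith

theorem integrableOn_pow_mul_exp (D : ℕ) {b : ℝ} (hb : 0 < b) :
    IntegrableOn (fun v : ℝ => (1 + v) ^ D * Real.exp (-(b * v))) (Set.Ioi 1) := by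
  have hb2 : 0 < b / 2 := by positivity
  refine Integrable.mono' ((exp_neg_integrableOn_Ioi 1 hb2).const_mul
    (D.factorial / (b / 2) ^ D * Real.exp (b / 2))) ?_ ?_
  · exact (by fun_prop : Continuous _).aestronglyMeasurable
  · filter_upwards [self_mem_ae_restrict measurableSet_Ioi] with v hv
    have hv0 : 0 ≤ v := (zero_lt_one.trans hv).le
    rw [Real.norm_of_nonneg (by positivity)]
    calc (1 + v) ^ D * Real.exp (-(b * v)) =
        (1 + v) ^ D * Real.exp (-(b / 2 * v)) * Real.exp (-(b / 2) * v) := by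
          rw [mul_assoc, ← Real.exp_add]; ring_nf
      _ ≤ _ := mul_le_mul_of_nonneg_right (pow_mul_exp_neg_le D hb2 hv0) (Real.exp_pos _).le

theorem integral_exp_two_pi_int (n : ℤ) :
    ∫ u in Set.Icc (-1 / 2 : ℝ) (1 / 2), Complex.exp (2 * Real.pi * Complex.I * (n * u)) =
      if n = 0 then 1 else 0 := by
  rw [integral_Icc_eq_integral_Ioc, ← intervalIntegral.integral_of_le (by norm_num)]
  split_ifs with h
  · subst h
    simp
    norm_num
  · have hne : 2 * Real.pi * Complex.I * n ≠ 0 := by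
      have : (n : ℂ) ≠ 0 := by exact_mod_cast h
      have := Real.pi_ne_zero
      simp_all
    have := integral_exp_mul_complex (a := -1 / 2) (b := 1 / 2) hne
    simp only [mul_assoc] at this ⊢
    rw [this, div_eq_zero_iff]
    left
    rw [sub_eq_zero, Complex.exp_eq_exp_iff_exists_int]
    exact ⟨n, by push_cast; ring⟩

namespace IsFourierFamily

variable {ι : Type*} {x : ι → Fin 3 → ℝ} {f : ℍ → ℂ} {c : ℤ → ℂ} {q : ℝ} {m : ι → ℤ} {r : ℕ}

theorem coe_ofComplex {u v : ℝ} (hv : 0 < v) :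
    ((UpperHalfPlane.ofComplex (u + v * Complex.I) : ℍ) : ℂ) = u + v * Complex.I := by
  rw [ofComplex_apply_of_im_pos (by simpa using hv)]

theorem im_ofComplex {u v : ℝ} (hv : 0 < v) :
    (UpperHalfPlane.ofComplex (u + v * Complex.I) : ℍ).im = v := by
  rw [← UpperHalfPlane.coe_im, coe_ofComplex hv]; simp

theorem re_ofComplex {u v : ℝ} (hv : 0 < v) :
    (UpperHalfPlane.ofComplex (u + v * Complex.I) : ℍ).re = u := by
  rw [← UpperHalfPlane.coe_re, coe_ofComplex hv]; simp

theorem continuous_horizontal (h : IsFourierFamily x f c q m r) {v : ℝ} (hv : 0 < v) :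
    Continuous fun u : ℝ => f (UpperHalfPlane.ofComplex (u + v * Complex.I)) := by
  refine h.cont.comp (continuous_iff_continuousAt.2 fun u => ?_)
  have hpos : 0 < ((u : ℂ) + v * Complex.I).im := by simpa using hv
  have h1 : ContinuousAt (UpperHalfPlane.ofComplex : ℂ → ℍ) ((u : ℂ) + v * Complex.I) :=
    UpperHalfPlane.contMDiffAt_ofComplex (n := 0) hpos |>.continuousAt
  exact h1.comp (f := fun u : ℝ => ((u : ℂ) + v * Complex.I)) (by fun_prop)

/-- Integration over the real part picks out one Fourier coefficient. -/
theorem integral_mul_termA (h : IsFourierFamily x f c q m r) (ℓ k : ℕ) {v : ℝ} (hv : 0 < v)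
    (i : ι) {z₁ z₂ : ℂ} (hy : ypol z₁ z₂ ≠ 0) :
    ∫ u in Set.Icc (-1 / 2 : ℝ) (1 / 2), f (UpperHalfPlane.ofComplex (u + v * Complex.I)) *
      termA ℓ k u v (x i) z₁ z₂ = c (m i) * termB ℓ k v (x i) z₁ z₂ := by
  have hterm : ∀ u : ℝ, HasSum (fun n : ℤ => c n * ee (((n : ℂ) - q) * (u + v * Complex.I)) *
      termA ℓ k u v (x i) z₁ z₂) (f (UpperHalfPlane.ofComplex (u + v * Complex.I)) *
      termA ℓ k u v (x i) z₁ z₂) := by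
    intro u
    have := (h.hasSum (UpperHalfPlane.ofComplex (u + v * Complex.I))).mul_right
      (termA ℓ k u v (x i) z₁ z₂)
    rwa [coe_ofComplex hv] at this
  -- The n-th Fourier term times the theta summand is constant in u except for the character e((n -
  -- m)u), so only n = m survives integration over a period. For n = m the exponent is the
  -- right-hand side of `pf_sq_sub`.
  have hterm' : ∀ n : ℤ, ∀ u : ℝ, c n * ee (((n : ℂ) - q) * (u + v * Complex.I)) *
      termA ℓ k u v (x i) z₁ z₂ =
      (c n * Complex.exp (-2 * Real.pi * v * (n - m i)) * termB ℓ k v (x i) z₁ z₂) *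
        Complex.exp (2 * Real.pi * Complex.I * (((n - m i : ℤ) : ℂ) * u)) := by
    intro n u
    have hm : (m i : ℂ) = q - detV (x i) := by
      exact_mod_cast congrArg (fun t : ℝ => (t : ℂ)) (h.det i)
    rw [termA, termB, ee, ← pf_sq_sub _ hy]
    have e1 : 2 * Real.pi * Complex.I * (((n : ℂ) - q) * (u + v * Complex.I)) +
        (2 * Real.pi * Complex.I * (detV (x i) * u) -
          2 * Real.pi * v * (pf (x i) z₁ z₂ ^ 2 / 2 - detV (x i))) =
        -2 * Real.pi * v * (n - m i) + (-(Real.pi * v * (pf (x i) z₁ z₂ ^ 2 - 4 * detV (x i)))) +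
        2 * Real.pi * Complex.I * (((n - m i : ℤ) : ℂ) * u) := by
      push_cast
      rw [hm]
      linear_combination 2 * Real.pi * ((n : ℂ) - q) * v * Complex.I_sq
    have e2 := congrArg Complex.exp e1
    simp only [Complex.exp_add] at e2
    linear_combination c n * polyPart ℓ k v (x i) z₁ z₂ * e2
  have hnorm : ∀ u : ℝ, ‖termA ℓ k u v (x i) z₁ z₂‖ = ‖termA ℓ k 0 v (x i) z₁ z₂‖ := by
    intro u; rw [norm_termA, norm_termA]
  have hne : ∀ n : ℤ, ∀ u : ℝ, ‖ee (((n : ℂ) - q) * (u + v * Complex.I))‖ =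
      ‖ee (((n : ℂ) - q) * ((0 : ℝ) + v * Complex.I))‖ := by
    intro n u
    have h2 : ((n : ℂ) - (q : ℂ)) = (((n : ℝ) - q : ℝ) : ℂ) := by push_cast; rfl
    rw [← coe_ofComplex (u := u) hv, ← coe_ofComplex (u := 0) hv, h2, norm_ee_mul, norm_ee_mul,
      im_ofComplex hv,
      im_ofComplex hv]
  have hsum : Summable fun n : ℤ => ‖c n * ee (((n : ℂ) - q) * ((0 : ℝ) + v * Complex.I))‖ := by
    have := (h.hasSum (UpperHalfPlane.ofComplex ((0 : ℝ) + v * Complex.I))).summable.norm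
    rwa [coe_ofComplex hv] at this
  calc _ = ∫ u in Set.Icc (-1 / 2 : ℝ) (1 / 2), ∑' n : ℤ,
        c n * ee (((n : ℂ) - q) * (u + v * Complex.I)) * termA ℓ k u v (x i) z₁ z₂ := by
        refine integral_congr_ae (Eventually.of_forall fun u => ?_)
        exact (hterm u).tsum_eq.symm
    _ = ∑' n : ℤ, ∫ u in Set.Icc (-1 / 2 : ℝ) (1 / 2),
        c n * ee (((n : ℂ) - q) * (u + v * Complex.I)) * termA ℓ k u v (x i) z₁ z₂ := by
        refine integral_tsum_of_dominated (F := fun (n : ℤ) (u : ℝ) =>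
          c n * ee (((n : ℂ) - q) * (u + v * Complex.I)) * termA ℓ k u v (x i) z₁ z₂)
          (u := fun n : ℤ => ‖c n * ee (((n : ℂ) - q) * ((0 : ℝ) + v * Complex.I))‖)
          (g := fun _ => ‖termA ℓ k 0 v (x i) z₁ z₂‖) (fun n => ?_) (fun n => ?_) hsum ?_
        · refine Continuous.aestronglyMeasurable ?_
          have hA : Continuous fun u : ℝ => termA ℓ k u v (x i) z₁ z₂ :=
            continuous_termA ℓ k continuous_id continuous_const (x i) z₁ z₂
          have hE : Continuous fun u : ℝ => ee (((n : ℂ) - q) * (u + v * Complex.I)) := by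
            unfold ee
            fun_prop
          exact (continuous_const.mul hE).mul hA
        · refine Eventually.of_forall fun u => ?_
          rw [norm_mul, norm_mul, norm_mul, hnorm, hne]
        · exact integrable_const _
    _ = ∑' n : ℤ, if n = m i then c (m i) * termB ℓ k v (x i) z₁ z₂ else 0 := by
        refine tsum_congr fun n => ?_
        simp only [hterm']
        rw [integral_const_mul, integral_exp_two_pi_int]
        by_cases hn : n = m i
        · subst hn; simp
        · rw [if_neg hn, if_neg (sub_ne_zero.2 hn), mul_zero]
    _ = _ := tsum_ite_eq _ _

end IsFourierFamily

/-! ### Holomorphy of the kernels in the polarized variables and in s -/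

theorem differentiableOn_qf (x : Fin 3 → ℝ) {U : Set ℂ} {ζ : ℂ → ℂ}
    (h : DifferentiableOn ℂ ζ U) : DifferentiableOn ℂ (fun w => qf x (ζ w)) U := by
  unfold qf
  fun_prop

theorem differentiableOn_ypol {U : Set ℂ} {ζ₁ ζ₂ : ℂ → ℂ}
    (h₁ : DifferentiableOn ℂ ζ₁ U) (h₂ : DifferentiableOn ℂ ζ₂ U) :
    DifferentiableOn ℂ (fun w => ypol (ζ₁ w) (ζ₂ w)) U := by
  unfold ypol
  fun_prop

theorem differentiableOn_pf (x : Fin 3 → ℝ) {U : Set ℂ} {ζ₁ ζ₂ : ℂ → ℂ}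
    (h₁ : DifferentiableOn ℂ ζ₁ U) (h₂ : DifferentiableOn ℂ ζ₂ U)
    (hy : ∀ w ∈ U, ypol (ζ₁ w) (ζ₂ w) ≠ 0) :
    DifferentiableOn ℂ (fun w => pf x (ζ₁ w) (ζ₂ w)) U := by
  unfold pf
  exact DifferentiableOn.div (by fun_prop) (differentiableOn_ypol h₁ h₂) hy

theorem differentiableOn_polyPart (ℓ k : ℕ) (v : ℝ) (x : Fin 3 → ℝ) {U : Set ℂ} {ζ₁ ζ₂ : ℂ → ℂ}
    (h₁ : DifferentiableOn ℂ ζ₁ U) (h₂ : DifferentiableOn ℂ ζ₂ U)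
    (hy : ∀ w ∈ U, ypol (ζ₁ w) (ζ₂ w) ≠ 0) :
    DifferentiableOn ℂ (fun w => polyPart ℓ k v x (ζ₁ w) (ζ₂ w)) U := by
  have hp := (differentiableOn_pf x h₁ h₂ hy).const_mul (Real.sqrt (Real.pi * v) : ℂ)
  have hq := ((differentiableOn_qf x h₂).const_mul (-(1 / (Real.sqrt 2 : ℂ)))).pow k
  have hd : Differentiable ℂ fun y : ℂ => Polynomial.aeval y (hermiteH ℓ) := by
    simp only [Polynomial.aeval_def, Polynomial.eval₂_eq_eval_map]
    exact Polynomial.differentiable _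
  have hH : DifferentiableOn ℂ (fun w => Polynomial.aeval
      ((Real.sqrt (Real.pi * v) : ℂ) * pf x (ζ₁ w) (ζ₂ w)) (hermiteH ℓ)) U :=
    hd.comp_differentiableOn hp
  unfold polyPart
  exact (hH.const_mul _).mul hq

theorem differentiableOn_termA (ℓ k : ℕ) (u v : ℝ) (x : Fin 3 → ℝ) {U : Set ℂ} {ζ₁ ζ₂ : ℂ → ℂ}
    (h₁ : DifferentiableOn ℂ ζ₁ U) (h₂ : DifferentiableOn ℂ ζ₂ U)
    (hy : ∀ w ∈ U, ypol (ζ₁ w) (ζ₂ w) ≠ 0) :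
    DifferentiableOn ℂ (fun w => termA ℓ k u v x (ζ₁ w) (ζ₂ w)) U := by
  have hp := differentiableOn_pf x h₁ h₂ hy
  unfold termA
  exact (differentiableOn_polyPart ℓ k v x h₁ h₂ hy).mul (by fun_prop)

theorem differentiableOn_termB (ℓ k : ℕ) (v : ℝ) (x : Fin 3 → ℝ) {U : Set ℂ} {ζ₁ ζ₂ : ℂ → ℂ}
    (h₁ : DifferentiableOn ℂ ζ₁ U) (h₂ : DifferentiableOn ℂ ζ₂ U)
    (hy : ∀ w ∈ U, ypol (ζ₁ w) (ζ₂ w) ≠ 0) :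
    DifferentiableOn ℂ (fun w => termB ℓ k v x (ζ₁ w) (ζ₂ w)) U := by
  have hq₁ := (differentiableOn_qf x h₁).fun_div (differentiableOn_ypol h₁ h₂) hy
  have hq₂ := (differentiableOn_qf x h₂).fun_div (differentiableOn_ypol h₁ h₂) hy
  unfold termB
  exact (differentiableOn_polyPart ℓ k v x h₁ h₂ hy).mul
    (((hq₁.mul hq₂).const_mul _).neg.cexp)

/-- Domination of the summands of the theta kernel at `(z₁, z₂)`. -/
def BoundA {ι : Type*} (ℓ k : ℕ) (x : ι → Fin 3 → ℝ) (r : ℕ) (C : ℝ) (d : ℕ) (z₁ z₂ : ℂ) : Prop :=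
  ypol z₁ z₂ ≠ 0 ∧ ∀ i, ∀ u v : ℝ, 1 / 2 ≤ v →
    ‖termA ℓ k u v (x i) z₁ z₂‖ ≤ ((1 + ‖x i‖) ^ r)⁻¹ * (C * (1 + v) ^ d)

/-- Domination of the summands of the cuspidal integrand at `(z₁, z₂)`. -/
def BoundB {ι : Type*} (ℓ k : ℕ) (β : ι → ℂ) (x : ι → Fin 3 → ℝ) (r : ℕ) (C : ℝ) (d : ℕ) (b : ℝ)
    (z₁ z₂ : ℂ) : Prop :=
  ∀ i, ∀ v : ℝ, 1 ≤ v → ‖β i * termB ℓ k v (x i) z₁ z₂‖ ≤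
    ((1 + ‖x i‖) ^ r)⁻¹ * (C * ((1 + v) ^ d * Real.exp (-(b * v))))

section

variable {ι : Type*} {x : ι → Fin 3 → ℝ} {f : ℍ → ℂ} {c : ℤ → ℂ} {q : ℝ} {m : ι → ℤ} {r : ℕ}
  {ℓ k : ℕ} {β : ι → ℂ} {C b : ℝ} {d : ℕ} {z₁ z₂ : ℂ}

theorem BoundA.norm_kerA_le (hA : BoundA ℓ k x r C d z₁ z₂) (hC : 0 ≤ C) {M S : ℝ} {τ : ℍ} {s : ℂ}
    (hτ : τ ∈ truncFD 1) (hf : ‖f τ‖ ≤ M) (hs : ‖(thetaExp ℓ k : ℂ) - s‖ ≤ S) (i : ι) :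
    ‖kerA ℓ k f s τ (x i) z₁ z₂‖ ≤
      ((1 + ‖x i‖) ^ r)⁻¹ * (M * Real.exp (S * 2) * (C * 2 ^ d)) := by
  have hv := one_half_lt_im hτ.1
  have hv1 : τ.im ≤ 1 := hτ.2
  have hM : 0 ≤ M := (norm_nonneg _).trans hf
  rw [kerA, norm_mul, norm_mul]
  calc _ ≤ M * Real.exp (S * 2) * (((1 + ‖x i‖) ^ r)⁻¹ * (C * 2 ^ d)) := by
        gcongr
        · refine (norm_cpow_le_of_half_le hv.le _).trans (Real.exp_le_exp.2 ?_)
          gcongr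
          · exact (norm_nonneg _).trans hs
          · linarith
        · refine (hA.2 i _ _ hv.le).trans ?_
          have : 0 ≤ 1 + τ.im := by linarith
          gcongr
          linarith
    _ = _ := by ring

theorem BoundB.norm_kerB_le (hB : BoundB ℓ k β x r C d b z₁ z₂) {D : ℕ} {v : ℝ}
    {s : ℂ} (hv : 1 ≤ v) (hs : ‖(thetaExp ℓ k : ℂ) - 2 - s‖ ≤ D) (i : ι) :
    ‖kerB ℓ k (β i) s v (x i) z₁ z₂‖ ≤
      ((1 + ‖x i‖) ^ r)⁻¹ * (C * ((1 + v) ^ (D + d) * Real.exp (-(b * v)))) := by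
  rw [kerB, norm_mul]
  have hv0 : 0 ≤ 1 + v := by linarith
  calc _ ≤ (1 + v) ^ D * (((1 + ‖x i‖) ^ r)⁻¹ * (C * ((1 + v) ^ d * Real.exp (-(b * v))))) := by
        refine mul_le_mul (norm_cpow_le_of_one_le hv hs) (hB i v hv) (norm_nonneg _)
          (by positivity)
    _ = _ := by ring

theorem exists_norm_le_truncFD (hf : Continuous f) : ∃ M, ∀ τ ∈ truncFD 1, ‖f τ‖ ≤ M :=
  (isCompact_truncFD 1).exists_bound_of_continuousOn hf.continuousOn

theorem integrableOn_const_truncFD (M : ℝ) : IntegrableOn (fun _ : ℍ => M) (truncFD 1) :=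
  integrableOn_const (isCompact_truncFD 1).measure_lt_top.ne

theorem measurableSet_truncFD (T : ℝ) : MeasurableSet (truncFD T) :=
  (isCompact_truncFD T).isClosed.measurableSet

theorem BoundA.differentiable_liftA (hA : BoundA ℓ k x r C d z₁ z₂) (hC : 0 ≤ C)
    (hx : Summable fun i => ((1 + ‖x i‖) ^ r)⁻¹) (hf : Continuous f) :
    Differentiable ℂ fun s => liftA ℓ k f x s z₁ z₂ := by
  intro s₀
  obtain ⟨M, hM⟩ := exists_norm_le_truncFD hf
  refine DifferentiableOn.differentiableAt (s := Metric.ball s₀ 1) ?_ (Metric.ball_mem_nhds _ one_pos)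
  refine differentiableOn_tsum_integral Metric.isOpen_ball (fun i s _ => ?_) (fun i => ?_)
    (fun i => ?_) hx (integrableOn_const_truncFD (M * Real.exp ((‖(thetaExp ℓ k : ℂ) - s₀‖ + 1) * 2) *
      (C * 2 ^ d)))
  · exact (continuous_kerA hf ℓ k s (x i) z₁ z₂).aestronglyMeasurable
  · refine Eventually.of_forall fun τ => ?_
    have : (τ.im : ℂ) ≠ 0 := by exact_mod_cast τ.im_pos.ne'
    unfold kerA
    refine Differentiable.differentiableOn ?_
    refine Differentiable.mul_const (Differentiable.const_mul ?_ _) _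
    exact Differentiable.const_cpow (by fun_prop) (Or.inl this)
  · filter_upwards [self_mem_ae_restrict (measurableSet_truncFD 1)] with τ hτ s hs
    refine hA.norm_kerA_le hC hτ (hM τ hτ) ?_ i
    rw [Metric.mem_ball, dist_comm, dist_eq_norm] at hs
    calc _ = ‖((thetaExp ℓ k : ℂ) - s₀) + (s₀ - s)‖ := by ring_nf
      _ ≤ _ := (norm_add_le _ _).trans (by linarith)

/-- The exponential decay in v beats v^(-s) for every s, locally uniformly in s. This is why no
half-plane of convergence appears and no genuine continuation is needed. -/
theorem BoundB.differentiable_liftB (hB : BoundB ℓ k β x r C d b z₁ z₂) (hb : 0 < b)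
    (hx : Summable fun i => ((1 + ‖x i‖) ^ r)⁻¹) :
    Differentiable ℂ fun s => liftB ℓ k β x s z₁ z₂ := by
  intro s₀
  obtain ⟨D, hD⟩ := exists_nat_ge (‖(thetaExp ℓ k : ℂ) - 2 - s₀‖ + 1)
  refine DifferentiableOn.differentiableAt (s := Metric.ball s₀ 1) ?_ (Metric.ball_mem_nhds _ one_pos)
  refine differentiableOn_tsum_integral Metric.isOpen_ball (fun i s _ => ?_) (fun i => ?_)
    (fun i => ?_) hx ((integrableOn_pow_mul_exp (D + d) hb).const_mul C)
  · exact aestronglyMeasurable_kerB ℓ k (β i) s (x i) z₁ z₂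
  · filter_upwards [self_mem_ae_restrict measurableSet_Ioi] with v hv
    have : (v : ℂ) ≠ 0 := by exact_mod_cast (zero_lt_one.trans hv).ne'
    unfold kerB
    refine Differentiable.differentiableOn ?_
    refine Differentiable.mul_const ?_ _
    exact Differentiable.const_cpow (by fun_prop) (Or.inl this)
  · filter_upwards [self_mem_ae_restrict measurableSet_Ioi] with v hv s hs
    refine hB.norm_kerB_le (le_of_lt hv) ?_ i
    rw [Metric.mem_ball, dist_comm, dist_eq_norm] at hs
    calc _ = ‖((thetaExp ℓ k : ℂ) - 2 - s₀) + (s₀ - s)‖ := by ring_nf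
      _ ≤ _ := (norm_add_le _ _).trans (by linarith)

/-- The compact part is holomorphic along holomorphic curves of the polarization. -/
theorem differentiableOn_liftA_comp {U : Set ℂ} (hU : IsOpen U) {ζ₁ ζ₂ : ℂ → ℂ}
    (h₁ : DifferentiableOn ℂ ζ₁ U) (h₂ : DifferentiableOn ℂ ζ₂ U)
    (hA : ∀ w ∈ U, BoundA ℓ k x r C d (ζ₁ w) (ζ₂ w)) (hC : 0 ≤ C)
    (hx : Summable fun i => ((1 + ‖x i‖) ^ r)⁻¹) (hf : Continuous f) (s : ℂ) :
    DifferentiableOn ℂ (fun w => liftA ℓ k f x s (ζ₁ w) (ζ₂ w)) U := by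
  obtain ⟨M, hM⟩ := exists_norm_le_truncFD hf
  refine differentiableOn_tsum_integral hU (fun i w _ => ?_) (fun i => ?_)
    (fun i => ?_) hx (integrableOn_const_truncFD (M * Real.exp (‖(thetaExp ℓ k : ℂ) - s‖ * 2) *
      (C * 2 ^ d)))
  · exact (continuous_kerA hf ℓ k s (x i) _ _).aestronglyMeasurable
  · refine Eventually.of_forall fun τ => ?_
    unfold kerA
    exact (differentiableOn_termA ℓ k _ _ (x i) h₁ h₂ fun w hw => (hA w hw).1).const_mul _
  · filter_upwards [self_mem_ae_restrict (measurableSet_truncFD 1)] with τ hτ w hw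
    exact (hA w hw).norm_kerA_le hC hτ (hM τ hτ) le_rfl i

/-- The cuspidal part is holomorphic along holomorphic curves of the polarization. -/
theorem differentiableOn_liftB_comp {U : Set ℂ} (hU : IsOpen U) {ζ₁ ζ₂ : ℂ → ℂ}
    (h₁ : DifferentiableOn ℂ ζ₁ U) (h₂ : DifferentiableOn ℂ ζ₂ U)
    (hy : ∀ w ∈ U, ypol (ζ₁ w) (ζ₂ w) ≠ 0)
    (hB : ∀ w ∈ U, BoundB ℓ k β x r C d b (ζ₁ w) (ζ₂ w)) (hb : 0 < b)
    (hx : Summable fun i => ((1 + ‖x i‖) ^ r)⁻¹) (s : ℂ) :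
    DifferentiableOn ℂ (fun w => liftB ℓ k β x s (ζ₁ w) (ζ₂ w)) U := by
  obtain ⟨D, hD⟩ := exists_nat_ge ‖(thetaExp ℓ k : ℂ) - 2 - s‖
  refine differentiableOn_tsum_integral hU (fun i w _ => ?_) (fun i => ?_)
    (fun i => ?_) hx ((integrableOn_pow_mul_exp (D + d) hb).const_mul C)
  · exact aestronglyMeasurable_kerB ℓ k (β i) s (x i) _ _
  · refine Eventually.of_forall fun v => ?_
    unfold kerB
    exact ((differentiableOn_termB ℓ k v (x i) h₁ h₂ hy).const_mul _).const_mul _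
  · filter_upwards [self_mem_ae_restrict measurableSet_Ioi] with v hv w hw
    exact (hB w hw).norm_kerB_le (le_of_lt hv) hD i

/-- The bound depends only on the domination constants and not on (z₁, z₂); it supplies the
boundedness on a bidisc needed for the double power series. -/
theorem exists_norm_liftA_le (hC : 0 ≤ C)
    (hx : Summable fun i => ((1 + ‖x i‖) ^ r)⁻¹) (hf : Continuous f) (s : ℂ) :
    ∃ M, ∀ z₁ z₂, BoundA ℓ k x r C d z₁ z₂ → ‖liftA ℓ k f x s z₁ z₂‖ ≤ M := by
  obtain ⟨M, hM⟩ := exists_norm_le_truncFD hf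
  refine ⟨_, fun z₁ z₂ hA => norm_tsum_integral_le (fun i => ?_) hx (integrableOn_const_truncFD
    (M * Real.exp (‖(thetaExp ℓ k : ℂ) - s‖ * 2) * (C * 2 ^ d)))⟩
  filter_upwards [self_mem_ae_restrict (measurableSet_truncFD 1)] with τ hτ
  exact hA.norm_kerA_le hC hτ (hM τ hτ) le_rfl i

theorem exists_norm_liftB_le (hb : 0 < b)
    (hx : Summable fun i => ((1 + ‖x i‖) ^ r)⁻¹) (s : ℂ) :
    ∃ M, ∀ z₁ z₂, BoundB ℓ k β x r C d b z₁ z₂ → ‖liftB ℓ k β x s z₁ z₂‖ ≤ M := by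
  obtain ⟨D, hD⟩ := exists_nat_ge ‖(thetaExp ℓ k : ℂ) - 2 - s‖
  refine ⟨_, fun z₁ z₂ hB => norm_tsum_integral_le (fun i => ?_) hx
    ((integrableOn_pow_mul_exp (D + d) hb).const_mul C)⟩
  filter_upwards [self_mem_ae_restrict measurableSet_Ioi] with v hv
  exact hB.norm_kerB_le (le_of_lt hv) hD i

end

/-! ### The regularized integral of one component -/

/-- One component of the pairing of a modular form with the theta kernel. -/
noncomputable def familyIntegrand {ι : Type*} (ℓ k : ℕ) (f : ℍ → ℂ) (x : ι → Fin 3 → ℝ) (z : ℂ)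
    (τ : ℍ) : ℂ :=
  f τ * (((τ.im ^ ((k : ℝ) + 1 - (ℓ : ℝ) / 2) * z.im ^ (-(2 * k : ℤ)) : ℝ) : ℂ) *
    ∑' i, thetaTerm ℓ k τ z (vecMat (x i)))

theorem familyIntegrand_mul_cpow {ι : Type*} (ℓ k : ℕ) (f : ℍ → ℂ) (x : ι → Fin 3 → ℝ) {z : ℂ}
    (hz : z.im ≠ 0) (s : ℂ) (τ : ℍ) :
    familyIntegrand ℓ k f x z τ * (τ.im : ℂ) ^ (-s) =
      (z.im : ℂ) ^ (-(2 * k : ℤ)) * ∑' i, kerA ℓ k f s τ (x i) z (starRingEnd ℂ z) := by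
  have hτ : (τ.im : ℂ) ≠ 0 := by exact_mod_cast τ.im_pos.ne'
  have hpow : ((τ.im ^ ((k : ℝ) + 1 - (ℓ : ℝ) / 2) : ℝ) : ℂ) = (τ.im : ℂ) ^ (thetaExp ℓ k : ℂ) := by
    rw [Complex.ofReal_cpow τ.im_pos.le]
    rfl
  simp only [kerA, thetaTerm_vecMat ℓ k τ hz, familyIntegrand, tsum_mul_left]
  rw [Complex.ofReal_mul, hpow, sub_eq_add_neg, Complex.cpow_add _ _ hτ, Complex.ofReal_zpow]
  ring

section

variable {ι : Type*} {x : ι → Fin 3 → ℝ} {f : ℍ → ℂ} {c : ℤ → ℂ} {q : ℝ} {m : ι → ℤ} {r : ℕ}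
  {ℓ k : ℕ} {C b : ℝ} {d : ℕ}

theorem BoundA.continuousOn_tsum_kerA {z₁ z₂ : ℂ} (hA : BoundA ℓ k x r C d z₁ z₂)
    (hC : 0 ≤ C) (hx : Summable fun i => ((1 + ‖x i‖) ^ r)⁻¹) (hf : Continuous f) (s : ℂ) :
    ContinuousOn (fun τ : ℍ => ∑' i, kerA ℓ k f s τ (x i) z₁ z₂) {τ : ℍ | 1 / 2 < τ.im} := by
  have heq : (fun τ : ℍ => ∑' i, kerA ℓ k f s τ (x i) z₁ z₂) = fun τ : ℍ =>
      f τ * (τ.im : ℂ) ^ ((thetaExp ℓ k : ℂ) - s) * ∑' i, termA ℓ k τ.re τ.im (x i) z₁ z₂ := by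
    funext τ
    simp only [kerA, tsum_mul_left]
  rw [heq]
  refine (hf.mul (continuous_im_cpow _)).continuousOn.mul ?_
  intro τ₀ hτ₀
  refine ContinuousAt.continuousWithinAt ?_
  have hopen : IsOpen {τ : ℍ | 1 / 2 < τ.im ∧ τ.im < τ₀.im + 1} :=
    (isOpen_lt continuous_const UpperHalfPlane.continuous_im).inter
      (isOpen_lt UpperHalfPlane.continuous_im continuous_const)
  refine ContinuousOn.continuousAt (s := {τ : ℍ | 1 / 2 < τ.im ∧ τ.im < τ₀.im + 1}) ?_
    (hopen.mem_nhds ⟨hτ₀, lt_add_one _⟩)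
  refine continuousOn_tsum (u := fun i => ((1 + ‖x i‖) ^ r)⁻¹ * (C * (1 + (τ₀.im + 1)) ^ d))
    (fun i => ?_) (hx.mul_right _) fun i τ hτ => ?_
  · exact (continuous_termA ℓ k UpperHalfPlane.continuous_re UpperHalfPlane.continuous_im
      (x i) z₁ z₂).continuousOn
  · refine (hA.2 i τ.re τ.im hτ.1.le).trans ?_
    have h1 := τ.im_pos
    have h2 := hτ.2
    gcongr

namespace IsFourierFamily

theorem continuousOn_familyIntegrand_mul (h : IsFourierFamily x f c q m r) {z : ℂ} (hz : z.im ≠ 0)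
    (hA : BoundA ℓ k x r C d z (starRingEnd ℂ z)) (hC : 0 ≤ C) (s : ℂ) :
    ContinuousOn (fun τ : ℍ => familyIntegrand ℓ k f x z τ * (τ.im : ℂ) ^ (-s))
      {τ : ℍ | 1 / 2 < τ.im} := by
  simp only [familyIntegrand_mul_cpow ℓ k f x hz]
  exact continuousOn_const.mul (hA.continuousOn_tsum_kerA hC h.summ h.cont s)

theorem integrableOn_familyIntegrand (h : IsFourierFamily x f c q m r) {z : ℂ} (hz : z.im ≠ 0)
    (hA : BoundA ℓ k x r C d z (starRingEnd ℂ z)) (hC : 0 ≤ C) (s : ℂ) (T : ℝ) :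
    IntegrableOn (fun τ : ℍ => familyIntegrand ℓ k f x z τ * (τ.im : ℂ) ^ (-s)) (truncFD T) :=
  ((h.continuousOn_familyIntegrand_mul hz hA hC s).mono
    fun _ hτ => one_half_lt_im hτ.1).integrableOn_compact (isCompact_truncFD T)

/-- On a horizontal segment the sum over λ converges uniformly, so it may be exchanged with the
integral; each λ then keeps exactly one Fourier coefficient of f. -/
theorem integral_horizontal (h : IsFourierFamily x f c q m r) {z₁ z₂ : ℂ}
    (hA : BoundA ℓ k x r C d z₁ z₂) (s : ℂ) {v : ℝ} (hv : 1 ≤ v) :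
    ((v ^ 2 : ℝ) : ℂ)⁻¹ * ∫ u in Set.Icc (-1 / 2 : ℝ) (1 / 2), ∑' i,
      kerA ℓ k f s (UpperHalfPlane.ofComplex (u + v * Complex.I)) (x i) z₁ z₂ =
    ∑' i, kerB ℓ k (c (m i)) s v (x i) z₁ z₂ := by
  have hv0 : 0 < v := by linarith
  have hvc : (v : ℂ) ≠ 0 := by exact_mod_cast hv0.ne'
  have hcount := h.countable
  have hker : ∀ (u : ℝ) (i : ι),
      kerA ℓ k f s (UpperHalfPlane.ofComplex (u + v * Complex.I)) (x i) z₁ z₂ =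
      (v : ℂ) ^ ((thetaExp ℓ k : ℂ) - s) *
        (f (UpperHalfPlane.ofComplex (u + v * Complex.I)) * termA ℓ k u v (x i) z₁ z₂) := by
    intro u i
    rw [kerA, im_ofComplex hv0, re_ofComplex hv0]
    ring
  have htsum : ∀ u : ℝ, ∑' i,
      kerA ℓ k f s (UpperHalfPlane.ofComplex (u + v * Complex.I)) (x i) z₁ z₂ =
      (v : ℂ) ^ ((thetaExp ℓ k : ℂ) - s) * ∑' i,
        f (UpperHalfPlane.ofComplex (u + v * Complex.I)) * termA ℓ k u v (x i) z₁ z₂ := by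
    intro u
    simp only [hker]
    exact tsum_mul_left
  have hfc := h.continuous_horizontal hv0
  have hswap : ∫ u in Set.Icc (-1 / 2 : ℝ) (1 / 2), ∑' i,
      f (UpperHalfPlane.ofComplex (u + v * Complex.I)) * termA ℓ k u v (x i) z₁ z₂ =
      ∑' i, c (m i) * termB ℓ k v (x i) z₁ z₂ := by
    refine (integral_tsum_of_dominated (F := fun (i : ι) (u : ℝ) =>
      f (UpperHalfPlane.ofComplex (u + v * Complex.I)) * termA ℓ k u v (x i) z₁ z₂)
      (g := fun u => ‖f (UpperHalfPlane.ofComplex (u + v * Complex.I))‖ * (C * (1 + v) ^ d))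
      (fun i => ?_) (fun i => ?_) h.summ ?_).trans
      (tsum_congr fun i => h.integral_mul_termA ℓ k hv0 i hA.1)
    · exact (hfc.mul (continuous_termA ℓ k continuous_id continuous_const (x i) z₁ z₂)
        ).aestronglyMeasurable
    · refine Eventually.of_forall fun u => ?_
      rw [norm_mul]
      calc _ ≤ ‖f (UpperHalfPlane.ofComplex (u + v * Complex.I))‖ *
            (((1 + ‖x i‖) ^ r)⁻¹ * (C * (1 + v) ^ d)) :=
            mul_le_mul_of_nonneg_left (hA.2 i u v (by linarith)) (norm_nonneg _)
        _ = _ := by ring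
    · exact (hfc.norm.mul continuous_const).continuousOn.integrableOn_compact isCompact_Icc
  simp only [htsum]
  rw [integral_const_mul, hswap]
  simp only [kerB]
  rw [tsum_mul_left, ← mul_assoc]
  congr 1
  -- The shift by 2 in the exponent of `kerB` is the density v⁻² of the hyperbolic measure.
  rw [show (thetaExp ℓ k : ℂ) - 2 - s = ((thetaExp ℓ k : ℂ) - s) - 2 by ring,
    Complex.cpow_sub ((thetaExp ℓ k : ℂ) - s) 2 hvc, Complex.cpow_ofNat]
  push_cast
  rw [div_eq_inv_mul]

theorem integral_truncFD_familyIntegrand (h : IsFourierFamily x f c q m r) {z : ℂ}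
    (hz : z.im ≠ 0) (hA : BoundA ℓ k x r C d z (starRingEnd ℂ z)) (hC : 0 ≤ C) (s : ℂ) {T : ℝ}
    (hT : 1 ≤ T) :
    ∫ τ in truncFD T, familyIntegrand ℓ k f x z τ * (τ.im : ℂ) ^ (-s) =
      (z.im : ℂ) ^ (-(2 * k : ℤ)) * (liftA ℓ k f x s z (starRingEnd ℂ z) +
        ∫ v in Set.Ioc 1 T, ∑' i, kerB ℓ k (c (m i)) s v (x i) z (starRingEnd ℂ z)) := by
  have hcount := h.countable
  obtain ⟨M, hM⟩ := exists_norm_le_truncFD h.cont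
  have hswap : ∫ τ in truncFD 1, ∑' i, kerA ℓ k f s τ (x i) z (starRingEnd ℂ z) =
      liftA ℓ k f x s z (starRingEnd ℂ z) := by
    refine integral_tsum_of_dominated (fun i => ?_) (fun i => ?_) h.summ
      (integrableOn_const_truncFD (M * Real.exp (‖(thetaExp ℓ k : ℂ) - s‖ * 2) * (C * 2 ^ d)))
    · exact (continuous_kerA h.cont ℓ k s (x i) _ _).aestronglyMeasurable
    · filter_upwards [self_mem_ae_restrict (measurableSet_truncFD 1)] with τ hτ
      exact hA.norm_kerA_le hC hτ (hM τ hτ) le_rfl i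
  simp only [familyIntegrand_mul_cpow ℓ k f x hz]
  rw [integral_const_mul, integral_truncFD (hA.continuousOn_tsum_kerA hC h.summ h.cont s) hT, hswap]
  congr 2
  exact setIntegral_congr_fun measurableSet_Ioc fun v hv => h.integral_horizontal hA s hv.1.le

/-- After integration over u the cuspidal integrand is absolutely integrable on (1, ∞), so the limit
T → ∞ exists for every s and may be taken inside the sum over λ. -/
theorem tendsto_integral_truncFD (h : IsFourierFamily x f c q m r) {z : ℂ}
    (hz : z.im ≠ 0) {C' : ℝ} {d' : ℕ} (hA : BoundA ℓ k x r C d z (starRingEnd ℂ z)) (hC : 0 ≤ C)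
    (hB : BoundB ℓ k (fun i => c (m i)) x r C' d' b z (starRingEnd ℂ z)) (hb : 0 < b) (s : ℂ) :
    Tendsto (fun T : ℝ => ∫ τ in truncFD T, familyIntegrand ℓ k f x z τ * (τ.im : ℂ) ^ (-s)) atTop
      (𝓝 ((z.im : ℂ) ^ (-(2 * k : ℤ)) * (liftA ℓ k f x s z (starRingEnd ℂ z) +
        liftB ℓ k (fun i => c (m i)) x s z (starRingEnd ℂ z)))) := by
  have hcount := h.countable
  obtain ⟨D, hD⟩ := exists_nat_ge ‖(thetaExp ℓ k : ℂ) - 2 - s‖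
  set z' := starRingEnd ℂ z with hz'
  have hbound : ∀ v : ℝ, 1 ≤ v → ∀ i, ‖kerB ℓ k (c (m i)) s v (x i) z z'‖ ≤ ((1 + ‖x i‖) ^ r)⁻¹ *
      (C' * ((1 + v) ^ (D + d') * Real.exp (-(b * v)))) :=
    fun v hv i => hB.norm_kerB_le hv hD i
  have hg := (integrableOn_pow_mul_exp (D + d') hb).const_mul C'
  have hswap : ∫ v in Set.Ioi 1, ∑' i, kerB ℓ k (c (m i)) s v (x i) z z' =
      liftB ℓ k (fun i => c (m i)) x s z z' := by
    refine integral_tsum_of_dominated (fun i => aestronglyMeasurable_kerB ℓ k _ s (x i) _ _)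
      (fun i => ?_) h.summ hg
    filter_upwards [self_mem_ae_restrict measurableSet_Ioi] with v hv
    exact hbound v (le_of_lt hv) i
  have hmeas : AEStronglyMeasurable (fun v => ∑' i, kerB ℓ k (c (m i)) s v (x i) z z')
      (volume.restrict (Set.Ioi (1 : ℝ))) := by
    have heq : (fun v : ℝ => ∑' i, kerB ℓ k (c (m i)) s v (x i) z z') = fun v : ℝ =>
        (v : ℂ) ^ ((thetaExp ℓ k : ℂ) - 2 - s) * ∑' i, c (m i) * termB ℓ k v (x i) z z' := by
      funext v
      simp only [kerB, tsum_mul_left]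
    refine ContinuousOn.aestronglyMeasurable ?_ measurableSet_Ioi
    rw [heq]
    refine ((continuousOn_ofReal_cpow _).mono (Set.Ioi_subset_Ioi zero_le_one)).mul ?_
    intro v₀ hv₀
    refine ContinuousAt.continuousWithinAt ?_
    refine ContinuousOn.continuousAt (s := Set.Ioo 1 (v₀ + 1)) ?_
      (Ioo_mem_nhds hv₀ (lt_add_one _))
    refine continuousOn_tsum (u := fun i => ((1 + ‖x i‖) ^ r)⁻¹ * (|C'| * ((1 + (v₀ + 1)) ^ d' * 1)))
      (fun i => ?_) (h.summ.mul_right _) fun i v hv => ?_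
    · exact (continuous_const.mul (continuous_termB ℓ k (x i) _ _)).continuousOn
    · refine (hB i v hv.1.le).trans ?_
      have h1 := hv.1
      have h2 := hv.2
      have : 0 ≤ 1 + v := by linarith
      refine mul_le_mul_of_nonneg_left ?_ (by positivity)
      refine mul_le_mul (le_abs_self _) ?_ (by positivity) (abs_nonneg _)
      have hbv : 0 < b * v := mul_pos hb (by linarith)
      exact mul_le_mul (pow_le_pow_left₀ this (by linarith) _)
        (Real.exp_le_one_iff.2 (by linarith)) (Real.exp_pos _).le (pow_nonneg (by linarith) _)
  have hint : IntegrableOn (fun v => ∑' i, kerB ℓ k (c (m i)) s v (x i) z z') (Set.Ioi 1) := by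
    refine Integrable.mono' (hg.const_mul (∑' i, ((1 + ‖x i‖) ^ r)⁻¹)) hmeas ?_
    filter_upwards [self_mem_ae_restrict measurableSet_Ioi] with v hv
    rw [← tsum_mul_right]
    exact tsum_of_norm_bounded (h.summ.mul_right _).hasSum (hbound v (le_of_lt hv))
  have hlim := intervalIntegral_tendsto_integral_Ioi 1 hint tendsto_id
  rw [hswap] at hlim
  refine ((hlim.const_add (liftA ℓ k f x s z z')).const_mul
    ((z.im : ℂ) ^ (-(2 * k : ℤ)))).congr' ?_
  filter_upwards [eventually_ge_atTop 1] with T hT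
  rw [h.integral_truncFD_familyIntegrand hz hA hC s hT, id,
    intervalIntegral.integral_of_le hT]

/-- At every point the regularized integral converges for all `s` to an entire function. -/
theorem exists_bounds_at (h : IsFourierFamily x f c q m r) (ℓ : ℕ) {k : ℕ} (hk : 1 ≤ k) {z : ℂ}
    (hz : z.im ≠ 0) : (∃ C ≥ 0, ∃ d, BoundA ℓ k x r C d z (starRingEnd ℂ z)) ∧
      ∃ C ≥ 0, ∃ d, ∃ b > 0, BoundB ℓ k (fun i => c (m i)) x r C d b z (starRingEnd ℂ z) := by
  obtain ⟨δ, hδ, hδi⟩ := h.exists_qf_lower hz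
  obtain ⟨ε, hε, ⟨C, hC, d, hA⟩, C', hC', d', b, hb, hB⟩ := h.exists_bounds ℓ k hz hδ
  have hm1 : z ∈ Metric.ball z ε := Metric.mem_ball_self hε
  have hm2 : starRingEnd ℂ z ∈ Metric.ball (starRingEnd ℂ z) ε := Metric.mem_ball_self hε
  refine ⟨⟨C, hC, d, hA _ hm1 _ hm2⟩, C', hC', d', b, hb, fun i v hv => ?_⟩
  have hnn : 0 ≤ ((1 + ‖x i‖) ^ r)⁻¹ * (C' * ((1 + v) ^ d' * Real.exp (-(b * v)))) := by
    have : 0 ≤ 1 + v := by linarith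
    positivity
  -- Either f has no coefficient at m, or λ_z = 0 and the factor (λ, Z(z̄))^k with k ≥ 1 kills the
  -- term, or `qf` is bounded below and the integrand decays exponentially.
  rcases hδi i with h0 | h0 | h0
  · simpa only [h0, zero_mul, norm_zero] using hnn
  · have : termB ℓ k v (x i) z (starRingEnd ℂ z) = 0 := by
      rw [termB, polyPart, qf_conj, h0, map_zero, mul_zero, zero_pow (by omega), mul_zero, zero_mul]
    simpa only [this, mul_zero, norm_zero] using hnn
  · exact hB _ hm1 _ hm2 i h0 v hv

end IsFourierFamily

end

/-! ### The local coordinate and the regular part of the expansion -/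

/-- The inverse of the local coordinate `w = (z - z₀) / (z - z̄₀)`. -/
noncomputable def localPoint (z₀ w : ℂ) : ℂ := (z₀ - w * starRingEnd ℂ z₀) / (1 - w)

theorem localPoint_zero (z₀ : ℂ) : localPoint z₀ 0 = z₀ := by simp [localPoint]

theorem conj_localPoint (z₀ w : ℂ) :
    starRingEnd ℂ (localPoint z₀ w) = localPoint (starRingEnd ℂ z₀) (starRingEnd ℂ w) := by
  simp [localPoint]

theorem differentiableOn_localPoint (z₀ : ℂ) {R : ℝ} (hR : R ≤ 1) :
    DifferentiableOn ℂ (localPoint z₀) (Metric.ball 0 R) := by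
  unfold localPoint
  refine DifferentiableOn.div (by fun_prop) (by fun_prop) fun w hw h0 => ?_
  rw [mem_ball_zero_iff] at hw
  have : w = 1 := (sub_eq_zero.1 h0).symm
  rw [this, norm_one] at hw
  linarith

/-- The value of the regularized integral of one component at `z`. -/
noncomputable def familyLift {ι : Type*} (ℓ k : ℕ) (f : ℍ → ℂ) (β : ι → ℂ) (x : ι → Fin 3 → ℝ)
    (z : ℂ) : ℂ :=
  (z.im : ℂ) ^ (-(2 * k : ℤ)) * (liftA ℓ k f x 0 z (starRingEnd ℂ z) +
    liftB ℓ k β x 0 z (starRingEnd ℂ z))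

/-- The factor `qf`^k vanishes because k ≥ 1. Both convergence at singular points and the constant
term formula depend on this. -/
theorem termB_eq_zero {ℓ k : ℕ} (hk : 1 ≤ k) {v : ℝ} {x : Fin 3 → ℝ} {z₁ z₂ : ℂ}
    (h : qf x z₂ = 0) : termB ℓ k v x z₁ z₂ = 0 := by
  rw [termB, polyPart, h, mul_zero, zero_pow (by omega), mul_zero, zero_mul]

namespace IsFourierFamily

variable {ι : Type*} {x : ι → Fin 3 → ℝ} {f : ℍ → ℂ} {c : ℤ → ℂ} {q : ℝ} {m : ι → ℤ} {r : ℕ}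

/-- If λ_z = 0 then |`pf`|² = 4Q(λ) ≤ 4(q - N), which bounds λ, since it lies on the positive line.
-/
theorem finite_singular (h : IsFourierFamily x f c q m r) {z : ℂ} (hz : z.im ≠ 0) :
    {i | c (m i) ≠ 0 ∧ qf (x i) z = 0}.Finite := by
  obtain ⟨N, hN⟩ := h.bdd
  obtain ⟨K, hK, hKx⟩ := exists_norm_le_pf_qf hz
  have hyc : ypol z (starRingEnd ℂ z) = z.im := ypol_conj z
  have hy0 : ypol z (starRingEnd ℂ z) ≠ 0 := by rw [hyc]; exact_mod_cast hz
  refine (h.finite_norm_le (K * Real.sqrt (4 * (q - N)))).subset fun i hi => ?_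
  obtain ⟨hc, hq⟩ := hi
  have hmN : (N : ℝ) ≤ m i := by
    by_contra hlt
    exact hc (hN _ (by exact_mod_cast not_le.1 hlt))
  have hid := pf_sq_sub (x i) hy0
  rw [hq, zero_div, zero_mul, ← pair_Zperp] at hid
  have hid' : (pair (vecMat (x i)) (Zperp z)) ^ 2 - 4 * detV (x i) = 0 := by exact_mod_cast hid
  have hP : ‖pf (x i) z (starRingEnd ℂ z)‖ ≤ Real.sqrt (4 * (q - N)) := by
    apply Real.le_sqrt_of_sq_le
    rw [← pair_Zperp, Complex.norm_real, Real.norm_eq_abs, sq_abs]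
    have := h.det i
    linarith
  have h1 := hKx (x i)
  rw [hq, zero_div, norm_zero, add_zero] at h1
  exact h1.trans (by gcongr)

/-- Up to finitely many singular terms, one component of the lift has a double power series
expansion in the local coordinate. -/
theorem exists_regular_expansion (h : IsFourierFamily x f c q m r) (ℓ : ℕ) {k : ℕ} (hk : 1 ≤ k)
    {z₀ : ℂ} (hz₀ : z₀.im ≠ 0) :
    ∃ J : Finset ι, (∀ i ∈ J, qf (x i) z₀ = 0) ∧ ∃ R > 0, ∃ a : ℕ × ℕ → ℂ,
      a (0, 0) = familyLift ℓ k f (fun i => c (m i)) x z₀ ∧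
      ∀ w : ℂ, ‖w‖ < R → (localPoint z₀ w).im ≠ 0 ∧
        HasSum (fun p : ℕ × ℕ => a p * (w ^ p.1 * starRingEnd ℂ w ^ p.2))
          ((1 - w) ^ (-(2 * k : ℤ)) * familyLift ℓ k f (fun i => c (m i)) x (localPoint z₀ w) -
            ∑ i ∈ J, (1 - w) ^ (-(2 * k : ℤ)) * ((localPoint z₀ w).im : ℂ) ^ (-(2 * k : ℤ)) *
              ∫ v in Set.Ioi (1 : ℝ), kerB ℓ k (c (m i)) 0 v (x i) (localPoint z₀ w)
                (starRingEnd ℂ (localPoint z₀ w))) := by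
  classical
  set z₀' := starRingEnd ℂ z₀ with hz₀'
  obtain ⟨δ, hδ, hδi⟩ := h.exists_qf_lower hz₀
  obtain ⟨ε, hε, ⟨C, hC, d, hA⟩, C', hC', d', b, hb, hB⟩ := h.exists_bounds ℓ k hz₀ hδ
  -- The coefficients of vectors with λ_{z₀} = 0 are discarded; all vectors that remain with nonzero
  -- coefficient satisfy the uniform lower bound, so the cuspidal sum is bounded on a full
  -- neighbourhood of (z₀, z̄₀).
  let β₀ : ι → ℂ := fun i => if qf (x i) z₀ = 0 then 0 else c (m i)
  have hB₀ : ∀ z₁ ∈ Metric.ball z₀ ε, ∀ z₂ ∈ Metric.ball z₀' ε,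
      BoundB ℓ k β₀ x r C' d' b z₁ z₂ := by
    intro z₁ hz₁ z₂ hz₂ i v hv
    have hnn : 0 ≤ ((1 + ‖x i‖) ^ r)⁻¹ * (C' * ((1 + v) ^ d' * Real.exp (-(b * v)))) := by
      have : 0 ≤ 1 + v := by linarith
      positivity
    by_cases hq : qf (x i) z₀ = 0
    · simpa only [β₀, if_pos hq, zero_mul, norm_zero] using hnn
    · simp only [β₀, if_neg hq]
      rcases hδi i with h0 | h0 | h0
      · simpa only [h0, zero_mul, norm_zero] using hnn
      · exact absurd h0 hq
      · exact hB _ hz₁ _ hz₂ i h0 v hv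
  let J := (h.finite_singular hz₀).toFinset
  have hJ : ∀ i, i ∈ J ↔ c (m i) ≠ 0 ∧ qf (x i) z₀ = 0 := fun i => by simp [J]
  -- the decomposition of the cuspidal part
  have hsplit : ∀ z₁ ∈ Metric.ball z₀ ε, ∀ z₂ ∈ Metric.ball z₀' ε,
      liftB ℓ k (fun i => c (m i)) x 0 z₁ z₂ = liftB ℓ k β₀ x 0 z₁ z₂ +
        ∑ i ∈ J, ∫ v in Set.Ioi (1 : ℝ), kerB ℓ k (c (m i)) 0 v (x i) z₁ z₂ := by
    intro z₁ hz₁ z₂ hz₂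
    obtain ⟨D, hD⟩ := exists_nat_ge ‖(thetaExp ℓ k : ℂ) - 2 - 0‖
    have hg := (integrableOn_pow_mul_exp (D + d') hb).const_mul C'
    have hs : Summable fun i => ∫ v in Set.Ioi (1 : ℝ), kerB ℓ k (β₀ i) 0 v (x i) z₁ z₂ := by
      refine Summable.of_norm_bounded (h.summ.mul_right
        (∫ v in Set.Ioi (1 : ℝ), C' * ((1 + v) ^ (D + d') * Real.exp (-(b * v))))) fun i => ?_
      rw [← integral_const_mul]
      refine norm_integral_le_of_norm_le (hg.const_mul _) ?_
      filter_upwards [self_mem_ae_restrict measurableSet_Ioi] with v hv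
      exact (hB₀ z₁ hz₁ z₂ hz₂).norm_kerB_le (le_of_lt hv) hD i
    have hfin : HasSum (fun i => if qf (x i) z₀ = 0 then
        ∫ v in Set.Ioi (1 : ℝ), kerB ℓ k (c (m i)) 0 v (x i) z₁ z₂ else 0)
        (∑ i ∈ J, if qf (x i) z₀ = 0 then
          ∫ v in Set.Ioi (1 : ℝ), kerB ℓ k (c (m i)) 0 v (x i) z₁ z₂ else 0) := by
      refine hasSum_sum_of_ne_finset_zero fun i hi => ?_
      rw [hJ, not_and_or, not_not] at hi
      split_ifs with hq
      · rcases hi with h0 | h0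
        · simp [kerB, h0]
        · exact absurd hq h0
      · rfl
    have hJsum : (∑ i ∈ J, if qf (x i) z₀ = 0 then
          ∫ v in Set.Ioi (1 : ℝ), kerB ℓ k (c (m i)) 0 v (x i) z₁ z₂ else 0) =
        ∑ i ∈ J, ∫ v in Set.Ioi (1 : ℝ), kerB ℓ k (c (m i)) 0 v (x i) z₁ z₂ :=
      Finset.sum_congr rfl fun i hi => if_pos ((hJ i).1 hi).2
    rw [← hJsum, liftB, liftB]
    refine HasSum.tsum_eq ((hs.hasSum.add hfin).congr_fun fun i => ?_)
    by_cases hq : qf (x i) z₀ = 0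
    · simp [β₀, hq, kerB]
    · simp [β₀, hq]
  -- the polarized regular part
  let N : ℂ → ℂ → ℂ := fun w₁ w₂ => (1 - w₁) ^ (-(2 * k : ℤ)) *
    (ypol (localPoint z₀ w₁) (localPoint z₀' w₂) ^ (-(2 * k : ℤ)) *
    (liftA ℓ k f x 0 (localPoint z₀ w₁) (localPoint z₀' w₂) +
      liftB ℓ k β₀ x 0 (localPoint z₀ w₁) (localPoint z₀' w₂)))
  have hcont : ∀ z : ℂ, ContinuousAt (localPoint z) 0 := fun z =>
    ((differentiableOn_localPoint z le_rfl).differentiableAt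
      (Metric.ball_mem_nhds 0 one_pos)).continuousAt
  have hy0 : ypol z₀ z₀' ≠ 0 := by rw [hz₀', ypol_conj]; exact_mod_cast hz₀
  set Y := ‖ypol z₀ z₀' ^ (-(2 * k : ℤ))‖ with hY
  have hev : ∀ᶠ w in 𝓝 (0 : ℂ × ℂ), localPoint z₀ w.1 ∈ Metric.ball z₀ ε ∧
      localPoint z₀' w.2 ∈ Metric.ball z₀' ε ∧
      ‖(1 - w.1) ^ (-(2 * k : ℤ))‖ < 2 ∧
      ‖ypol (localPoint z₀ w.1) (localPoint z₀' w.2) ^ (-(2 * k : ℤ))‖ < Y + 1 := by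
    have h1 : ContinuousAt (fun w : ℂ × ℂ => localPoint z₀ w.1) 0 :=
      ContinuousAt.comp (f := Prod.fst) (x := (0 : ℂ × ℂ)) (hcont z₀) continuousAt_fst
    have h2 : ContinuousAt (fun w : ℂ × ℂ => localPoint z₀' w.2) 0 :=
      ContinuousAt.comp (f := Prod.snd) (x := (0 : ℂ × ℂ)) (hcont z₀') continuousAt_snd
    have h3 : ContinuousAt (fun w : ℂ × ℂ => ‖(1 - w.1) ^ (-(2 * k : ℤ))‖) 0 := by
      refine ContinuousAt.norm (ContinuousAt.zpow₀ (by fun_prop) _ (Or.inl ?_))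
      simp
    have h4 : ContinuousAt (fun w : ℂ × ℂ =>
        ‖ypol (localPoint z₀ w.1) (localPoint z₀' w.2) ^ (-(2 * k : ℤ))‖) 0 := by
      refine ContinuousAt.norm (ContinuousAt.zpow₀ ?_ _ (Or.inl ?_))
      · unfold ypol
        exact (h1.sub h2).div_const _
      · simpa [localPoint_zero] using hy0
    refine (h1.eventually_mem ?_).and ((h2.eventually_mem ?_).and
      ((h3.eventually_lt continuousAt_const ?_).and (h4.eventually_lt continuousAt_const ?_)))
    · simpa [localPoint_zero] using Metric.ball_mem_nhds z₀ hε
    · simpa [localPoint_zero] using Metric.ball_mem_nhds z₀' hε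
    · simp
    · simp only [Prod.fst_zero, Prod.snd_zero, localPoint_zero, ← hY]
      exact lt_add_one _
  obtain ⟨R₀, hR₀, hball⟩ := Metric.eventually_nhds_iff_ball.1 hev
  let R := min R₀ 1
  have hR : 0 < R := lt_min hR₀ one_pos
  have hR1 : R ≤ 1 := min_le_right _ _
  have hreg : ∀ w₁ ∈ Metric.ball (0 : ℂ) R, ∀ w₂ ∈ Metric.ball (0 : ℂ) R,
      localPoint z₀ w₁ ∈ Metric.ball z₀ ε ∧ localPoint z₀' w₂ ∈ Metric.ball z₀' ε ∧
      ‖(1 - w₁) ^ (-(2 * k : ℤ))‖ < 2 ∧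
      ‖ypol (localPoint z₀ w₁) (localPoint z₀' w₂) ^ (-(2 * k : ℤ))‖ < Y + 1 := by
    intro w₁ hw₁ w₂ hw₂
    refine hball (w₁, w₂) ?_
    rw [← Prod.mk_zero_zero, ← ball_prod_same]
    exact ⟨Metric.ball_subset_ball (min_le_left _ _) hw₁,
      Metric.ball_subset_ball (min_le_left _ _) hw₂⟩
  have hAr : ∀ w₁ ∈ Metric.ball (0 : ℂ) R, ∀ w₂ ∈ Metric.ball (0 : ℂ) R,
      BoundA ℓ k x r C d (localPoint z₀ w₁) (localPoint z₀' w₂) := fun w₁ hw₁ w₂ hw₂ =>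
    hA _ (hreg w₁ hw₁ w₂ hw₂).1 _ (hreg w₁ hw₁ w₂ hw₂).2.1
  have hBr : ∀ w₁ ∈ Metric.ball (0 : ℂ) R, ∀ w₂ ∈ Metric.ball (0 : ℂ) R,
      BoundB ℓ k β₀ x r C' d' b (localPoint z₀ w₁) (localPoint z₀' w₂) := fun w₁ hw₁ w₂ hw₂ =>
    hB₀ _ (hreg w₁ hw₁ w₂ hw₂).1 _ (hreg w₁ hw₁ w₂ hw₂).2.1
  have hne1 : ∀ w ∈ Metric.ball (0 : ℂ) R, 1 - w ≠ 0 := by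
    intro w hw h0
    rw [mem_ball_zero_iff, ← sub_eq_zero.1 h0, norm_one] at hw
    linarith
  obtain ⟨MA, hMA⟩ := exists_norm_liftA_le (ℓ := ℓ) (k := k) (x := x) (f := f) (d := d) hC h.summ
    h.cont 0
  obtain ⟨MB, hMB⟩ := exists_norm_liftB_le (ℓ := ℓ) (k := k) (x := x) (β := β₀) (C := C') (d := d')
    hb h.summ 0
  have hd₁ := differentiableOn_localPoint z₀ hR1
  have hd₂ := differentiableOn_localPoint z₀' hR1
  -- The expansion is made in independent variables w₁, w₂ and specialized to w₂ = w̄₁ afterwards.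
  -- This is consistent because conjugation carries the local coordinate at z₀ to that at z̄₀, and
  -- `ypol` to y.
  obtain ⟨a, ha0, ha⟩ := exists_hasSum_of_separately_differentiable (F := N) (R := R)
    (M := 2 * ((Y + 1) * (MA + MB))) hR (fun w₂ hw₂ => by
      have hc := differentiableOn_const (𝕜 := ℂ) (s := Metric.ball (0 : ℂ) R) (localPoint z₀' w₂)
      have hA1 := differentiableOn_liftA_comp Metric.isOpen_ball hd₁ hc
        (fun w hw => hAr w hw w₂ hw₂) hC h.summ h.cont 0
      have hB1 := differentiableOn_liftB_comp Metric.isOpen_ball hd₁ hc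
        (fun w hw => (hAr w hw w₂ hw₂).1) (fun w hw => hBr w hw w₂ hw₂) hb h.summ 0
      have hy1 := (differentiableOn_ypol hd₁ hc).zpow (m := -(2 * k : ℤ))
        (Or.inl fun w hw => (hAr w hw w₂ hw₂).1)
      have h1 : DifferentiableOn ℂ (fun w : ℂ => (1 - w) ^ (-(2 * k : ℤ))) (Metric.ball 0 R) :=
        DifferentiableOn.zpow (by fun_prop) (Or.inl hne1)
      exact h1.mul (hy1.mul (hA1.add hB1))) (fun w₁ hw₁ => by
      have hc := differentiableOn_const (𝕜 := ℂ) (s := Metric.ball (0 : ℂ) R) (localPoint z₀ w₁)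
      have hA1 := differentiableOn_liftA_comp Metric.isOpen_ball hc hd₂
        (fun w hw => hAr w₁ hw₁ w hw) hC h.summ h.cont 0
      have hB1 := differentiableOn_liftB_comp Metric.isOpen_ball hc hd₂
        (fun w hw => (hAr w₁ hw₁ w hw).1) (fun w hw => hBr w₁ hw₁ w hw) hb h.summ 0
      have hy1 := (differentiableOn_ypol hc hd₂).zpow (m := -(2 * k : ℤ))
        (Or.inl fun w hw => (hAr w₁ hw₁ w hw).1)
      exact (hy1.mul (hA1.add hB1)).const_mul _) (fun w₁ hw₁ w₂ hw₂ => by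
      obtain ⟨-, -, h1, h2⟩ := hreg w₁ hw₁ w₂ hw₂
      simp only [N]
      rw [norm_mul, norm_mul]
      refine mul_le_mul h1.le (mul_le_mul h2.le ((norm_add_le _ _).trans (add_le_add
        (hMA _ _ (hAr w₁ hw₁ w₂ hw₂)) (hMB _ _ (hBr w₁ hw₁ w₂ hw₂)))) (norm_nonneg _) ?_)
        (by positivity) zero_le_two
      positivity)
  refine ⟨J, fun i hi => ((hJ i).1 hi).2, R / 2, by positivity, a, ?_, fun w hw => ?_⟩
  · rw [ha0]
    simp only [N, localPoint_zero, sub_zero, one_zpow, one_mul, familyLift]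
    rw [hz₀', ypol_conj, ← hz₀', hsplit _ (Metric.mem_ball_self hε) _ (Metric.mem_ball_self hε)]
    -- At z₀ itself the discarded terms are zero, so the constant coefficient is the complete lift
    -- and not merely its regular part.
    have : ∑ i ∈ J, ∫ v in Set.Ioi (1 : ℝ), kerB ℓ k (c (m i)) 0 v (x i) z₀ z₀' = 0 := by
      refine Finset.sum_eq_zero fun i hi => ?_
      have hq : qf (x i) z₀' = 0 := by rw [hz₀', qf_conj, ((hJ i).1 hi).2, map_zero]
      simp only [kerB, termB_eq_zero hk hq, mul_zero, integral_zero]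
    rw [this, add_zero]
  · have hw' : w ∈ Metric.ball (0 : ℂ) (R / 2) := by simpa using hw
    have hcw' : starRingEnd ℂ w ∈ Metric.ball (0 : ℂ) (R / 2) := by simpa using hw
    have hsub : Metric.ball (0 : ℂ) (R / 2) ⊆ Metric.ball 0 R :=
      Metric.ball_subset_ball (by linarith)
    have hyw := (hAr w (hsub hw') _ (hsub hcw')).1
    have hmem := hreg w (hsub hw') _ (hsub hcw')
    rw [hz₀', ← conj_localPoint] at hyw hmem
    rw [ypol_conj] at hyw
    refine ⟨by exact_mod_cast hyw, ?_⟩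
    have hsum := ha w hw' _ hcw'
    have hN : N w (starRingEnd ℂ w) =
        (1 - w) ^ (-(2 * k : ℤ)) * familyLift ℓ k f (fun i => c (m i)) x (localPoint z₀ w) -
            ∑ i ∈ J, (1 - w) ^ (-(2 * k : ℤ)) * ((localPoint z₀ w).im : ℂ) ^ (-(2 * k : ℤ)) *
              ∫ v in Set.Ioi (1 : ℝ), kerB ℓ k (c (m i)) 0 v (x i) (localPoint z₀ w)
                (starRingEnd ℂ (localPoint z₀ w)) := by
      simp only [N, familyLift]
      rw [hz₀', ← conj_localPoint, ypol_conj, ← Finset.mul_sum,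
        hsplit _ hmem.1 _ hmem.2.1]
      ring
    rw [← hN]
    exact hsum

end IsFourierFamily

/-! ### Incomplete Gamma integrals -/

/-- The incomplete Gamma integral `∫_1^∞ v ^ t exp (-A v) dv`. -/
noncomputable def gammaInt (t : ℤ) (A : ℝ) : ℂ :=
  ∫ v in Set.Ioi (1 : ℝ), (v : ℂ) ^ t * Complex.exp (-(A * v))

theorem norm_zpow_le_of_one_le {v : ℝ} (hv : 1 ≤ v) (t : ℤ) :
    ‖(v : ℂ) ^ t‖ ≤ (1 + v) ^ t.natAbs := by
  have hv0 : 0 < v := by linarith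
  rw [norm_zpow, Complex.norm_real, Real.norm_of_nonneg hv0.le]
  calc v ^ t ≤ v ^ (t.natAbs : ℤ) := zpow_le_zpow_right₀ hv (by omega)
    _ = v ^ t.natAbs := zpow_natCast _ _
    _ ≤ _ := by gcongr; linarith

theorem continuousOn_zpow_mul_exp (t : ℤ) (A : ℝ) :
    ContinuousOn (fun v : ℝ => (v : ℂ) ^ t * Complex.exp (-(A * v))) (Set.Ioi 0) := by
  refine ContinuousOn.mul (ContinuousOn.zpow₀ (by fun_prop) _ fun v hv => Or.inl ?_) (by fun_prop)
  exact_mod_cast (ne_of_gt hv)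

theorem integrableOn_zpow_mul_exp (t : ℤ) {A : ℝ} (hA : 0 < A) :
    IntegrableOn (fun v : ℝ => (v : ℂ) ^ t * Complex.exp (-(A * v))) (Set.Ioi 1) := by
  refine Integrable.mono' (integrableOn_pow_mul_exp t.natAbs hA) ?_ ?_
  · exact ((continuousOn_zpow_mul_exp t A).mono
      (Set.Ioi_subset_Ioi zero_le_one)).aestronglyMeasurable measurableSet_Ioi
  · filter_upwards [self_mem_ae_restrict measurableSet_Ioi] with v hv
    rw [norm_mul]
    refine mul_le_mul (norm_zpow_le_of_one_le (le_of_lt hv) t) (le_of_eq ?_) (norm_nonneg _)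
      (by have : (1 : ℝ) < v := hv
          positivity)
    rw [← Complex.ofReal_mul, ← Complex.ofReal_neg, Complex.norm_exp_ofReal]

theorem hasDerivAt_zpow_mul_exp (t : ℤ) (A : ℝ) {v : ℝ} (hv : 0 < v) :
    HasDerivAt (fun v : ℝ => (v : ℂ) ^ t * Complex.exp (-(A * v)))
      (t * ((v : ℂ) ^ (t - 1) * Complex.exp (-(A * v))) -
        A * ((v : ℂ) ^ t * Complex.exp (-(A * v)))) v := by
  have hv0 : (v : ℂ) ≠ 0 := by exact_mod_cast hv.ne'
  have h1 : HasDerivAt (fun z : ℂ => z ^ t) (t * (v : ℂ) ^ (t - 1)) v :=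
    hasDerivAt_zpow t _ (Or.inl hv0)
  have h2 : HasDerivAt (fun z : ℂ => Complex.exp (-(A * z)))
      (Complex.exp (-(A * v)) * -((A : ℂ) * 1)) v :=
    (((hasDerivAt_id (v : ℂ)).const_mul (A : ℂ)).neg).cexp
  have h3 : HasDerivAt (fun z : ℂ => z ^ t * Complex.exp (-(A * z)))
      (t * ((v : ℂ) ^ (t - 1) * Complex.exp (-(A * v))) -
        A * ((v : ℂ) ^ t * Complex.exp (-(A * v)))) v :=
    (h1.fun_mul h2).congr_deriv (by ring)
  exact h3.comp_ofReal

theorem tendsto_zpow_mul_exp (t : ℤ) {A : ℝ} (hA : 0 < A) :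
    Tendsto (fun v : ℝ => (v : ℂ) ^ t * Complex.exp (-(A * v))) atTop (𝓝 0) := by
  rw [tendsto_zero_iff_norm_tendsto_zero]
  have hA2 : 0 < A / 2 := by positivity
  have hexp : Tendsto (fun v : ℝ => t.natAbs.factorial / (A / 2) ^ t.natAbs * Real.exp (A / 2) *
      Real.exp (-(A / 2 * v))) atTop (𝓝 0) := by
    have : Tendsto (fun v : ℝ => Real.exp (-(A / 2 * v))) atTop (𝓝 0) :=
      Real.tendsto_exp_neg_atTop_nhds_zero.comp (tendsto_id.const_mul_atTop hA2)
    simpa using this.const_mul (t.natAbs.factorial / (A / 2) ^ t.natAbs * Real.exp (A / 2))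
  refine squeeze_zero' (Eventually.of_forall fun v => norm_nonneg _) ?_ hexp
  filter_upwards [eventually_ge_atTop 1] with v hv
  rw [norm_mul, ← Complex.ofReal_mul, ← Complex.ofReal_neg, Complex.norm_exp_ofReal]
  calc _ ≤ (1 + v) ^ t.natAbs * Real.exp (-(A * v)) := by
        gcongr; exact norm_zpow_le_of_one_le hv t
    _ = (1 + v) ^ t.natAbs * Real.exp (-(A / 2 * v)) * Real.exp (-(A / 2 * v)) := by
        rw [mul_assoc, ← Real.exp_add]; ring_nf
    _ ≤ _ := mul_le_mul_of_nonneg_right (pow_mul_exp_neg_le _ hA2 (by linarith))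
        (Real.exp_pos _).le

theorem gammaInt_by_parts (t : ℤ) {A : ℝ} (hA : 0 < A) :
    (A : ℂ) * gammaInt t A = Complex.exp (-A) + t * gammaInt (t - 1) A := by
  have hcont : ContinuousWithinAt (fun v : ℝ => (v : ℂ) ^ t * Complex.exp (-(A * v)))
      (Set.Ici 1) 1 :=
    (hasDerivAt_zpow_mul_exp t A zero_lt_one).continuousAt.continuousWithinAt
  have hint := ((integrableOn_zpow_mul_exp (t - 1) hA).const_mul (t : ℂ)).sub
    ((integrableOn_zpow_mul_exp t hA).const_mul (A : ℂ))
  have key := integral_Ioi_of_hasDerivAt_of_tendsto hcont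
    (fun v hv => hasDerivAt_zpow_mul_exp t A (zero_lt_one.trans hv)) hint
    (tendsto_zpow_mul_exp t hA)
  rw [integral_sub ((integrableOn_zpow_mul_exp (t - 1) hA).const_mul (t : ℂ))
    ((integrableOn_zpow_mul_exp t hA).const_mul (A : ℂ)), integral_const_mul,
    integral_const_mul] at key
  simp only [Complex.ofReal_one, one_zpow, one_mul, mul_one, zero_sub] at key
  rw [gammaInt, gammaInt]
  linear_combination -key

theorem gammaInt_zero {A : ℝ} (hA : 0 < A) : gammaInt 0 A = (A : ℂ)⁻¹ * Complex.exp (-A) := by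
  have hA' : (A : ℂ) ≠ 0 := by exact_mod_cast hA.ne'
  have := gammaInt_by_parts 0 hA
  rw [Int.cast_zero, zero_mul, add_zero] at this
  rw [← this, inv_mul_cancel_left₀ hA']

/-- Upward recursion from ∫ exp(-Av) dv = A⁻¹ exp(-A): each integration by parts costs one factor
A⁻¹, and no logarithm appears. -/
theorem exists_gammaInt_nat (n : ℕ) : ∃ P : ℂ → ℂ, AnalyticAt ℂ P 0 ∧
    ∀ A : ℝ, 0 < A → gammaInt n A = (A : ℂ) ^ (-((n + 1 : ℕ) : ℤ)) * P A := by
  have hexp : AnalyticAt ℂ (fun z : ℂ => Complex.exp (-z)) 0 := analyticAt_id.neg.cexp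
  induction n with
  | zero =>
    refine ⟨_, hexp, fun A hA => ?_⟩
    rw [Nat.cast_zero, gammaInt_zero hA]
    simp
  | succ n ih =>
    obtain ⟨P, hP, h⟩ := ih
    refine ⟨fun z => z ^ (n + 1) * Complex.exp (-z) + (n + 1 : ℂ) * P z,
      ((analyticAt_id.pow _).mul hexp).add (analyticAt_const.mul hP), fun A hA => ?_⟩
    have hA' : (A : ℂ) ≠ 0 := by exact_mod_cast hA.ne'
    have := gammaInt_by_parts ((n + 1 : ℕ) : ℤ) hA
    rw [show (((n + 1 : ℕ) : ℤ) - 1) = (n : ℤ) by push_cast; ring, h A hA] at this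
    rw [← mul_right_inj' hA', this]
    rw [zpow_neg, zpow_neg, zpow_natCast, zpow_natCast]
    field_simp
    push_cast
    ring

theorem hasDerivAt_gammaInt_neg_one {A : ℝ} (hA : 0 < A) :
    HasDerivAt (fun A : ℝ => gammaInt (-1) A) (-gammaInt 0 A) A := by
  have hA2 : 0 < A / 2 := by positivity
  have key := hasDerivAt_integral_of_dominated_loc_of_deriv_le
    (μ := volume.restrict (Set.Ioi (1 : ℝ)))
    (F := fun (A : ℝ) (v : ℝ) => (v : ℂ) ^ (-1 : ℤ) * Complex.exp (-(A * v)))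
    (F' := fun (A : ℝ) (v : ℝ) => -((v : ℂ) ^ (0 : ℤ) * Complex.exp (-(A * v))))
    (x₀ := A) (s := Set.Ioi (A / 2)) (bound := fun v => (1 + v) ^ 0 * Real.exp (-(A / 2 * v)))
    (Ioi_mem_nhds (by linarith)) ?_ (integrableOn_zpow_mul_exp (-1) hA)
    (integrableOn_zpow_mul_exp 0 hA).neg.aestronglyMeasurable ?_
    (integrableOn_pow_mul_exp 0 hA2) ?_
  · have h := key.2
    rw [integral_neg] at h
    exact h
  · filter_upwards [Ioi_mem_nhds hA] with B hB
    exact (integrableOn_zpow_mul_exp (-1) hB).aestronglyMeasurable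
  · filter_upwards [self_mem_ae_restrict measurableSet_Ioi] with v hv B hB
    have hv0 : (0 : ℝ) < v := zero_lt_one.trans hv
    have hB' : A / 2 < B := hB
    rw [norm_neg, zpow_zero, one_mul, ← Complex.ofReal_mul, ← Complex.ofReal_neg,
      Complex.norm_exp_ofReal, pow_zero, one_mul]
    gcongr
  · filter_upwards [self_mem_ae_restrict measurableSet_Ioi] with v hv B hB
    have hv0 : (v : ℂ) ≠ 0 := by exact_mod_cast (zero_lt_one.trans hv).ne'
    have h2 : HasDerivAt (fun z : ℂ => Complex.exp (-(z * v)))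
        (Complex.exp (-(B * v)) * -(1 * (v : ℂ))) B :=
      (((hasDerivAt_id (B : ℂ)).mul_const (v : ℂ)).neg).cexp
    have h3 : HasDerivAt (fun z : ℂ => (v : ℂ) ^ (-1 : ℤ) * Complex.exp (-(z * v)))
        (-((v : ℂ) ^ (0 : ℤ) * Complex.exp (-(B * v)))) B :=
      (h2.const_mul ((v : ℂ) ^ (-1 : ℤ))).congr_deriv (by
        rw [zpow_zero, zpow_neg_one]
        field_simp)
    exact h3.comp_ofReal

/-- The derivative of `gammaInt (-1) A` + log A is (1 - exp(-A))/A, which extends holomorphically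
across 0; a primitive Φ of this extension differs from the function by a constant, fixed at A = 1/2.
-/
theorem exists_gammaInt_neg_one : ∃ E : ℂ → ℂ, AnalyticAt ℂ E 0 ∧
    ∀ᶠ A : ℝ in 𝓝[>] 0, gammaInt (-1) A = E A - Real.log A := by
  let g : ℂ → ℂ := dslope (fun z => -Complex.exp (-z)) 0
  have hg : DifferentiableOn ℂ g (Metric.ball 0 1) := by
    rw [Complex.differentiableOn_dslope (Metric.ball_mem_nhds 0 one_pos)]
    fun_prop
  obtain ⟨Φ, hΦ⟩ := hg.isExactOn_ball
  have hΦan : AnalyticAt ℂ Φ 0 := by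
    have : DifferentiableOn ℂ Φ (Metric.ball 0 1) := fun z hz =>
      (hΦ z hz).differentiableAt.differentiableWithinAt
    exact this.analyticAt (Metric.ball_mem_nhds 0 one_pos)
  have hder : ∀ A ∈ Set.Ioo (0 : ℝ) 1, HasDerivAt
      (fun A : ℝ => gammaInt (-1) A + Real.log A - Φ A) 0 A := by
    intro A hA
    have hA' : (A : ℂ) ≠ 0 := by exact_mod_cast hA.1.ne'
    have h1 := hasDerivAt_gammaInt_neg_one hA.1
    have h2 := (Real.hasDerivAt_log hA.1.ne').ofReal_comp
    have h3 : HasDerivAt (fun A : ℝ => Φ A) (g A) A := by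
      refine (hΦ (A : ℂ) ?_).comp_ofReal
      rw [mem_ball_zero_iff, Complex.norm_real, Real.norm_of_nonneg hA.1.le]
      exact hA.2
    refine ((h1.fun_add h2).fun_sub h3).congr_deriv ?_
    rw [gammaInt_zero hA.1]
    simp only [g]
    rw [dslope_of_ne _ hA', slope_def_field]
    simp
    field_simp
    ring
  have hconst : ∀ A ∈ Set.Ioo (0 : ℝ) 1, gammaInt (-1) A + Real.log A - Φ A =
      gammaInt (-1) (1 / 2 : ℝ) + Real.log (1 / 2 : ℝ) - Φ ((1 / 2 : ℝ) : ℂ) := by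
    intro A hA
    exact isOpen_Ioo.is_const_of_deriv_eq_zero isPreconnected_Ioo
      (fun B hB => (hder B hB).differentiableAt.differentiableWithinAt)
      (fun B hB => (hder B hB).deriv) hA ⟨by norm_num, by norm_num⟩
  refine ⟨fun z => Φ z + (gammaInt (-1) (1 / 2 : ℝ) + Real.log (1 / 2 : ℝ) - Φ ((1 / 2 : ℝ) : ℂ)),
    hΦan.add analyticAt_const, ?_⟩
  filter_upwards [Ioo_mem_nhdsGT one_pos] with A hA
  linear_combination hconst A hA

/-- Downward recursion from exponent -1: solving the integration by parts for the lower exponent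
only multiplies by A and adds exp(-A), so no pole is created and the logarithm keeps an analytic
coefficient. -/
theorem exists_gammaInt_neg (n : ℕ) : ∃ E D : ℂ → ℂ, AnalyticAt ℂ E 0 ∧ AnalyticAt ℂ D 0 ∧
    ∀ᶠ A : ℝ in 𝓝[>] 0, gammaInt (-((n + 1 : ℕ) : ℤ)) A = E A + D A * Real.log A := by
  have hexp : AnalyticAt ℂ (fun z : ℂ => Complex.exp (-z)) 0 := analyticAt_id.neg.cexp
  induction n with
  | zero =>
    obtain ⟨E, hE, h⟩ := exists_gammaInt_neg_one
    refine ⟨E, fun _ => -1, hE, analyticAt_const, ?_⟩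
    filter_upwards [h] with A hA
    rw [zero_add, Nat.cast_one, hA]
    ring
  | succ n ih =>
    obtain ⟨E, D, hE, hD, h⟩ := ih
    refine ⟨fun z => (n + 1 : ℂ)⁻¹ * (Complex.exp (-z) - z * E z),
      fun z => (n + 1 : ℂ)⁻¹ * (-(z * D z)),
      analyticAt_const.mul (hexp.sub (analyticAt_id.mul hE)),
      analyticAt_const.mul (analyticAt_id.mul hD).neg, ?_⟩
    filter_upwards [h, self_mem_nhdsWithin] with A hA hpos
    have := gammaInt_by_parts (-((n + 1 : ℕ) : ℤ)) hpos
    rw [hA, show (-((n + 1 : ℕ) : ℤ) - 1) = -((n + 1 + 1 : ℕ) : ℤ) by push_cast; ring] at this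
    have hn : (n + 1 : ℂ) ≠ 0 := by exact_mod_cast Nat.succ_ne_zero n
    rw [← mul_right_inj' hn]
    simp only [mul_add, mul_inv_cancel_left₀ hn, ← mul_assoc]
    push_cast at this ⊢
    linear_combination this

/-! ### Functions with a pole of bounded order and a logarithm at `0` -/

/-- `S ρ = ρ ^ (-k) A(ρ) + D(ρ) log ρ` for small `ρ > 0`, with analytic `A` and `D`, and `D = 0`
under the condition `b`. -/
def IsLogMeromorphic (k : ℕ) (b : Prop) (S : ℝ → ℂ) : Prop :=
  ∃ A D : ℂ → ℂ, AnalyticAt ℂ A 0 ∧ AnalyticAt ℂ D 0 ∧ (b → D = 0) ∧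
    ∀ᶠ ρ : ℝ in 𝓝[>] 0, S ρ = (ρ : ℂ) ^ (-(k : ℤ)) * A ρ + D ρ * Real.log ρ

namespace IsLogMeromorphic

variable {k : ℕ} {b : Prop} {S S' : ℝ → ℂ}

theorem zero : IsLogMeromorphic k b fun _ => 0 :=
  ⟨0, 0, analyticAt_const, analyticAt_const, fun _ => rfl, by simp⟩

theorem add (h : IsLogMeromorphic k b S) (h' : IsLogMeromorphic k b S') :
    IsLogMeromorphic k b fun ρ => S ρ + S' ρ := by
  obtain ⟨A, D, hA, hD, hb, hS⟩ := h
  obtain ⟨A', D', hA', hD', hb', hS'⟩ := h'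
  refine ⟨A + A', D + D', hA.add hA', hD.add hD', fun hh => by simp [hb hh, hb' hh], ?_⟩
  filter_upwards [hS, hS'] with ρ h1 h2
  simp only [h1, h2, Pi.add_apply]
  ring

theorem sum {κ : Type*} (s : Finset κ) {S : κ → ℝ → ℂ}
    (h : ∀ j ∈ s, IsLogMeromorphic k b (S j)) : IsLogMeromorphic k b fun ρ => ∑ j ∈ s, S j ρ := by
  classical
  induction s using Finset.induction_on with
  | empty => simpa using zero
  | insert j s hj ih =>
    simp only [Finset.sum_insert hj]
    exact (h j (Finset.mem_insert_self _ _)).add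
      (ih fun i hi => h i (Finset.mem_insert_of_mem hi))

theorem analytic_mul (h : IsLogMeromorphic k b S) {E : ℂ → ℂ} (hE : AnalyticAt ℂ E 0) :
    IsLogMeromorphic k b fun ρ => E ρ * S ρ := by
  obtain ⟨A, D, hA, hD, hb, hS⟩ := h
  refine ⟨E * A, E * D, hE.mul hA, hE.mul hD, fun hh => by simp [hb hh], ?_⟩
  filter_upwards [hS] with ρ h1
  simp only [h1, Pi.mul_apply]
  ring

/-- The exponent t ≥ 0 gives a pole of order t + 1 without logarithm, and t < 0 gives a logarithm
without pole. -/
theorem gammaInt {t : ℤ} (ht : t + 1 ≤ k) (hb : b → 0 ≤ t) :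
    IsLogMeromorphic k b (gammaInt t) := by
  rcases le_or_gt 0 t with h0 | h0
  · obtain ⟨n, rfl⟩ := Int.eq_ofNat_of_zero_le h0
    obtain ⟨P, hP, h⟩ := exists_gammaInt_nat n
    obtain ⟨e, rfl⟩ : ∃ e, k = n + 1 + e := ⟨k - (n + 1), by omega⟩
    refine ⟨fun z => z ^ e * P z, 0, (analyticAt_id.pow _).mul hP, analyticAt_const,
      fun _ => rfl, ?_⟩
    filter_upwards [self_mem_nhdsWithin] with A hA
    have hA' : (A : ℂ) ≠ 0 := by exact_mod_cast (ne_of_gt hA)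
    rw [h A hA]
    simp only [Pi.zero_apply, zero_mul, add_zero]
    rw [zpow_neg, zpow_neg, zpow_natCast, zpow_natCast, pow_add]
    field_simp
    ring
  · obtain ⟨n, rfl⟩ : ∃ n : ℕ, t = -((n + 1 : ℕ) : ℤ) := ⟨(-t - 1).toNat, by omega⟩
    obtain ⟨E, D, hE, hD, h⟩ := exists_gammaInt_neg n
    refine ⟨fun z => z ^ k * E z, D, (analyticAt_id.pow _).mul hE, hD,
      fun hh => absurd (hb hh) (by omega), ?_⟩
    filter_upwards [h, self_mem_nhdsWithin] with A hA hpos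
    have hA' : (A : ℂ) ≠ 0 := by exact_mod_cast (ne_of_gt hpos)
    rw [hA, zpow_neg, zpow_natCast]
    field_simp

theorem comp_div (h : IsLogMeromorphic k b S) {C₀ : ℝ} (hC₀ : 0 < C₀) :
    IsLogMeromorphic k b fun ρ => S (C₀ * ρ / (1 - ρ) ^ 2) := by
  obtain ⟨A, D, hA, hD, hb, hS⟩ := h
  let φ : ℂ → ℂ := fun z => C₀ * z / (1 - z) ^ 2
  have hφ : AnalyticAt ℂ φ 0 :=
    (analyticAt_const.mul analyticAt_id).div ((analyticAt_const.sub analyticAt_id).pow 2) (by simp)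
  have hφ0 : φ 0 = 0 := by simp [φ]
  have hAφ : AnalyticAt ℂ (fun z => A (φ z)) 0 := AnalyticAt.fun_comp (by rwa [hφ0]) hφ
  have hDφ : AnalyticAt ℂ (fun z => D (φ z)) 0 := AnalyticAt.fun_comp (by rwa [hφ0]) hφ
  have hlog : AnalyticAt ℂ (fun z : ℂ => Complex.log (1 - z)) 0 :=
    (analyticAt_const.sub analyticAt_id).clog (by simp)
  have hfac : AnalyticAt ℂ (fun z : ℂ => ((1 - z) ^ 2 / C₀) ^ k) 0 :=
    (((analyticAt_const.sub analyticAt_id).pow 2).div analyticAt_const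
      (by exact_mod_cast hC₀.ne')).pow k
  -- Here log φ(ρ) is log ρ plus the analytic function log C₀ - 2 log(1 - ρ). Its product with D is
  -- moved to the analytic part, where z^k offsets the prefactor ρ^(-k).
  refine ⟨fun z => ((1 - z) ^ 2 / C₀) ^ k * A (φ z) +
      z ^ k * (D (φ z) * (Real.log C₀ - 2 * Complex.log (1 - z))), fun z => D (φ z),
    (hfac.mul hAφ).add ((analyticAt_id.pow k).mul
      (hDφ.mul (analyticAt_const.sub (analyticAt_const.mul hlog)))), hDφ,
    fun hh => by rw [hb hh]; rfl, ?_⟩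
  have htend : Tendsto (fun ρ : ℝ => C₀ * ρ / (1 - ρ) ^ 2) (𝓝[>] 0) (𝓝[>] 0) := by
    refine tendsto_nhdsWithin_iff.2 ⟨?_, ?_⟩
    · have : ContinuousAt (fun ρ : ℝ => C₀ * ρ / (1 - ρ) ^ 2) 0 :=
        ContinuousAt.div (by fun_prop) (by fun_prop) (by simp)
      simpa using this.tendsto.mono_left nhdsWithin_le_nhds
    · filter_upwards [Ioo_mem_nhdsGT one_pos] with ρ hρ
      have h1 : 0 < 1 - ρ := by linarith [hρ.2]
      have h2 := hρ.1
      exact div_pos (mul_pos hC₀ h2) (pow_pos h1 2)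
  filter_upwards [htend.eventually hS, Ioo_mem_nhdsGT one_pos] with ρ h1 hρ
  have hρ1 : 0 < 1 - ρ := by linarith [hρ.2]
  have hρ0 : 0 < ρ := hρ.1
  have e1 : ((C₀ * ρ / (1 - ρ) ^ 2 : ℝ) : ℂ) = φ ρ := by simp [φ]
  have e2 : Real.log (C₀ * ρ / (1 - ρ) ^ 2) = Real.log C₀ + Real.log ρ - 2 * Real.log (1 - ρ) := by
    rw [Real.log_div (by positivity) (by positivity), Real.log_mul hC₀.ne' hρ0.ne', Real.log_pow]
    norm_num
  have e3 : (Real.log (1 - ρ) : ℂ) = Complex.log (1 - ρ) := by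
    rw [Complex.ofReal_log hρ1.le]; push_cast; rfl
  rw [h1, e1, e2]
  push_cast
  rw [e3]
  have c1 : (1 - ρ : ℂ) ≠ 0 := by exact_mod_cast hρ1.ne'
  have c2 : (ρ : ℂ) ≠ 0 := by exact_mod_cast hρ0.ne'
  have c3 : (C₀ : ℂ) ≠ 0 := by exact_mod_cast hC₀.ne'
  have e4 : φ ρ ^ (-(k : ℤ)) = (ρ : ℂ) ^ (-(k : ℤ)) * ((1 - ρ) ^ 2 / C₀) ^ k := by
    simp only [φ, zpow_neg, zpow_natCast]
    rw [← inv_pow, ← inv_pow, ← mul_pow]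
    congr 1
    field_simp
  rw [e4, mul_add, ← mul_assoc ((ρ : ℂ) ^ (-(k : ℤ))) ((ρ : ℂ) ^ k), zpow_neg, zpow_natCast,
    inv_mul_cancel₀ (pow_ne_zero k c2)]
  ring

end IsLogMeromorphic

/-! ### Singular terms of the cuspidal part -/

theorem natDegree_hermiteH_le (ℓ : ℕ) : (hermiteH ℓ).natDegree ≤ ℓ := by
  induction ℓ with
  | zero => simp [hermiteH]
  | succ n ih =>
    rw [hermiteH]
    refine (Polynomial.natDegree_sub_le _ _).trans (max_le ?_ ?_)
    · refine Polynomial.natDegree_mul_le.trans ?_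
      have h2 : (2 * Polynomial.X : Polynomial ℝ).natDegree ≤ 1 :=
        Polynomial.natDegree_mul_le.trans (by
          rw [Polynomial.natDegree_X, Polynomial.natDegree_ofNat])
      omega
    · exact (Polynomial.natDegree_derivative_le _).trans (by omega)

/-- By parity, `hermiteH ℓ` contains only powers congruent to ℓ modulo 2. Hence the half-integral
powers of v coming from v^(-ℓ/2) and √v^j combine to integral ones. -/
theorem exists_add_of_coeff_hermiteH_ne_zero (ℓ : ℕ) {j : ℕ} (h : (hermiteH ℓ).coeff j ≠ 0) :
    ∃ i, ℓ = j + 2 * i := by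
  induction ℓ generalizing j with
  | zero =>
    rw [hermiteH, Polynomial.coeff_one] at h
    have : j = 0 := by by_contra h0; exact h (if_neg h0)
    exact ⟨0, by omega⟩
  | succ n ih =>
    rw [hermiteH, Polynomial.coeff_sub, Polynomial.coeff_derivative, mul_assoc,
      Polynomial.coeff_ofNat_mul] at h
    by_cases h1 : (hermiteH n).coeff (j + 1) = 0
    · rw [h1, zero_mul, sub_zero] at h
      rcases j with _ | j
      · simp at h
      · rw [Polynomial.coeff_X_mul] at h
        obtain ⟨i, hi⟩ := ih (right_ne_zero_of_mul h)
        exact ⟨i, by omega⟩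
    · obtain ⟨i, hi⟩ := ih h1
      exact ⟨i + 1, by omega⟩

theorem eq_of_qf_eq_zero {x : Fin 3 → ℝ} {z : ℂ} (hz : z.im ≠ 0) (h : qf x z = 0) :
    x 0 = x 2 * z.re ∧ x 1 = -(x 2 * (z.re ^ 2 + z.im ^ 2)) := by
  have hre := congrArg Complex.re h
  have him := congrArg Complex.im h
  simp [qf, pow_two] at hre him
  have h0 : x 0 = x 2 * z.re := by
    have : z.im * (x 2 * z.re - x 0) = 0 := by linarith
    have := (mul_eq_zero.1 this).resolve_left hz
    linarith
  refine ⟨h0, ?_⟩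
  rw [h0] at hre
  linarith

/-- As a polynomial in ζ with real coefficients, `qf x` has the root z̄ along with z; equivalently,
x is a multiple of Z^⊥(z). -/
theorem qf_of_qf_eq_zero {x : Fin 3 → ℝ} {z : ℂ} (hz : z.im ≠ 0) (h : qf x z = 0) (ζ : ℂ) :
    qf x ζ = x 2 * ((ζ - z) * (ζ - starRingEnd ℂ z)) := by
  obtain ⟨h0, h1⟩ := eq_of_qf_eq_zero hz h
  have h0' : (2 : ℂ) * x 0 = x 2 * (z + starRingEnd ℂ z) := by
    rw [Complex.add_conj, h0]; push_cast; ring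
  have h1' : (x 1 : ℂ) = -(x 2 * (z * starRingEnd ℂ z)) := by
    rw [Complex.mul_conj, Complex.normSq_apply, h1]; push_cast; ring
  rw [qf, h0', h1']
  ring

theorem pf_of_qf_eq_zero {x : Fin 3 → ℝ} {z : ℂ} (hz : z.im ≠ 0) (h : qf x z = 0) (z₁ z₂ : ℂ) :
    pf x z₁ z₂ = x 2 / 2 * ((z₁ - z) * (z₂ - starRingEnd ℂ z) +
      (z₁ - starRingEnd ℂ z) * (z₂ - z)) / ypol z₁ z₂ := by
  obtain ⟨h0, h1⟩ := eq_of_qf_eq_zero hz h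
  have h0' : (2 : ℂ) * x 0 = x 2 * (z + starRingEnd ℂ z) := by
    rw [Complex.add_conj, h0]; push_cast; ring
  have h1' : (x 1 : ℂ) = -(x 2 * (z * starRingEnd ℂ z)) := by
    rw [Complex.mul_conj, Complex.normSq_apply, h1]; push_cast; ring
  rw [pf, h1']
  congr 1
  linear_combination -(z₁ + z₂) / 2 * h0'

section LocalPoint

variable {z₀ w : ℂ}

theorem conj_eq_sub (z : ℂ) : starRingEnd ℂ z = z - 2 * Complex.I * z.im := by
  have := Complex.sub_conj z
  push_cast at this
  linear_combination -this

theorem localPoint_sub (hw : w ≠ 1) :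
    localPoint z₀ w - z₀ = 2 * Complex.I * z₀.im * w / (1 - w) := by
  have h1 : 1 - w ≠ 0 := sub_ne_zero.2 hw.symm
  rw [localPoint, conj_eq_sub z₀]
  field_simp
  ring

theorem localPoint_sub_conj (hw : w ≠ 1) :
    localPoint z₀ w - starRingEnd ℂ z₀ = 2 * Complex.I * z₀.im / (1 - w) := by
  have h1 : 1 - w ≠ 0 := sub_ne_zero.2 hw.symm
  rw [localPoint, conj_eq_sub z₀]
  field_simp
  ring

theorem conj_localPoint_sub_conj (hw : w ≠ 1) :
    starRingEnd ℂ (localPoint z₀ w) - starRingEnd ℂ z₀ =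
      -(2 * Complex.I * z₀.im * starRingEnd ℂ w / (1 - starRingEnd ℂ w)) := by
  rw [← map_sub, localPoint_sub hw]
  simp [map_ofNat]
  ring

theorem conj_localPoint_sub (hw : w ≠ 1) :
    starRingEnd ℂ (localPoint z₀ w) - z₀ =
      -(2 * Complex.I * z₀.im / (1 - starRingEnd ℂ w)) := by
  have := congrArg (starRingEnd ℂ) (localPoint_sub_conj (z₀ := z₀) hw)
  rw [map_sub, Complex.conj_conj] at this
  rw [this]
  simp [map_ofNat]
  ring

theorem ypol_localPoint (hw : w ≠ 1) :
    ypol (localPoint z₀ w) (starRingEnd ℂ (localPoint z₀ w)) =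
      z₀.im * (1 - w * starRingEnd ℂ w) / ((1 - w) * (1 - starRingEnd ℂ w)) := by
  have h1 : 1 - w ≠ 0 := sub_ne_zero.2 hw.symm
  have h2 : 1 - starRingEnd ℂ w ≠ 0 := by
    rw [← map_one (starRingEnd ℂ), ← map_sub]
    exact (map_ne_zero _).2 h1
  have h3 : localPoint z₀ w - starRingEnd ℂ (localPoint z₀ w) =
      (localPoint z₀ w - z₀) - (starRingEnd ℂ (localPoint z₀ w) - z₀) := by ring
  rw [ypol, h3, localPoint_sub hw, conj_localPoint_sub hw]
  have := Complex.I_ne_zero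
  field_simp
  ring

end LocalPoint

/-- Near a point where `qf x` vanishes, the cuspidal contribution of `x` is `w̄ ^ k` times a
function of `|w| ^ 2`. -/
theorem exists_singular_term (ℓ : ℕ) {k : ℕ} (hk : 1 ≤ k) (β : ℂ) {x : Fin 3 → ℝ} {z₀ : ℂ}
    (hz₀ : z₀.im ≠ 0) (hx : qf x z₀ = 0) :
    ∃ S, IsLogMeromorphic k (ℓ < 2 * k) S ∧ ∀ w : ℂ, 0 < ‖w‖ → ‖w‖ < 1 →
      (1 - w) ^ (-(2 * k : ℤ)) * ((localPoint z₀ w).im : ℂ) ^ (-(2 * k : ℤ)) *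
        ∫ v in Set.Ioi (1 : ℝ), kerB ℓ k β 0 v x (localPoint z₀ w)
          (starRingEnd ℂ (localPoint z₀ w)) = starRingEnd ℂ w ^ k * S (‖w‖ ^ 2) := by
  -- On the line spanned by Z^⊥(z₀), a vanishing lower left entry means x = 0, and then the term is
  -- identically zero.
  by_cases hγ : x 2 = 0
  · refine ⟨_, IsLogMeromorphic.zero, fun w _ _ => ?_⟩
    have h0 : ∀ ζ, qf x ζ = 0 := fun ζ => by rw [qf_of_qf_eq_zero hz₀ hx, hγ]; simp
    simp only [kerB, termB_eq_zero hk (h0 _), mul_zero, integral_zero]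
  set γ := x 2 with hγdef
  set y := z₀.im with hy
  -- Chosen so that π|`qf`|²/Im(z)² = C₀ρ/(1 - ρ)² with ρ = |w|².
  let C₀ : ℝ := 16 * Real.pi * γ ^ 2 * y ^ 2
  have hC₀ : 0 < C₀ := by positivity
  -- The exponent of v for the ξ^j part of the Hermite polynomial. The natural division is exact
  -- whenever the coefficient is nonzero; the other j contribute zero.
  let t : ℕ → ℤ := fun j => (k : ℤ) - 1 - ((ℓ - j) / 2 : ℕ)
  let co : ℕ → ℂ := fun j => β * ((2 : ℂ) ^ ℓ)⁻¹ * ((hermiteH ℓ).coeff j : ℝ) *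
    (Real.sqrt Real.pi * (2 * γ * y)) ^ j * (-(1 / (Real.sqrt 2 : ℂ))) ^ k * (-4 * γ) ^ k
  let E : ℕ → ℂ → ℂ := fun j ρ => co j * ((1 + ρ) / (1 - ρ)) ^ j * ((1 - ρ) ^ (2 * k))⁻¹
  have hE : ∀ j, AnalyticAt ℂ (E j) 0 := by
    intro j
    have h1 : AnalyticAt ℂ (fun ρ : ℂ => 1 - ρ) 0 := analyticAt_const.sub analyticAt_id
    have h2 : AnalyticAt ℂ (fun ρ : ℂ => 1 + ρ) 0 := analyticAt_const.add analyticAt_id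
    exact (analyticAt_const.mul ((h2.div h1 (by simp)).pow j)).mul ((h1.pow _).inv (by simp))
  refine ⟨fun ρ => ∑ j ∈ Finset.range (ℓ + 1), E j ρ * gammaInt (t j) (C₀ * ρ / (1 - ρ) ^ 2),
    IsLogMeromorphic.sum _ fun j hj => ?_, fun w hw0 hw1 => ?_⟩
  · rw [Finset.mem_range] at hj
    -- Always t j + 1 ≤ k, which bounds the pole. If ℓ < 2k, then ⌊ℓ/2⌋ ≤ k - 1, so every t j is
    -- nonnegative and logarithms are absent.
    refine ((IsLogMeromorphic.gammaInt ?_ ?_).comp_div hC₀).analytic_mul (hE j)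
    · simp only [t]; omega
    · intro h; simp only [t]; omega
  have hwne : w ≠ 1 := by rintro rfl; simp at hw1
  have h1 : 1 - w ≠ 0 := sub_ne_zero.2 hwne.symm
  have h2 : 1 - starRingEnd ℂ w ≠ 0 := by
    rw [← map_one (starRingEnd ℂ), ← map_sub]
    exact (map_ne_zero _).2 h1
  have hρ : w * starRingEnd ℂ w = ((‖w‖ ^ 2 : ℝ) : ℂ) := by
    rw [Complex.mul_conj, Complex.normSq_eq_norm_sq]
  set ρ : ℝ := ‖w‖ ^ 2 with hρdef
  have hρ1 : 0 < 1 - ρ := by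
    have : ρ < 1 := by rw [hρdef]; exact pow_lt_one₀ hw0.le hw1 two_ne_zero
    linarith
  have hρc : (1 - ρ : ℂ) ≠ 0 := by exact_mod_cast hρ1.ne'
  have hyc : (y : ℂ) ≠ 0 := by exact_mod_cast hz₀
  have hρ0 : 0 < ρ := by positivity
  set A : ℝ := C₀ * ρ / (1 - ρ) ^ 2 with hA
  have hA0 : 0 < A := by positivity
  set z := localPoint z₀ w with hz
  set z' := starRingEnd ℂ z with hz'
  have hypol : ypol z z' = y * (1 - ρ) / ((1 - w) * (1 - starRingEnd ℂ w)) := by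
    rw [hz', hz, ypol_localPoint hwne, hρ]
  have hpf : pf x z z' = 2 * γ * y * ((1 + ρ) / (1 - ρ)) := by
    rw [pf_of_qf_eq_zero hz₀ hx, hypol, hz', hz, localPoint_sub hwne, localPoint_sub_conj hwne,
      conj_localPoint_sub hwne, conj_localPoint_sub_conj hwne, ← hγdef, ← hy, ← hρ]
    rw [← hρ] at hρc
    field_simp
    linear_combination (-(γ : ℂ) * (1 + w * starRingEnd ℂ w)) * Complex.I_sq
  have hq1 : qf x z = -4 * γ * y ^ 2 * w / (1 - w) ^ 2 := by
    rw [qf_of_qf_eq_zero hz₀ hx, hz, localPoint_sub hwne, localPoint_sub_conj hwne]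
    field_simp
    linear_combination (4 * x 2 * z₀.im ^ 2 * w) * Complex.I_sq
  have hq2 : qf x z' = -4 * γ * y ^ 2 * starRingEnd ℂ w / (1 - starRingEnd ℂ w) ^ 2 := by
    rw [qf_of_qf_eq_zero hz₀ hx, hz', hz, conj_localPoint_sub hwne, conj_localPoint_sub_conj hwne]
    field_simp
    linear_combination (4 * x 2 * z₀.im ^ 2 * starRingEnd ℂ w) * Complex.I_sq
  have hqq : Real.pi * (qf x z / ypol z z' * (qf x z' / ypol z z')) = A := by
    rw [hq1, hq2, hypol, hA]
    push_cast [C₀]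
    rw [← hρ] at hρc ⊢
    field_simp
    ring
  -- The weight factor cancels all powers of 1 - w and 1 - w̄, leaving w̄^k times a function of ρ
  -- alone.
  have hfront : (1 - w) ^ (-(2 * k : ℤ)) * ((localPoint z₀ w).im : ℂ) ^ (-(2 * k : ℤ)) *
      qf x z' ^ k = (-4 * γ) ^ k * starRingEnd ℂ w ^ k * ((1 - (ρ : ℂ)) ^ (2 * k))⁻¹ := by
    rw [← ypol_conj, ← hz, ← hz', hypol, hq2, zpow_neg, zpow_neg,
      show (2 * k : ℤ) = ((2 * k : ℕ) : ℤ) by push_cast; rfl, zpow_natCast, zpow_natCast,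
      pow_mul, pow_mul, pow_mul, ← inv_pow, ← inv_pow, ← inv_pow, ← mul_pow, ← mul_pow, ← mul_pow,
      ← inv_pow _ k, ← mul_pow]
    congr 1
    field_simp
  have hker : ∀ v ∈ Set.Ioi (1 : ℝ), kerB ℓ k β 0 v x z z' = ∑ j ∈ Finset.range (ℓ + 1),
      (β * ((2 : ℂ) ^ ℓ)⁻¹ * ((hermiteH ℓ).coeff j : ℝ) * (Real.sqrt Real.pi * pf x z z') ^ j *
        (-(1 / (Real.sqrt 2 : ℂ)) * qf x z') ^ k) * ((v : ℂ) ^ t j * Complex.exp (-(A * v))) := by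
    intro v hv
    have hv0 : 0 < v := one_pos.trans hv
    have hexp : Complex.exp (-(Real.pi * v * (qf x z / ypol z z' * (qf x z' / ypol z z')))) =
        Complex.exp (-(A * v)) := by
      rw [← hqq]; ring_nf
    have hvp : (v : ℂ) ^ ((thetaExp ℓ k : ℂ) - 2 - 0) = ((v ^ (thetaExp ℓ k - 2) : ℝ) : ℂ) := by
      rw [Complex.ofReal_cpow hv0.le]
      push_cast
      rw [sub_zero]
    rw [kerB, termB, polyPart, hexp, hvp, Polynomial.aeval_eq_sum_range'
      (Nat.lt_succ_of_le (natDegree_hermiteH_le ℓ)), Finset.mul_sum, Finset.sum_mul, Finset.sum_mul,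
      Finset.mul_sum, Finset.mul_sum]
    refine Finset.sum_congr rfl fun j _ => ?_
    by_cases hj : (hermiteH ℓ).coeff j = 0
    · simp [hj]
    obtain ⟨i, hi⟩ := exists_add_of_coeff_hermiteH_ne_zero ℓ hj
    have hti : t j = (k : ℤ) - 1 - i := by simp only [t]; omega
    have hpow : v ^ (thetaExp ℓ k - 2) * Real.sqrt v ^ j = v ^ t j := by
      rw [Real.sqrt_eq_rpow, ← Real.rpow_natCast, ← Real.rpow_mul hv0.le, ← Real.rpow_add hv0,
        ← Real.rpow_intCast]
      congr 1
      rw [hti, thetaExp, hi]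
      push_cast
      ring
    have hpow' : ((v ^ (thetaExp ℓ k - 2) : ℝ) : ℂ) * (Real.sqrt v : ℂ) ^ j = (v : ℂ) ^ t j := by
      exact_mod_cast congrArg (fun r : ℝ => (r : ℂ)) hpow
    rw [Real.sqrt_mul Real.pi_pos.le, Complex.ofReal_mul, Complex.real_smul, ← hpow']
    ring
  rw [setIntegral_congr_fun measurableSet_Ioi hker, integral_finsetSum _ fun j _ =>
    (integrableOn_zpow_mul_exp (t j) hA0).const_mul _]
  simp only [integral_const_mul]
  rw [Finset.mul_sum, Finset.mul_sum]
  refine Finset.sum_congr rfl fun j _ => ?_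
  simp only [E, co, gammaInt]
  rw [hpf, ← mul_assoc (Real.sqrt Real.pi : ℂ), mul_pow _ ((1 + ρ : ℂ) / (1 - ρ)),
    mul_pow (-(1 / (Real.sqrt 2 : ℂ))) (qf x z') k]
  linear_combination (β * ((2 : ℂ) ^ ℓ)⁻¹ * ((hermiteH ℓ).coeff j : ℝ) *
    (Real.sqrt Real.pi * (2 * γ * y)) ^ j * ((1 + (ρ : ℂ)) / (1 - ρ)) ^ j *
      (-(1 / (Real.sqrt 2 : ℂ))) ^ k *
        ∫ v in Set.Ioi (1 : ℝ), (v : ℂ) ^ t j * Complex.exp (-(A * v))) * hfront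

theorem im_localPoint_ne_zero {z₀ w : ℂ} (hz₀ : z₀.im ≠ 0) (hw : ‖w‖ < 1) :
    (localPoint z₀ w).im ≠ 0 := by
  have hwne : w ≠ 1 := by rintro rfl; simp at hw
  have h1 : 1 - w ≠ 0 := sub_ne_zero.2 hwne.symm
  have h2 : 1 - starRingEnd ℂ w ≠ 0 := by
    rw [← map_one (starRingEnd ℂ), ← map_sub]
    exact (map_ne_zero _).2 h1
  have h3 : 1 - w * starRingEnd ℂ w ≠ 0 := by
    rw [Complex.mul_conj, Complex.normSq_eq_norm_sq]
    have : ‖w‖ ^ 2 < 1 := pow_lt_one₀ (norm_nonneg _) hw two_ne_zero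
    exact_mod_cast (sub_pos.2 this).ne'
  have h4 : (z₀.im : ℂ) ≠ 0 := by exact_mod_cast hz₀
  have := ypol_localPoint (z₀ := z₀) hwne
  rw [ypol_conj] at this
  have h5 : ((localPoint z₀ w).im : ℂ) ≠ 0 := by
    rw [this]
    exact div_ne_zero (mul_ne_zero h4 h3) (mul_ne_zero h1 h2)
  exact_mod_cast h5

/-! ### Logarithmic Laurent expansions -/

/-- `g` has a logarithmic Laurent expansion with constant term `c`, without logarithms under the
condition `P`. -/
def HasExpansion (P : Prop) (g : ℂ → ℂ) (c : ℂ) : Prop :=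
  ∃ a b : ℤ × ℤ → ℂ, HasLogLaurentExpansion g a b ∧ (P → b = 0) ∧ a (0, 0) = c

theorem hasSum_extend_mul {κ ι : Type*} {φ : κ → ι} (hφ : φ.Injective) {α : κ → ℂ} {M : ι → ℂ}
    {s : ℂ} (h : HasSum (fun i => α i * M (φ i)) s) :
    HasSum (fun p => Function.extend φ α 0 p * M p) s := by
  rw [← hφ.hasSum_iff]
  · refine h.congr_fun fun i => ?_
    simp [hφ.extend_apply]
  · intro p hp
    rw [Function.extend_apply' _ _ _ (by simpa using hp)]
    simp

theorem exists_hasSum_of_analyticAt {f : ℂ → ℂ} (hf : AnalyticAt ℂ f 0) :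
    ∃ α : ℕ → ℂ, ∀ᶠ z in 𝓝 (0 : ℂ), HasSum (fun n => α n * z ^ n) (f z) := by
  obtain ⟨p, hp⟩ := hf
  refine ⟨p.coeff, ?_⟩
  filter_upwards [hasFPowerSeriesAt_iff.1 hp] with z hz
  simpa [mul_comm] using hz

namespace HasExpansion

variable {P : Prop} {g g' : ℂ → ℂ} {c c' : ℂ}

theorem zero : HasExpansion P (fun _ => 0) 0 :=
  ⟨0, 0, ⟨⟨0, fun _ _ => ⟨rfl, rfl⟩⟩, 1, one_pos, fun w _ _ => by
    simp⟩, fun _ => rfl, rfl⟩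

theorem add (h : HasExpansion P g c) (h' : HasExpansion P g' c') :
    HasExpansion P (fun w => g w + g' w) (c + c') := by
  obtain ⟨a, b, ⟨⟨N, hN⟩, r, hr, hs⟩, hb, hc⟩ := h
  obtain ⟨a', b', ⟨⟨N', hN'⟩, r', hr', hs'⟩, hb', hc'⟩ := h'
  refine ⟨a + a', b + b', ⟨⟨min N N', fun p hp => ?_⟩, min r r', lt_min hr hr', fun w h0 h1 => ?_⟩,
    fun hP => by rw [hb hP, hb' hP, add_zero], by rw [Pi.add_apply, hc, hc']⟩
  · have h1 := hN p (hp.imp (fun h => h.trans_le (min_le_left _ _))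
      fun h => h.trans_le (min_le_left _ _))
    have h2 := hN' p (hp.imp (fun h => h.trans_le (min_le_right _ _))
      fun h => h.trans_le (min_le_right _ _))
    simp [h1.1, h1.2, h2.1, h2.2]
  · refine ((hs w h0 (h1.trans_le (min_le_left _ _))).add
      (hs' w h0 (h1.trans_le (min_le_right _ _)))).congr_fun fun p => ?_
    simp only [Pi.add_apply]
    ring

theorem sum {κ : Type*} (s : Finset κ) {g : κ → ℂ → ℂ} {c : κ → ℂ}
    (h : ∀ j ∈ s, HasExpansion P (g j) (c j)) :
    HasExpansion P (fun w => ∑ j ∈ s, g j w) (∑ j ∈ s, c j) := by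
  classical
  induction s using Finset.induction_on with
  | empty => simpa using zero
  | insert j s hj ih =>
    simp only [Finset.sum_insert hj]
    exact (h j (Finset.mem_insert_self _ _)).add
      (ih fun i hi => h i (Finset.mem_insert_of_mem hi))

theorem congr (h : HasExpansion P g c) {R : ℝ} (hR : 0 < R)
    (hg : ∀ w, 0 < ‖w‖ → ‖w‖ < R → g' w = g w) : HasExpansion P g' c := by
  obtain ⟨a, b, ⟨hN, r, hr, hs⟩, hb, hc⟩ := h
  refine ⟨a, b, ⟨hN, min r R, lt_min hr hR, fun w h0 h1 => ?_⟩, hb, hc⟩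
  rw [hg w h0 (h1.trans_le (min_le_right _ _))]
  exact hs w h0 (h1.trans_le (min_le_left _ _))

theorem of_hasSum_nat {a : ℕ × ℕ → ℂ} {R : ℝ} (hR : 0 < R)
    (h : ∀ w, ‖w‖ < R → HasSum (fun p : ℕ × ℕ => a p * (w ^ p.1 * starRingEnd ℂ w ^ p.2)) (g w)) :
    HasExpansion P g (a (0, 0)) := by
  let φ : ℕ × ℕ → ℤ × ℤ := fun p => (p.1, p.2)
  have hφ : φ.Injective := fun p p' h => by
    simp only [φ, Prod.mk.injEq, Nat.cast_inj] at h
    exact Prod.ext h.1 h.2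
  refine ⟨Function.extend φ a 0, 0, ⟨⟨0, fun p hp => ⟨?_, rfl⟩⟩, R, hR, fun w _ hw => ?_⟩,
    fun _ => rfl, hφ.extend_apply a 0 (0, 0)⟩
  · refine Function.extend_apply' _ _ _ ?_
    rintro ⟨p', rfl⟩
    simp only [φ] at hp
    omega
  · have := hasSum_extend_mul hφ (M := fun p => w ^ p.1 * starRingEnd ℂ w ^ p.2) (s := g w)
      (α := a) (by simpa [φ] using h w hw)
    simpa using this

/-- Substituting ρ = w w̄ gives w̄^k ρ^(n-k) = w^(n-k) w̄^n and w̄^k ρ^n = w^n w̄^(n+k). For k ≥ 1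
the first family never meets the index (0, 0), so the constant term is zero. -/
theorem of_isLogMeromorphic {k : ℕ} (hk : 1 ≤ k) {S : ℝ → ℂ} (hS : IsLogMeromorphic k P S)
    {R : ℝ} (hR : 0 < R) (h : ∀ w, 0 < ‖w‖ → ‖w‖ < R → g w = starRingEnd ℂ w ^ k * S (‖w‖ ^ 2)) :
    HasExpansion P g 0 := by
  obtain ⟨A, D, hA, hD, hb, hSρ⟩ := hS
  obtain ⟨α, hα⟩ := exists_hasSum_of_analyticAt hA
  -- Under P the zero coefficients are selected explicitly, so that the logarithmic coefficients are
  -- literally zero.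
  have hD' : ∃ δ : ℕ → ℂ, (∀ᶠ z in 𝓝 (0 : ℂ), HasSum (fun n => δ n * z ^ n) (D z)) ∧
      (P → δ = 0) := by
    by_cases hP : P
    · refine ⟨0, Eventually.of_forall fun z => ?_, fun _ => rfl⟩
      simp [hb hP]
    · obtain ⟨δ, hδ⟩ := exists_hasSum_of_analyticAt hD
      exact ⟨δ, hδ, fun h => absurd h hP⟩
  obtain ⟨δ, hδ, hδP⟩ := hD'
  let φ : ℕ → ℤ × ℤ := fun n => (n - k, n)
  let ψ : ℕ → ℤ × ℤ := fun n => (n, n + k)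
  have hφ : φ.Injective := fun n n' h => by
    simp only [φ, Prod.mk.injEq, Nat.cast_inj] at h
    exact h.2
  have hψ : ψ.Injective := fun n n' h => by
    simp only [ψ, Prod.mk.injEq, Nat.cast_inj] at h
    exact h.1
  have hsq : Tendsto (fun t : ℝ => t ^ 2) (𝓝[>] 0) (𝓝[>] 0) := by
    refine tendsto_nhdsWithin_iff.2 ⟨?_, ?_⟩
    · have : ContinuousAt (fun t : ℝ => t ^ 2) 0 := by fun_prop
      simpa using this.tendsto.mono_left nhdsWithin_le_nhds
    · filter_upwards [self_mem_nhdsWithin] with t ht using pow_pos (Set.mem_Ioi.1 ht) 2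
  have hcast : Tendsto (fun t : ℝ => (t : ℂ)) (𝓝[>] 0) (𝓝 0) := by
    have : ContinuousAt (fun t : ℝ => (t : ℂ)) 0 := by fun_prop
    simpa using this.tendsto.mono_left nhdsWithin_le_nhds
  obtain ⟨r, hr, hev⟩ := (mem_nhdsGT_iff_exists_Ioo_subset).1
    (hsq.eventually (hSρ.and (hcast.eventually (hα.and hδ))))
  refine ⟨Function.extend φ α 0, Function.extend ψ δ 0, ⟨⟨-k, fun p hp => ⟨?_, ?_⟩⟩, min r R,
    lt_min hr hR, fun w h0 h1 => ?_⟩, fun hP => ?_, ?_⟩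
  · refine Function.extend_apply' _ _ _ ?_
    rintro ⟨n, rfl⟩
    simp only [φ] at hp
    omega
  · refine Function.extend_apply' _ _ _ ?_
    rintro ⟨n, rfl⟩
    simp only [ψ] at hp
    omega
  · obtain ⟨hS1, hα1, hδ1⟩ := hev ⟨h0, h1.trans_le (min_le_left _ _)⟩
    have hw : w ≠ 0 := norm_pos_iff.1 h0
    have hcw : starRingEnd ℂ w ≠ 0 := (map_ne_zero _).2 hw
    have hρ : ((‖w‖ ^ 2 : ℝ) : ℂ) = w * starRingEnd ℂ w := by
      rw [Complex.mul_conj, Complex.normSq_eq_norm_sq]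
    have e1 := hasSum_extend_mul hφ (M := fun p => w ^ p.1 * starRingEnd ℂ w ^ p.2)
      (s := starRingEnd ℂ w ^ k * ((((‖w‖ ^ 2 : ℝ) : ℂ)) ^ (-(k : ℤ)) * A ((‖w‖ ^ 2 : ℝ) : ℂ)))
      (α := α) (by
        rw [← mul_assoc]
        refine (hα1.mul_left _).congr_fun fun n => ?_
        simp only [φ]
        rw [hρ, zpow_sub₀ hw, mul_zpow, mul_pow, zpow_neg, zpow_neg, zpow_natCast, zpow_natCast,
          zpow_natCast, zpow_natCast]
        field_simp)
    have e2 := hasSum_extend_mul hψ (M := fun p => w ^ p.1 * starRingEnd ℂ w ^ p.2)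
      (s := starRingEnd ℂ w ^ k * D ((‖w‖ ^ 2 : ℝ) : ℂ))
      (α := δ) (by
        refine (hδ1.mul_left _).congr_fun fun n => ?_
        simp only [ψ]
        rw [hρ, zpow_add₀ hcw, mul_pow, zpow_natCast, zpow_natCast, zpow_natCast]
        ring)
    rw [h w h0 (h1.trans_le (min_le_right _ _)), hS1, mul_add, ← mul_assoc _ (D _)]
    refine (e1.add (e2.mul_right (Real.log (‖w‖ ^ 2) : ℂ))).congr_fun fun p => ?_
    ring
  · rw [hδP hP]
    funext p
    by_cases hp : ∃ n, ψ n = p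
    · obtain ⟨n, rfl⟩ := hp
      rw [hψ.extend_apply]
      rfl
    · rw [Function.extend_apply' _ _ _ hp]
  · refine Function.extend_apply' _ _ _ ?_
    rintro ⟨n, hn⟩
    simp only [φ, Prod.mk.injEq] at hn
    omega

end HasExpansion

theorem IsFourierFamily.hasExpansion {ι : Type*} {x : ι → Fin 3 → ℝ} {f : ℍ → ℂ} {c : ℤ → ℂ}
    {q : ℝ} {m : ι → ℤ} {r : ℕ} (h : IsFourierFamily x f c q m r) (ℓ : ℕ) {k : ℕ} (hk : 1 ≤ k)
    {z₀ : ℂ} (hz₀ : z₀.im ≠ 0) :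
    HasExpansion (ℓ < 2 * k) (fun w => (1 - w) ^ (-(2 * k : ℤ)) *
      familyLift ℓ k f (fun i => c (m i)) x (localPoint z₀ w))
      (familyLift ℓ k f (fun i => c (m i)) x z₀) := by
  obtain ⟨J, hJ, R, hR, a, ha0, ha⟩ := h.exists_regular_expansion ℓ hk hz₀
  have h1 := HasExpansion.of_hasSum_nat (P := ℓ < 2 * k) hR fun w hw => (ha w hw).2
  have h2 := HasExpansion.sum (P := ℓ < 2 * k) J (c := fun _ => 0) fun i hi => by
    obtain ⟨S, hS, hSw⟩ := exists_singular_term ℓ hk (c (m i)) hz₀ (hJ i hi)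
    exact HasExpansion.of_isLogMeromorphic hk hS one_pos hSw
  have h3 := h1.add h2
  rw [Finset.sum_const_zero, add_zero, ha0] at h3
  exact h3.congr one_pos fun w _ _ => (sub_add_cancel _ _).symm

/-! ### Integral adeles -/

theorem IsIntegralAdele.add {a b : Af} (ha : IsIntegralAdele a) (hb : IsIntegralAdele b) :
    IsIntegralAdele (a + b) := fun p => add_mem (ha p) (hb p)

theorem IsIntegralAdele.neg {a : Af} (ha : IsIntegralAdele a) : IsIntegralAdele (-a) :=
  fun p => neg_mem (ha p)

theorem IsIntegralAdele.mul {a b : Af} (ha : IsIntegralAdele a) (hb : IsIntegralAdele b) :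
    IsIntegralAdele (a * b) := fun p => mul_mem (ha p) (hb p)

theorem isIntegralAdele_zero : IsIntegralAdele 0 := fun _ => zero_mem _

theorem isIntegralAdele_one : IsIntegralAdele 1 := fun _ => one_mem _

theorem isIntegralAdele_intCast (n : ℤ) : IsIntegralAdele (n : Af) := by
  induction n using Int.induction_on with
  | zero => simpa using isIntegralAdele_zero
  | succ n ih => push_cast at ih ⊢; exact ih.add isIntegralAdele_one
  | pred n ih =>
    rw [Int.cast_sub, sub_eq_add_neg, Int.cast_one]
    exact ih.add isIntegralAdele_one.neg

/-- A rational number that is integral at every prime is an integer. This is the descent from adelic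
to rational integrality used below. -/
theorem exists_int_of_isIntegralAdele {r : ℚ} (h : IsIntegralAdele (algebraMap ℚ Af r)) :
    ∃ n : ℤ, r = n := by
  obtain ⟨n, hn⟩ := IsDedekindDomain.HeightOneSpectrum.mem_integers_of_valuation_le_one (R := ℤ) ℚ r
    (fun v => by
      have := h v
      rw [IsDedekindDomain.FiniteAdeleRing.algebraMap_apply,
        IsDedekindDomain.HeightOneSpectrum.mem_adicCompletionIntegers,
        IsDedekindDomain.HeightOneSpectrum.valuedAdicCompletion_eq_valuation'] at this
      exact this)
  exact ⟨n, by simpa using hn.symm⟩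

theorem exists_int_mul_mem (p : IsDedekindDomain.HeightOneSpectrum ℤ) (a : p.adicCompletion ℚ) :
    ∃ n : ℤ, n ≠ 0 ∧ (n : p.adicCompletion ℚ) * a ∈ p.adicCompletionIntegers ℚ := by
  obtain ⟨n, hn, h⟩ :=
    IsDedekindDomain.HeightOneSpectrum.adicCompletion.mul_nonZeroDivisor_mem_adicCompletionIntegers
      p a
  refine ⟨n, nonZeroDivisors.ne_zero hn, ?_⟩
  rw [mul_comm]
  simpa using h

theorem exists_int_mul_isIntegralAdele (a : Af) : ∃ n : ℤ, n ≠ 0 ∧ IsIntegralAdele (n * a) := by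
  classical
  have hfin : {p | a p ∉ p.adicCompletionIntegers ℚ}.Finite := a.2
  choose n hn0 hn using fun p => exists_int_mul_mem p (a p)
  refine ⟨∏ p ∈ hfin.toFinset, n p, Finset.prod_ne_zero_iff.2 fun p _ => hn0 p, fun p => ?_⟩
  have hmul : (((∏ p ∈ hfin.toFinset, n p : ℤ) : Af) * a) p =
      ((∏ p ∈ hfin.toFinset, n p : ℤ) : p.adicCompletion ℚ) * a p := rfl
  rw [hmul]
  by_cases hp : a p ∈ p.adicCompletionIntegers ℚ
  · exact mul_mem (intCast_mem _ _) hp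
  · have hp' : p ∈ hfin.toFinset := by simpa using hp
    rw [← Finset.mul_prod_erase _ _ hp', Int.cast_mul, mul_comm (n p : p.adicCompletion ℚ),
      mul_assoc]
    exact mul_mem (intCast_mem _ _) (hn p)

theorem exists_common_denominator {κ : Type*} (s : Finset κ) (a : κ → Af) :
    ∃ n : ℤ, n ≠ 0 ∧ ∀ i ∈ s, IsIntegralAdele (n * a i) := by
  classical
  choose n hn0 hn using fun i => exists_int_mul_isIntegralAdele (a i)
  refine ⟨∏ i ∈ s, n i, Finset.prod_ne_zero_iff.2 fun i _ => hn0 i, fun i hi => ?_⟩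
  rw [← Finset.mul_prod_erase _ _ hi, Int.cast_mul, mul_comm (n i : Af), mul_assoc]
  exact (isIntegralAdele_intCast _).mul (hn i)

/-! ### The action on the quadratic space -/

noncomputable instance : Invertible (2 : Af) :=
  ⟨algebraMap ℚ Af 2⁻¹, by
    rw [← map_ofNat (algebraMap ℚ Af), ← map_mul]; norm_num, by
    rw [← map_ofNat (algebraMap ℚ Af), ← map_mul]; norm_num⟩

/-- With 2 invertible, the Clifford algebra is linearly isomorphic to the exterior algebra, in which
scalars visibly embed. -/
theorem algebraMap_cliffordAlgebra_injective {R M : Type*} [CommRing R] [AddCommGroup M]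
    [Module R M] [Invertible (2 : R)] (q : QuadraticForm R M) :
    Function.Injective (algebraMap R (CliffordAlgebra q)) := by
  intro r s h
  have := congrArg (CliffordAlgebra.equivExterior q) h
  simp only [CliffordAlgebra.equivExterior, CliffordAlgebra.changeFormEquiv_apply,
    CliffordAlgebra.changeForm_algebraMap] at this
  exact (ExteriorAlgebra.algebraMap_inj M r s).1 this

theorem ι_cliffordAlgebra_injective {R M : Type*} [CommRing R] [AddCommGroup M]
    [Module R M] [Invertible (2 : R)] (q : QuadraticForm R M) :
    Function.Injective (CliffordAlgebra.ι q) := by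
  intro r s h
  have := congrArg (CliffordAlgebra.equivExterior q) h
  simp only [CliffordAlgebra.equivExterior, CliffordAlgebra.changeFormEquiv_apply,
    CliffordAlgebra.changeForm_ι] at this
  exact ExteriorAlgebra.ι_leftInverse.injective this

/-- Conjugation fixes the scalar obtained by squaring a vector, so it acts by isometries. -/
theorem eq_of_conj_ι {R M : Type*} [CommRing R] [AddCommGroup M]
    [Module R M] [Invertible (2 : R)] {q : QuadraticForm R M} (g : (CliffordAlgebra q)ˣ) {v w : M}
    (h : CliffordAlgebra.ι q v = g.val * CliffordAlgebra.ι q w * (g⁻¹).val) : q v = q w := by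
  apply algebraMap_cliffordAlgebra_injective q
  rw [← CliffordAlgebra.ι_sq_scalar, ← CliffordAlgebra.ι_sq_scalar q w, h]
  have : g.val * CliffordAlgebra.ι q w * (g⁻¹).val * (g.val * CliffordAlgebra.ι q w * (g⁻¹).val) =
      g.val * (CliffordAlgebra.ι q w * CliffordAlgebra.ι q w) * (g⁻¹).val := by
    simp only [mul_assoc, Units.inv_mul_cancel_left]
  rw [this, CliffordAlgebra.ι_sq_scalar, ← Algebra.commutes, mul_assoc, Units.mul_inv, mul_one]

section

variable {V : Type*} [AddCommGroup V] [Module ℚ V] {Q : QuadraticForm ℚ V} {L : Submodule ℤ V}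

theorem polar_baseChange_tmul {A : Type*} [CommRing A] [Algebra ℚ A] [Invertible (2 : A)]
    (Q : QuadraticForm ℚ V) (a b : A) (v w : V) :
    QuadraticMap.polar (Q.baseChange A) (a ⊗ₜ v) (b ⊗ₜ w) =
      algebraMap ℚ A (QuadraticMap.polar Q v w) * (a * b) := by
  have h := congrArg (fun B => B (a ⊗ₜ[ℚ] v) (b ⊗ₜ[ℚ] w))
    (QuadraticForm.polarBilin_baseChange (A := A) Q)
  simp only [QuadraticMap.polarBilin_apply_apply] at h
  rw [h, LinearMap.BilinForm.baseChange_tmul, QuadraticMap.polarBilin_apply_apply, Algebra.smul_def]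

theorem isIntegralAdele_polar_of_mem {x : V}
    (hx : ∀ y ∈ L, ∃ n : ℤ, QuadraticMap.polar Q x y = n) {b : Af} (hb : IsIntegralAdele b)
    {t : Af ⊗[ℚ] V} (ht : t ∈ latticeHat L) :
    IsIntegralAdele (QuadraticMap.polar (Q.baseChange Af) (b ⊗ₜ x) t) := by
  induction ht using AddSubgroup.closure_induction with
  | mem t ht =>
    obtain ⟨a, ha, y, hy, rfl⟩ := ht
    obtain ⟨n, hn⟩ := hx y hy
    rw [polar_baseChange_tmul, hn]
    simpa using (isIntegralAdele_intCast n).mul (hb.mul ha)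
  | zero => simpa [QuadraticMap.polar] using isIntegralAdele_zero
  | add t t' _ _ h h' => rw [QuadraticMap.polar_add_right]; exact h.add h'
  | neg t _ h => rw [QuadraticMap.polar_neg_right]; exact h.neg

theorem IsEvenLattice.polar_eq_intCast (hL : IsEvenLattice Q L) {x y : V} (hx : x ∈ L)
    (hy : y ∈ L) : ∃ n : ℤ, QuadraticMap.polar Q x y = n := by
  obtain ⟨a, ha⟩ := hL.integral _ (add_mem hx hy)
  obtain ⟨b, hb⟩ := hL.integral _ hx
  obtain ⟨c, hc⟩ := hL.integral _ hy
  exact ⟨a - b - c, by rw [QuadraticMap.polar, ha, hb, hc]; push_cast; ring⟩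

theorem IsEvenLattice.isIntegralAdele_of_mem (hL : IsEvenLattice Q L) {t : Af ⊗[ℚ] V}
    (ht : t ∈ latticeHat L) : IsIntegralAdele (Q.baseChange Af t) := by
  induction ht using AddSubgroup.closure_induction with
  | mem t ht =>
    obtain ⟨a, ha, y, hy, rfl⟩ := ht
    obtain ⟨n, hn⟩ := hL.integral y hy
    rw [QuadraticForm.baseChange_tmul, hn, Algebra.smul_def]
    simpa using (isIntegralAdele_intCast n).mul (ha.mul ha)
  | zero => simpa using isIntegralAdele_zero
  | add t t' ht ht' h h' =>
    rw [QuadraticMap.map_add (Q.baseChange Af)]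
    refine (h.add h').add ?_
    clear h h'
    induction ht using AddSubgroup.closure_induction with
    | mem t ht =>
      obtain ⟨a, ha, y, hy, rfl⟩ := ht
      exact isIntegralAdele_polar_of_mem (fun z hz => hL.polar_eq_intCast hy hz) ha ht'
    | zero => simpa [QuadraticMap.polar] using isIntegralAdele_zero
    | add s s' _ _ h h' => rw [QuadraticMap.polar_add_left]; exact h.add h'
    | neg s _ h => rw [QuadraticMap.polar_neg_left]; exact h.neg
  | neg t _ h => rwa [QuadraticMap.map_neg]

/-- Since h is an isometry, Q(λ) = Q(x' + t) with t in the completed lattice. The differences Q(t)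
and (x', t) are integral adeles, while Q(λ) - Q(x') is rational, hence an integer. Passing from x'
to another representative x changes Q by an integer as well. -/
theorem exists_int_sub_of_mem_cosetH (hL : IsEvenLattice Q L) (h : GSpin (Q.baseChange Af))
    (x : dualLattice Q L) {lam : V} (hlam : lam ∈ cosetH Q L h (Submodule.Quotient.mk x)) :
    ∃ n : ℤ, Q lam = Q (x : V) - n := by
  obtain ⟨x', hx', t, ht, heq⟩ := hlam
  have hdual : ∀ x : dualLattice Q L, ∀ y ∈ L, ∃ n : ℤ, QuadraticMap.polar Q (x : V) y = n := by
    intro x y hy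
    obtain ⟨n, hn⟩ := Submodule.mem_one.1 (x.2 y hy)
    exact ⟨n, by simpa using hn.symm⟩
  have h1 : ∃ n : ℤ, Q lam - Q (x' : V) = n := by
    apply exists_int_of_isIntegralAdele
    have e := eq_of_conj_ι _ heq
    rw [QuadraticMap.map_add (Q.baseChange Af), QuadraticForm.baseChange_tmul,
      QuadraticForm.baseChange_tmul,
      mul_one, Algebra.smul_def, Algebra.smul_def, mul_one, mul_one] at e
    rw [map_sub, e]
    have := (hL.isIntegralAdele_of_mem ht).add
      (isIntegralAdele_polar_of_mem (hdual x') isIntegralAdele_one ht)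
    convert this using 1
    ring
  have h2 : ∃ n : ℤ, Q (x' : V) - Q (x : V) = n := by
    have hd : (x' : V) - x ∈ L := by
      have := (Submodule.Quotient.eq _).1 hx'
      exact this
    obtain ⟨a, ha⟩ := hL.integral _ hd
    obtain ⟨b, hb⟩ := hdual x _ hd
    refine ⟨a + b, ?_⟩
    have e : (x' : V) = x + (x' - x) := by abel
    rw [e, QuadraticMap.map_add Q, ha, hb]
    push_cast
    ring
  obtain ⟨a, ha⟩ := h1
  obtain ⟨b, hb⟩ := h2
  exact ⟨-a - b, by push_cast; linear_combination ha + hb⟩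

end

/-! ### Real coordinates -/

/-- The coordinates of trace zero matrices. -/
noncomputable def coordEquiv : M20 ≃ₗ[ℝ] (Fin 3 → ℝ) where
  toFun M := ![(M : Matrix (Fin 2) (Fin 2) ℝ) 0 0, (M : Matrix (Fin 2) (Fin 2) ℝ) 0 1,
    (M : Matrix (Fin 2) (Fin 2) ℝ) 1 0]
  invFun x := ⟨vecMat x, by simp [vecMat, Matrix.trace_fin_two]⟩
  map_add' M N := by ext i; fin_cases i <;> simp
  map_smul' a M := by ext i; fin_cases i <;> simp
  left_inv M := by
    have h : (M : Matrix (Fin 2) (Fin 2) ℝ) 0 0 + (M : Matrix (Fin 2) (Fin 2) ℝ) 1 1 = 0 := by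
      have := LinearMap.mem_ker.1 M.2
      rwa [Matrix.traceLinearMap_apply, Matrix.trace_fin_two] at this
    ext i j
    fin_cases i <;> fin_cases j <;> simp [vecMat]
    linarith
  right_inv x := by ext i; fin_cases i <;> simp [vecMat]

theorem vecMat_coordEquiv (M : M20) : vecMat (coordEquiv M) = M :=
  congrArg Subtype.val (coordEquiv.symm_apply_apply M)

section

variable {V : Type*} [AddCommGroup V] [Module ℚ V] {Q : QuadraticForm ℚ V} {L : Submodule ℤ V}
  (σ : (Q.baseChange ℝ).IsometryEquiv detForm)

/-- The real coordinates of a rational vector. -/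
noncomputable def realCoord (v : V) : Fin 3 → ℝ := coordEquiv (σ ((1 : ℝ) ⊗ₜ[ℚ] v))

theorem vecMat_realCoord (v : V) :
    vecMat (realCoord σ v) = ((σ ((1 : ℝ) ⊗ₜ[ℚ] v) : M20) : Matrix (Fin 2) (Fin 2) ℝ) :=
  vecMat_coordEquiv _

theorem detV_realCoord (v : V) : detV (realCoord σ v) = Q v := by
  rw [← det_vecMat, vecMat_realCoord]
  have h := σ.map_app ((1 : ℝ) ⊗ₜ[ℚ] v)
  rw [QuadraticForm.baseChange_tmul, mul_one, Rat.smul_one_eq_cast] at h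
  exact h

/-- A rational basis gives a real basis. -/
noncomputable def realBasis {κ : Type*} (b : Module.Basis κ ℚ V) :
    Module.Basis κ ℝ (Fin 3 → ℝ) :=
  (Algebra.TensorProduct.basis ℝ b).map (σ.toLinearEquiv.trans coordEquiv)

theorem realBasis_repr {κ : Type*} (b : Module.Basis κ ℚ V) (v : V) (i : κ) :
    (realBasis σ b).repr (realCoord σ v) i = b.repr v i := by
  have : (realBasis σ b).repr (realCoord σ v) =
      (Algebra.TensorProduct.basis ℝ b).repr ((1 : ℝ) ⊗ₜ[ℚ] v) := by
    rw [realBasis, Module.Basis.map_repr]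
    rw [LinearEquiv.trans_apply, realCoord]
    simp
  rw [this, Algebra.TensorProduct.basis_repr_tmul]
  simp

theorem realCoord_injective : Function.Injective (realCoord σ) := by
  intro v w h
  let b := Module.Basis.ofVectorSpace ℚ V
  refine b.repr.injective (Finsupp.ext fun i => ?_)
  have := congrArg (fun x => (realBasis σ b).repr x i) h
  simp only [realBasis_repr] at this
  exact_mod_cast this

theorem polar_detForm (M N : M20) : QuadraticMap.polar detForm M N =
    -2 * coordEquiv M 0 * coordEquiv N 0 - coordEquiv M 1 * coordEquiv N 2 -
      coordEquiv M 2 * coordEquiv N 1 := by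
  have h : ∀ M : M20, detForm M = detV (coordEquiv M) := fun M => by
    rw [← det_vecMat, vecMat_coordEquiv]
    rfl
  simp only [QuadraticMap.polar, h, detV, map_add, Pi.add_apply]
  ring

/-- A rational vector orthogonal to everything remains so after extension to ℝ, where the
determinant form is nondegenerate in coordinates. -/
theorem nondegenerate_polarBilin (σ : (Q.baseChange ℝ).IsometryEquiv detForm) :
    LinearMap.BilinForm.Nondegenerate (QuadraticMap.polarBilin Q) := by
  have key : ∀ x, (∀ y, QuadraticMap.polar Q x y = 0) → x = 0 := by
    intro x hx
    have h1 : ∀ s, QuadraticMap.polar (Q.baseChange ℝ) ((1 : ℝ) ⊗ₜ x) s = 0 := by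
      intro s
      induction s using TensorProduct.induction_on with
      | zero => simp [QuadraticMap.polar]
      | tmul a y => rw [polar_baseChange_tmul, hx y]; simp
      | add s t hs ht => rw [QuadraticMap.polar_add_right, hs, ht, add_zero]
    have h2 : ∀ N : M20, QuadraticMap.polar detForm (σ ((1 : ℝ) ⊗ₜ x)) N = 0 := by
      intro N
      have := h1 (σ.symm N)
      rw [QuadraticMap.polar, ← σ.map_app, ← σ.map_app ((1 : ℝ) ⊗ₜ x), ← σ.map_app (σ.symm N),
        map_add] at this
      simpa [QuadraticMap.polar] using this
    apply realCoord_injective σ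
    have h3 : ∀ y : Fin 3 → ℝ, -2 * realCoord σ x 0 * y 0 - realCoord σ x 1 * y 2 -
        realCoord σ x 2 * y 1 = 0 := by
      intro y
      have := h2 (coordEquiv.symm y)
      rwa [polar_detForm, LinearEquiv.apply_symm_apply] at this
    have h0 : realCoord σ 0 = 0 := by simp [realCoord]
    rw [h0]
    have e0 := h3 ![1, 0, 0]
    have e1 := h3 ![0, 0, 1]
    have e2 := h3 ![0, 1, 0]
    simp at e0 e1 e2
    ext i
    fin_cases i <;> simp [e0, e1, e2]
  refine ⟨fun x hx => key x fun y => by simpa using hx y, fun x hx => key x fun y => ?_⟩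
  rw [QuadraticMap.polar_comm]
  simpa using hx y

end

/-! ### Finiteness of the discriminant group -/

section

variable {V : Type*} [AddCommGroup V] [Module ℚ V] {Q : QuadraticForm ℚ V} {L : Submodule ℤ V}

theorem exists_int_smul_mem (hL : Submodule.span ℚ (L : Set V) = ⊤) (x : V) :
    ∃ n : ℤ, n ≠ 0 ∧ n • x ∈ L := by
  have hx : x ∈ Submodule.span ℚ (L : Set V) := hL ▸ Submodule.mem_top
  induction hx using Submodule.span_induction with
  | mem x hx => exact ⟨1, one_ne_zero, by simpa using hx⟩
  | zero => exact ⟨1, one_ne_zero, by simp⟩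
  | add x y _ _ hx hy =>
    obtain ⟨n, hn, h⟩ := hx
    obtain ⟨m, hm, h'⟩ := hy
    refine ⟨n * m, mul_ne_zero hn hm, ?_⟩
    rw [smul_add, mul_comm n m, mul_smul, mul_comm m n, mul_smul]
    exact add_mem (L.smul_mem m h) (L.smul_mem n h')
  | smul a x _ hx =>
    obtain ⟨n, hn, h⟩ := hx
    refine ⟨n * a.den, mul_ne_zero hn (by exact_mod_cast a.den_ne_zero), ?_⟩
    have : (n * a.den : ℤ) • (a • x) = a.num • (n • x) := by
      rw [← Int.cast_smul_eq_zsmul ℚ, ← Int.cast_smul_eq_zsmul ℚ, ← Int.cast_smul_eq_zsmul ℚ,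
        smul_smul, smul_smul]
      congr 1
      push_cast
      rw [mul_assoc, Rat.den_mul_eq_num, mul_comm]
    rw [this]
    exact L.smul_mem _ h

/-- The dual lattice lies in the span of a basis dual to one contained in L, so it is finitely
generated; every element has a nonzero integer multiple in L, and a finitely generated torsion group
is finite. -/
theorem finite_disc [FiniteDimensional ℚ V] (σ : (Q.baseChange ℝ).IsometryEquiv detForm)
    (hL : IsEvenLattice Q L) : Finite (Disc Q L) := by
  classical
  have hB := nondegenerate_polarBilin σ
  let b := Module.Basis.ofSpan hL.span_eq_top.ge
  have hbfin : Finite ↥(LinearIndepOn.extend (linearIndepOn_empty ℚ id)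
      (Set.empty_subset (L : Set V))) := Module.Finite.finite_basis b
  have hbL : Submodule.span ℤ (Set.range b) ≤ L :=
    Submodule.span_le.2 (Module.Basis.ofSpan_subset hL.span_eq_top.ge)
  have hle : dualLattice Q L ≤ Submodule.span ℤ (Set.range
      (LinearMap.BilinForm.dualBasis (QuadraticMap.polarBilin Q) hB b)) := by
    rw [← LinearMap.BilinForm.dualSubmodule_span_of_basis (R := ℤ)]
    exact fun x hx y hy => hx y (hbL hy)
  have hfg : (dualLattice Q L).FG :=
    Submodule.FG.of_le (Submodule.fg_span (Set.finite_range _)) hle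
  have : Module.Finite ℤ (dualLattice Q L) := Module.Finite.iff_fg.2 hfg
  refine Module.finite_of_fg_torsion _ fun y => ?_
  induction y using Submodule.Quotient.induction_on with
  | H x =>
    obtain ⟨n, hn, hx⟩ := exists_int_smul_mem hL.span_eq_top (x : V)
    refine ⟨⟨n, mem_nonZeroDivisors_of_ne_zero hn⟩, ?_⟩
    exact (Submodule.Quotient.mk_eq_zero _).2 hx

end

/-! ### Bounded denominators and convergence -/

section

variable {V : Type*} [AddCommGroup V] [Module ℚ V] {Q : QuadraticForm ℚ V} {L : Submodule ℤ V}

/-- Conjugation by `h` maps `t` to a vector whose coordinates have denominators dividing `D`. -/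
def HasDenominator {κ : Type*} (b : Module.Basis κ ℚ V) (h : GSpin (Q.baseChange Af)) (D : ℤ)
    (t : Af ⊗[ℚ] V) : Prop :=
  ∃ w : Af ⊗[ℚ] V, (h : (CliffordAlgebra (Q.baseChange Af))ˣ).val *
      CliffordAlgebra.ι (Q.baseChange Af) t *
      ((h : (CliffordAlgebra (Q.baseChange Af))ˣ)⁻¹).val = CliffordAlgebra.ι (Q.baseChange Af) w ∧
    ∀ i, IsIntegralAdele (D * (Algebra.TensorProduct.basis Af b).repr w i)

namespace HasDenominator

variable {κ : Type*} {b : Module.Basis κ ℚ V} {h : GSpin (Q.baseChange Af)} {D : ℤ}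
  {t t' : Af ⊗[ℚ] V}

theorem zero : HasDenominator b h D 0 :=
  ⟨0, by simp, fun i => by simpa using isIntegralAdele_zero⟩

theorem add (ht : HasDenominator b h D t) (ht' : HasDenominator b h D t') :
    HasDenominator b h D (t + t') := by
  obtain ⟨w, hw, hi⟩ := ht
  obtain ⟨w', hw', hi'⟩ := ht'
  refine ⟨w + w', by rw [map_add, map_add, mul_add, add_mul, hw, hw'], fun i => ?_⟩
  rw [map_add, Finsupp.add_apply, mul_add]
  exact (hi i).add (hi' i)

theorem smul (ht : HasDenominator b h D t) {a : Af} (ha : IsIntegralAdele a) :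
    HasDenominator b h D (a • t) := by
  obtain ⟨w, hw, hi⟩ := ht
  refine ⟨a • w, by rw [map_smul, map_smul, mul_smul_comm, smul_mul_assoc, hw], fun i => ?_⟩
  rw [map_smul, Finsupp.smul_apply, smul_eq_mul, mul_left_comm]
  exact ha.mul (hi i)

theorem neg (ht : HasDenominator b h D t) : HasDenominator b h D (-t) := by
  obtain ⟨w, hw, hi⟩ := ht
  refine ⟨-w, by rw [map_neg, map_neg, mul_neg, neg_mul, hw], fun i => ?_⟩
  rw [map_neg, Finsupp.neg_apply, mul_neg]
  exact (hi i).neg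

end HasDenominator

variable {κ : Type*} [Finite κ] (b : Module.Basis κ ℚ V)

/-- Conjugation by h is linear over the finite adeles, so it suffices to clear the denominators of
the images of finitely many generators and of x. -/
theorem exists_hasDenominator (hL : L.FG) (h : GSpin (Q.baseChange Af)) (x : V) :
    ∃ D : ℤ, D ≠ 0 ∧ HasDenominator b h D ((1 : Af) ⊗ₜ x) ∧
      ∀ t ∈ latticeHat L, HasDenominator b h D t := by
  classical
  cases nonempty_fintype κ
  obtain ⟨S, hS⟩ := hL
  choose w hw using fun y : V => h.2.2.2.1 ((1 : Af) ⊗ₜ[ℚ] y)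
  obtain ⟨D, hD, hDi⟩ := exists_common_denominator (insert x S ×ˢ (Finset.univ : Finset κ))
    fun p => (Algebra.TensorProduct.basis Af b).repr (w p.1) p.2
  have hgen : ∀ y ∈ insert x S, HasDenominator b h D ((1 : Af) ⊗ₜ y) := fun y hy =>
    ⟨w y, hw y, fun i => hDi (y, i) (Finset.mem_product.2 ⟨hy, Finset.mem_univ _⟩)⟩
  have hone : ∀ y ∈ L, HasDenominator b h D ((1 : Af) ⊗ₜ y) := by
    intro y hy
    rw [← hS] at hy
    induction hy using Submodule.span_induction with
    | mem y hy => exact hgen y (Finset.mem_insert_of_mem hy)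
    | zero => rw [TensorProduct.tmul_zero]; exact HasDenominator.zero
    | add y y' _ _ hy hy' => rw [TensorProduct.tmul_add]; exact hy.add hy'
    | smul n y _ hy =>
      have : (1 : Af) ⊗ₜ[ℚ] (n • y) = (n : Af) • ((1 : Af) ⊗ₜ[ℚ] y) := by
        rw [TensorProduct.tmul_smul]
        exact (Int.cast_smul_eq_zsmul Af n _).symm
      rw [this]
      exact hy.smul (isIntegralAdele_intCast n)
  refine ⟨D, hD, hgen x (Finset.mem_insert_self _ _), fun t ht => ?_⟩
  induction ht using AddSubgroup.closure_induction with
  | mem t ht =>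
    obtain ⟨a, ha, y, hy, rfl⟩ := ht
    have : a ⊗ₜ[ℚ] y = a • ((1 : Af) ⊗ₜ[ℚ] y) := by
      rw [TensorProduct.smul_tmul', smul_eq_mul, mul_one]
    rw [this]
    exact (hone y hy).smul ha
  | zero => exact HasDenominator.zero
  | add t t' _ _ ht ht' => exact ht.add ht'
  | neg t _ ht => exact ht.neg

theorem exists_denominator_cosetH (hL : L.FG) (h : GSpin (Q.baseChange Af)) (μ : Disc Q L) :
    ∃ D : ℤ, D ≠ 0 ∧ ∀ lam ∈ cosetH Q L h μ, ∀ i, ∃ n : ℤ, D * b.repr lam i = n := by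
  obtain ⟨x, rfl⟩ := Submodule.Quotient.mk_surjective _ μ
  obtain ⟨D, hD, hx, hDt⟩ := exists_hasDenominator b hL h (x : V)
  refine ⟨D, hD, fun lam hlam i => ?_⟩
  obtain ⟨x', hx', t, ht, heq⟩ := hlam
  have hd : (x' : V) - x ∈ L := by
    have := (Submodule.Quotient.eq _).1 hx'
    exact this
  have hmem : (1 : Af) ⊗ₜ[ℚ] ((x' : V) - x) + t ∈ latticeHat L :=
    add_mem (AddSubgroup.subset_closure ⟨1, isIntegralAdele_one, _, hd, rfl⟩) ht
  obtain ⟨w, hw, hi⟩ := hx.add (hDt _ hmem)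
  rw [← add_assoc, ← TensorProduct.tmul_add, add_sub_cancel, ← heq] at hw
  have hwl := ι_cliffordAlgebra_injective _ hw
  apply exists_int_of_isIntegralAdele
  have := hi i
  rw [← hwl, Algebra.TensorProduct.basis_repr_tmul, one_smul, Finsupp.mapRange_apply] at this
  simpa using this

/-- After multiplication by a common denominator, the vectors inject into a lattice in ℝ³, over
which negative powers of the norm are summable once the exponent exceeds the rank. -/
theorem exists_summable_realCoord [FiniteDimensional ℚ V]
    (σ : (Q.baseChange ℝ).IsometryEquiv detForm) (hL : L.FG) (h : GSpin (Q.baseChange Af))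
    (μ : Disc Q L) : ∃ r : ℕ, Summable fun lam : cosetH Q L h μ =>
      ((1 + ‖realCoord σ (lam : V)‖) ^ r)⁻¹ := by
  let b := Module.finBasis ℚ V
  obtain ⟨D, hD, hDi⟩ := exists_denominator_cosetH b hL h μ
  let B := realBasis σ b
  let Λ : Submodule ℤ (Fin 3 → ℝ) := Submodule.span ℤ (Set.range B)
  let r := Module.finrank ℤ Λ + 1
  have hmem : ∀ lam : cosetH Q L h μ, (D : ℝ) • realCoord σ (lam : V) ∈ Λ := by
    intro lam
    refine (B.mem_span_iff_repr_mem ℤ _).2 ?_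
    intro i
    obtain ⟨n, hn⟩ := hDi lam lam.2 i
    refine ⟨n, ?_⟩
    rw [map_smul, Finsupp.smul_apply, realBasis_repr]
    simp only [smul_eq_mul]
    have := congrArg (fun a : ℚ => (a : ℝ)) hn
    push_cast at this
    simpa using this.symm
  let e : cosetH Q L h μ → Λ := fun lam => ⟨_, hmem lam⟩
  have hD' : (D : ℝ) ≠ 0 := by exact_mod_cast hD
  have he : Function.Injective e := by
    intro lam lam' hll
    have := congrArg Subtype.val hll
    exact Subtype.ext (realCoord_injective σ (smul_right_injective _ hD' this))
  have hΛ : Summable fun z : Λ => ((1 + ‖z‖) ^ r)⁻¹ := by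
    refine Summable.of_norm_bounded_eventually
      (ZLattice.summable_norm_pow_inv Λ r (Nat.lt_succ_self _)) ?_
    -- The comparison fails at z = 0, where 0⁻¹ = 0; one exceptional vector does not affect
    -- summability.
    filter_upwards [(Set.finite_singleton (0 : Λ)).compl_mem_cofinite] with z hz
    have hz0 : 0 < ‖z‖ := norm_pos_iff.2 hz
    rw [Real.norm_of_nonneg (by positivity), inv_pow]
    gcongr
    linarith
  refine ⟨r, Summable.of_nonneg_of_le (fun lam => by positivity) (fun lam => ?_)
    ((hΛ.comp_injective he).mul_left (|(D : ℝ)| ^ r))⟩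
  have h1 : (1 : ℝ) ≤ |(D : ℝ)| := by exact_mod_cast Int.one_le_abs hD
  have h2 : ‖e lam‖ = |(D : ℝ)| * ‖realCoord σ (lam : V)‖ := by
    rw [← Real.norm_eq_abs, ← norm_smul]
    rfl
  simp only [Function.comp_apply]
  rw [h2, ← div_eq_mul_inv, le_div_iff₀ (by positivity), inv_mul_le_iff₀ (by positivity), ← mul_pow]
  refine pow_le_pow_left₀ (by positivity) ?_ r
  nlinarith [norm_nonneg (realCoord σ (lam : V))]

end

/-! ### The regularized theta lift -/

/-- Each component yields an entire function of s, so their finite sum does too, and its value at s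
= 0 is the constant term. -/
theorem IsFourierFamily.hasRegIntegral_sum {κ : Type*} (s : Finset κ) {ι : κ → Type*}
    {x : ∀ μ, ι μ → Fin 3 → ℝ} {f : κ → ℍ → ℂ} {c : κ → ℤ → ℂ} {q : κ → ℝ} {m : ∀ μ, ι μ → ℤ}
    {r : κ → ℕ} (h : ∀ μ, IsFourierFamily (x μ) (f μ) (c μ) (q μ) (m μ) (r μ)) (ℓ : ℕ) {k : ℕ}
    (hk : 1 ≤ k) {z : ℂ} (hz : z.im ≠ 0) :
    HasRegIntegral (fun τ => ∑ μ ∈ s, familyIntegrand ℓ k (f μ) (x μ) z τ)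
      (∑ μ ∈ s, familyLift ℓ k (f μ) (fun i => c μ (m μ i)) (x μ) z) := by
  have hb := fun μ => (h μ).exists_bounds_at ℓ hk hz
  choose C hC d hA using fun μ => (hb μ).1
  choose C' hC' d' b hb hB using fun μ => (hb μ).2
  refine hasRegIntegral_of_differentiable (G := fun t => ∑ μ ∈ s, (z.im : ℂ) ^ (-(2 * k : ℤ)) *
    (liftA ℓ k (f μ) (x μ) t z (starRingEnd ℂ z) +
      liftB ℓ k (fun i => c μ (m μ i)) (x μ) t z (starRingEnd ℂ z))) ?_ (fun t T => ?_) fun t => ?_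
  · exact Differentiable.fun_sum fun μ _ => (((hA μ).differentiable_liftA (hC μ) (h μ).summ
      (h μ).cont).add ((hB μ).differentiable_liftB (hb μ) (h μ).summ)).const_mul _
  · simp only [Finset.sum_mul]
    exact integrable_finsetSum _ fun μ _ => (h μ).integrableOn_familyIntegrand hz (hA μ) (hC μ) t T
  · simp only [Finset.sum_mul]
    have : (fun T : ℝ => ∫ τ in truncFD T, ∑ μ ∈ s,
        familyIntegrand ℓ k (f μ) (x μ) z τ * (τ.im : ℂ) ^ (-t)) = fun T : ℝ => ∑ μ ∈ s,
        ∫ τ in truncFD T, familyIntegrand ℓ k (f μ) (x μ) z τ * (τ.im : ℂ) ^ (-t) :=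
      funext fun T => integral_finsetSum _ fun μ _ =>
        (h μ).integrableOn_familyIntegrand hz (hA μ) (hC μ) t T
    rw [this]
    exact tendsto_finsetSum _ fun μ _ =>
      (h μ).tendsto_integral_truncFD hz (hA μ) (hC μ) (hB μ) (hb μ) t

section

variable {V : Type*} [AddCommGroup V] [Module ℚ V] {Q : QuadraticForm ℚ V} {L : Submodule ℤ V}

theorem mul_theta_eq_familyIntegrand (σ : (Q.baseChange ℝ).IsometryEquiv detForm) (ℓ k : ℕ)
    (f : ℍ → Disc Q L → ℂ) (z : ℂ) (h : GSpin (Q.baseChange Af)) (τ : ℍ) (μ : Disc Q L) :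
    f τ μ * theta Q σ L ℓ k τ z h μ =
      familyIntegrand ℓ k (fun τ => f τ μ)
        (fun lam : cosetH Q L h μ => realCoord σ (lam : V)) z τ := by
  simp only [theta, familyIntegrand, vecMat_realCoord]

theorem exists_isFourierFamily [FiniteDimensional ℚ V]
    (σ : (Q.baseChange ℝ).IsometryEquiv detForm) (hL : IsEvenLattice Q L) {κ : ℝ}
    {f : ℍ → Disc Q L → ℂ} (hf : IsWeaklyHolomorphic Q L κ f) (h : GSpin (Q.baseChange Af))
    (μ : Disc Q L) : ∃ (c : ℤ → ℂ) (q : ℝ) (m : cosetH Q L h μ → ℤ) (r : ℕ),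
      IsFourierFamily (fun lam : cosetH Q L h μ => realCoord σ (lam : V)) (fun τ => f τ μ)
        c q m r := by
  obtain ⟨x, rfl⟩ := Submodule.Quotient.mk_surjective _ μ
  obtain ⟨c, hc, hsum⟩ := hf.fourier x
  obtain ⟨r, hr⟩ := exists_summable_realCoord σ hL.fg h (Submodule.Quotient.mk x)
  choose m hm using fun lam : cosetH Q L h (Submodule.Quotient.mk x) =>
    exists_int_sub_of_mem_cosetH hL h x lam.2
  refine ⟨c, ((Q (x : V) : ℚ) : ℝ), m, r, ⟨?_, hr, hc, fun τ => ?_, fun lam => ?_⟩⟩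
  · have := (hf.holo (Submodule.Quotient.mk x)).continuousOn.comp_continuous
      UpperHalfPlane.continuous_coe fun τ => τ.im_pos
    refine this.congr fun τ => ?_
    simp only [Function.comp_apply, UpperHalfPlane.ofComplex_apply]
  · simpa using hsum τ
  · rw [detV_realCoord, hm lam]
    push_cast
    ring

end

end OverReg

/-! ### Assembly over the discriminant group -/

theorem proposition2p4 {V : Type*} [AddCommGroup V] [Module ℚ V] [FiniteDimensional ℚ V]
    (Q : QuadraticForm ℚ V) (σ : (Q.baseChange ℝ).IsometryEquiv OverReg.detForm)
    (L : Submodule ℤ V) (hL : OverReg.IsEvenLattice Q L)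
    (ℓ k : ℕ) (hk : 1 ≤ k)
    (f : UpperHalfPlane → OverReg.Disc Q L → ℂ)
    (hf : OverReg.IsWeaklyHolomorphic Q L ((k : ℝ) - (ℓ : ℝ) + 1 / 2) f)
    (z₀ : ℂ) (hz₀ : z₀.im ≠ 0) (h₀ : OverReg.GSpin (Q.baseChange OverReg.Af)) :
    (∃ c : ℂ, OverReg.HasRegIntegral (OverReg.integrand Q σ L ℓ k f z₀ h₀) c) ∧
    ∃ a b : ℤ × ℤ → ℂ,
      OverReg.HasLogLaurentExpansion
        (OverReg.localForm (fun z => OverReg.thetaLift Q σ L ℓ k f z h₀) (2 * k) z₀) a b ∧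
      (ℓ < 2 * k → b = 0) ∧
      a (0, 0) = OverReg.thetaLift Q σ L ℓ k f z₀ h₀ := by
  have hfin := OverReg.finite_disc σ hL
  cases nonempty_fintype (OverReg.Disc Q L)
  choose c q m r hfam using OverReg.exists_isFourierFamily σ hL hf h₀
  let Φ : ℂ → ℂ := fun z => ∑ μ, OverReg.familyLift ℓ k (fun τ => f τ μ) (fun i => c μ (m μ i))
    (fun lam : OverReg.cosetH Q L h₀ μ => OverReg.realCoord σ (lam : V)) z
  have hreg : ∀ z : ℂ, z.im ≠ 0 →
      OverReg.HasRegIntegral (OverReg.integrand Q σ L ℓ k f z h₀) (Φ z) := by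
    intro z hz
    have hint : OverReg.integrand Q σ L ℓ k f z h₀ = fun τ => ∑ μ, OverReg.familyIntegrand ℓ k
        (fun τ => f τ μ)
        (fun lam : OverReg.cosetH Q L h₀ μ => OverReg.realCoord σ (lam : V)) z τ := by
      funext τ
      rw [OverReg.integrand, finsum_eq_sum_of_fintype]
      exact Finset.sum_congr rfl fun μ _ => OverReg.mul_theta_eq_familyIntegrand σ ℓ k f z h₀ τ μ
    rw [hint]
    exact OverReg.IsFourierFamily.hasRegIntegral_sum Finset.univ hfam ℓ hk hz
  have hlift : ∀ z : ℂ, z.im ≠ 0 → OverReg.thetaLift Q σ L ℓ k f z h₀ = Φ z := fun z hz =>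
    (hreg z hz).regIntegral_eq
  refine ⟨⟨_, hreg z₀ hz₀⟩, ?_⟩
  rw [hlift z₀ hz₀]
  -- For |w| < 1 the point z stays off the real line, so there the lift equals the finite sum Φ, and
  -- the expansions of the components add up, constant terms included.
  refine (OverReg.HasExpansion.sum (P := ℓ < 2 * k) Finset.univ fun μ _ =>
    (hfam μ).hasExpansion ℓ hk hz₀).congr one_pos fun w _ hw => ?_
  rw [← Finset.mul_sum, OverReg.localForm]
  exact congrArg _ (hlift _ (OverReg.im_localPoint_ne_zero hz₀ hw))
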